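/- **Theorem 5.1.** Let $M$ be a smooth manifold and $G$ a connected Lie group. Let $(e_i)$ be a basis of $T_eG$ and let $\omega_L^i$ and $\omega_R^i$ be the left and right invariant Maurer–Cartan forms on $G$ which at the identity $e$ coincide with the basis dual to $(e_i)$. Let $C^i_{jk}$ be the structure constants, so that (with summation over repeated indices) $$d\omega_L^i=\tfrac12 C^i_{jk}\,\omega_L^j\wedge\omega_L^k ,\qquad d\omega_R^i=-\tfrac12 C^i_{jk}\,\omega_R^j\wedge\omega_R^k .$$ Let $X_i^L$ and $X_i^R$ be the dual bases of left and right invariant vector fields on $G$. [i] Suppose that $G$ acts smoothly on $M$ on the right, $(x,g)\mapsto\hat\mu(x,g)$, and on the left, $(g,x)\mapsto\check\mu(g,x)$, and that these two actions commute, are free, are regular, and have the same orbits. (An action is regular if the orbit space, with the quotient topology, has a smooth manifold structure for which the projection from $M$ is a smooth submersion admitting smooth local cross-sections about each point of the orbit space; the orbit space need not be Hausdorff.) Let $\hat X_i$ and $\check X_i$ be the infinitesimal generators of these actions, that is, the images of $X^L_i$ and $X^R_i$ under the orbit maps $g\mapsto\hat\mu(x,g)$ and $g\mapsto\check\mu(g,x)$,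 $x\in M$. [ii] Suppose that $\hat\omega^i$ and $\check\omega^i$ are smooth 1-forms on $M$ such that * [a] $\hat\omega^i(\hat X_j)=\delta^i_j$ and $\check\omega^i(\check X_j)=\delta^i_j$; * [b] $\operatorname{span}\{\hat\omega^i\}=\operatorname{span}\{\check\omega^i\}$ at every point of $M$, and $\hat\omega^i(x_0)=\check\omega^i(x_0)$ for all $i$ at some fixed point $x_0\in M$; * [c] $d\hat\omega^i=\tfrac12 C^i_{jk}\,\hat\omega^j\wedge\hat\omega^k$ and $d\check\omega^i=-\tfrac12 C^i_{jk}\,\check\omega^j\wedge\check\omega^k$. Then about each point of the connected component of $x_0$ in $M$ (hence about each point of $M$, if $M$ is connected) there are an open set $\mathcal U\subset M$, invariant under both actions, and a smooth map $\rho:\mathcal U\to G$ such that $$\rho^*(\omega_L^i)=\hat\omega^i,\qquad \rho^*(\omega_R^i)=\check\omega^i,\qquad \rho(\hat\mu(x,g))=\rho(x)\,g,\qquad \rho(\check\mu(g,x))=g\,\rho(x)$$ for all $x\in\mathcal U$ and $g\in G$. If the orbit space $M/G$ is simply connected, then one can take $\mathcal U=M$. -/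

import Mathlib

open scoped Manifold ContDiff
open Set

noncomputable section

namespace MaurerCartan

section Forms

variable {E M : Type*} [NormedAddCommGroup E] [NormedSpace ℝ E]
  [TopologicalSpace M] [ChartedSpace E M]

variable (E M) in
/-- Differential `1`-forms (not necessarily smooth) on a manifold `M` modelled on `E`. -/
abbrev OneForm : Type _ := (x : M) → TangentSpace 𝓘(ℝ, E) x →L[ℝ] ℝ

/-- A `1`-form is smooth if it is a smooth section of the cotangent bundle. -/
def OneForm.IsSmooth [IsManifold 𝓘(ℝ, E) ∞ M] (α : OneForm E M) : Prop :=
  ContMDiff 𝓘(ℝ, E) (𝓘(ℝ, E).prod 𝓘(ℝ, E →L[ℝ] ℝ)) ∞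
    (fun x ↦ Bundle.TotalSpace.mk' (E →L[ℝ] ℝ)
      (E := fun x : M ↦ TangentSpace 𝓘(ℝ, E) x →L[ℝ] Bundle.Trivial M ℝ x) x (α x))

/-- The coordinate expression of a `1`-form in the preferred chart at `x₀`, that is, its pullback
by the inverse of that chart (meaningful on the target of the chart, an open subset of `E`). -/
def OneForm.inChart (α : OneForm E M) (x₀ : M) (y : E) : E →L[ℝ] ℝ :=
  (α ((extChartAt 𝓘(ℝ, E) x₀).symm y)).comp
    (mfderiv 𝓘(ℝ, E) 𝓘(ℝ, E) (extChartAt 𝓘(ℝ, E) x₀).symm y)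

/-- The exterior derivative `dα` of a `1`-form, as an alternating bilinear form on each tangent
space. It is computed at `x` in the preferred chart at `x`; the derivative at `x` of that
chart is the identification of `TangentSpace 𝓘(ℝ, E) x` with `E`. -/
def OneForm.d (α : OneForm E M) (x : M) : TangentSpace 𝓘(ℝ, E) x [⋀^Fin 2]→L[ℝ] ℝ :=
  (extDeriv
    (fun y : E ↦ ContinuousAlternatingMap.ofSubsingleton ℝ E ℝ (0 : Fin 1) (α.inChart x y))
    (extChartAt 𝓘(ℝ, E) x x) : E [⋀^Fin 2]→L[ℝ] ℝ)

/-- The structure equations `dαⁱ = ½ ∑ C i j k αʲ ∧ αᵏ`, where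
`(αʲ ∧ αᵏ)(v, w) = αʲ(v) αᵏ(w) - αʲ(w) αᵏ(v)`. -/
def SatisfiesStructureEquations {ι : Type*} [Fintype ι] (C : ι → ι → ι → ℝ)
    (α : ι → OneForm E M) : Prop :=
  ∀ (i : ι) (x : M) (v w : TangentSpace 𝓘(ℝ, E) x),
    OneForm.d (α i) x ![v, w] =
      (1 / 2 : ℝ) * ∑ j, ∑ k, C i j k * (α j x v * α k x w - α j x w * α k x v)

end Forms

section Group

variable {EG G : Type*} [NormedAddCommGroup EG] [NormedSpace ℝ EG] [FiniteDimensional ℝ EG]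
  [TopologicalSpace G] [ChartedSpace EG G] [Group G] {ι : Type*}

instance (g : G) : FiniteDimensional ℝ (TangentSpace 𝓘(ℝ, EG) g) :=
  inferInstanceAs (FiniteDimensional ℝ EG)

instance (g : G) : T2Space (TangentSpace 𝓘(ℝ, EG) g) :=
  inferInstanceAs (T2Space EG)

/-- The left invariant Maurer-Cartan forms of a Lie group attached to a basis `b` of its Lie
algebra: `ω_Lⁱ(g) = bⁱ ∘ (L_{g⁻¹})_*`, with `bⁱ` the basis dual to `b`. -/
def leftForm (b : Module.Basis ι ℝ (GroupLieAlgebra 𝓘(ℝ, EG) G)) (i : ι) : OneForm EG G :=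
  fun g ↦ (LinearMap.toContinuousLinearMap (b.coord i)).comp
    (mfderiv 𝓘(ℝ, EG) 𝓘(ℝ, EG) (fun h : G ↦ g⁻¹ * h) g)

/-- The right invariant Maurer-Cartan forms of a Lie group attached to a basis `b` of its Lie
algebra: `ω_Rⁱ(g) = bⁱ ∘ (R_{g⁻¹})_*`. They agree with the left invariant ones at the identity. -/
def rightForm (b : Module.Basis ι ℝ (GroupLieAlgebra 𝓘(ℝ, EG) G)) (i : ι) : OneForm EG G :=
  fun g ↦ (LinearMap.toContinuousLinearMap (b.coord i)).comp
    (mfderiv 𝓘(ℝ, EG) 𝓘(ℝ, EG) (fun h : G ↦ h * g⁻¹) g)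

end Group

section Actions

variable {E M EG G : Type*} [NormedAddCommGroup E] [NormedSpace ℝ E]
  [TopologicalSpace M] [ChartedSpace E M]
  [NormedAddCommGroup EG] [NormedSpace ℝ EG] [TopologicalSpace G] [ChartedSpace EG G] [Group G]

variable (E M) in
/-- An action of `Γ` on `M` is regular if the orbit space `M/Γ`, with the quotient
topology, has a smooth manifold structure for which the projection is a smooth submersion with
smooth local cross-sections. (Separation axioms are not imposed on `M/Γ`.) -/
def IsRegularAction (Γ : Type*) [Group Γ] [MulAction Γ M] : Prop :=
  ∃ (k : ℕ) (_ : ChartedSpace (EuclideanSpace ℝ (Fin k)) (MulAction.orbitRel.Quotient Γ M)),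
    IsManifold (𝓡 k) ∞ (MulAction.orbitRel.Quotient Γ M) ∧
    Manifold.IsSubmersion 𝓘(ℝ, E) (𝓡 k) ∞
      (fun x : M ↦ (Quotient.mk _ x : MulAction.orbitRel.Quotient Γ M)) ∧
    ∀ z : MulAction.orbitRel.Quotient Γ M, ∃ V : Set (MulAction.orbitRel.Quotient Γ M),
      IsOpen V ∧ z ∈ V ∧ ∃ s : MulAction.orbitRel.Quotient Γ M → M,
        ContMDiffOn (𝓡 k) 𝓘(ℝ, E) ∞ s V ∧
        ∀ v ∈ V, (Quotient.mk _ (s v) : MulAction.orbitRel.Quotient Γ M) = v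

/-- The infinitesimal generator at `x` of a left action corresponding to `ξ ∈ T_e G`, i.e. the
pushforward, by the orbit map `g ↦ g • x`, of the right invariant vector field with value `ξ`
at `e`. -/
def leftGenerator [MulAction G M] (ξ : GroupLieAlgebra 𝓘(ℝ, EG) G) (x : M) :
    TangentSpace 𝓘(ℝ, E) x :=
  mfderiv 𝓘(ℝ, EG) 𝓘(ℝ, E) (fun g : G ↦ g • x) 1 ξ

/-- The infinitesimal generator at `x` of a right action corresponding to `ξ ∈ T_e G`, i.e. the
pushforward, by the orbit map `g ↦ x · g`, of the left invariant vector field with value `ξ`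
at `e`. A right action of `G` is an action of the opposite group: `x · g = op g • x`. -/
def rightGenerator [MulAction Gᵐᵒᵖ M] (ξ : GroupLieAlgebra 𝓘(ℝ, EG) G) (x : M) :
    TangentSpace 𝓘(ℝ, E) x :=
  mfderiv 𝓘(ℝ, EG) 𝓘(ℝ, E) (fun g : G ↦ MulOpposite.op g • x) 1 ξ

/-- `ρ` is a smooth map `U → G` (with irrelevant values outside the open set `U`) such that
`ρ^* ω_Lⁱ = ω̂ⁱ`, `ρ^* ω_Rⁱ = ω̌ⁱ`, `ρ (x · g) = ρ x * g` and `ρ (g · x) = g * ρ x` on `U`. -/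
structure IsBiequivariantPrimitive [FiniteDimensional ℝ EG] [MulAction G M] [MulAction Gᵐᵒᵖ M]
    {ι : Type*} (b : Module.Basis ι ℝ (GroupLieAlgebra 𝓘(ℝ, EG) G))
    (ωhat ωcheck : ι → OneForm E M) (U : Set M) (ρ : M → G) : Prop where
  contMDiffOn : ContMDiffOn 𝓘(ℝ, E) 𝓘(ℝ, EG) ∞ ρ U
  pullback_left : ∀ i, ∀ x ∈ U,
    (leftForm b i (ρ x)).comp (mfderiv 𝓘(ℝ, E) 𝓘(ℝ, EG) ρ x) = ωhat i x
  pullback_right : ∀ i, ∀ x ∈ U,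
    (rightForm b i (ρ x)).comp (mfderiv 𝓘(ℝ, E) 𝓘(ℝ, EG) ρ x) = ωcheck i x
  map_right_action : ∀ x ∈ U, ∀ g : G, ρ (MulOpposite.op g • x) = ρ x * g
  map_left_action : ∀ x ∈ U, ∀ g : G, ρ (g • x) = g * ρ x

end Actions

end MaurerCartan

end

/-! Let `N` be the orbit space and `π : M → N` the projection. For the right action, `π` is a
principal bundle on which `θ = ωhat` is a flat connection: duality fixes `θ` on the generators, and
the structure equations carry no curvature term. The same holds for the left action and `θ' =
ωcheck`, and the span condition says that both connections have the same horizontal spaces.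
Equivariance of the forms is not assumed; it comes from the structure equations. While a tangent
vector is moved by the group, their mixed vertical-horizontal component is a homogeneous linear
differential equation for its values under the forms, so translates of horizontal leaves are
horizontal (`IsFlatPlot.translate`).

Frobenius (`exists_hasFDerivAt_of_commuting`, `IsFlatConnection.exists_isFlatPlot`) gives a local
flat section `σ` of `π`, and `x = σ(π x) · ρ(x)` defines `ρ`. In the coordinates `(p, g) ↦ σ(p) · g`
the translates of the leaf are horizontal and the orbits carry `ω_L`, whence `ρ^* ω_L = θ`
(`IsFlatPlot.primitive`).

For `ρ` to serve the left action too, `σ` has to lie in the set `S` of points `x` with `g · x = x ·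
g` for all `g`. At `x₀` the two families of generators coincide, hence so do the orbit maps, `G`
being connected: `x₀ ∈ S` (`smul_eq_op_smul`). A left translate of a leaf is a leaf, and `ρ` is
constant along leaves, so a local flat section that meets `S` stays in it
(`smul_section_eq_op_smul`). The points whose orbit meets `S` therefore form an open and closed set,
which contains the component of `x₀`. Over a section in `S` one has `x = σ · ρ = ρ · σ`, and the
same argument for the left action gives `ρ^* ω_R = θ'`.

Two such local maps differ by left multiplication by a locally constant element of the centre of
`G`. These elements form a cocycle on `N`, which is a coboundary when `N` is simply connected
(`exists_coboundary_of_simplyConnectedSpace`); correcting by it glues the local maps. -/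

noncomputable section

namespace MaurerCartan

/-! ### Frobenius theorem for total differential equations -/

section TotalODE

open Metric Filter Topology
open scoped NNReal

variable {F E : Type*} [NormedAddCommGroup F] [NormedSpace ℝ F]
  [NormedAddCommGroup E] [NormedSpace ℝ E]

/-- Time-one trajectories, staying in a ball, of the vector fields `y ↦ H y p` for small `p`. -/
theorem exists_trajectory_mem_closedBall [CompleteSpace E] {H : E → F →L[ℝ] E} {y₀ : E}
    {R : ℝ} {K L : ℝ≥0} (hR : 0 < R)
    (hlip : LipschitzOnWith K H (closedBall y₀ R)) (hL : ∀ y ∈ closedBall y₀ R, ‖H y‖ ≤ L)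
    {p : F} (hp : L * ‖p‖ ≤ R) :
    ∃ γ : ℝ → E, γ 0 = y₀ ∧ (∀ t, γ t ∈ closedBall y₀ R) ∧
      ∀ t ∈ Icc (0 : ℝ) 1, HasDerivWithinAt γ (H (γ t) p) (Icc 0 1) t := by
  lift R to ℝ≥0 using hR.le
  have hPL : IsPicardLindelof (fun (_ : ℝ) y ↦ H y p) (⟨0, by simp⟩ : Icc (0 : ℝ) 1) y₀
      R 0 (L * ‖p‖₊) (K * ‖p‖₊) := by
    refine ⟨fun t _ ↦ ?_, fun x _ ↦ continuousOn_const, fun t _ x hx ↦ ?_, ?_⟩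
    · refine LipschitzOnWith.of_dist_le_mul fun x hx y hy ↦ ?_
      have := hlip.dist_le_mul x hx y hy
      rw [dist_eq_norm] at this ⊢
      rw [← sub_apply]
      refine ((H x - H y).le_opNorm p).trans ?_
      push_cast
      nlinarith [norm_nonneg p]
    · refine ((H x).le_opNorm p).trans ?_
      push_cast
      exact mul_le_mul_of_nonneg_right (hL x hx) (norm_nonneg _)
    · simpa using hp
  obtain ⟨α, hα⟩ := ODE.FunSpace.exists_isFixedPt_next hPL
    (x := y₀) (by simp)
  refine ⟨α.compProj, ?_, fun t ↦ α.compProj_mem_closedBall hPL.mul_max_le, fun t ht ↦ ?_⟩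
  · have := ODE.FunSpace.compProj_val (α := α) (t := (⟨0, by simp⟩ : Icc (0 : ℝ) 1))
    rw [← hα, ODE.FunSpace.next_apply₀, hα] at this
    exact this
  · apply ODE.hasDerivWithinAt_picard_Icc (t₀ := 0) (by simp) hPL.continuousOn_uncurry
      α.continuous_compProj.continuousOn (fun _ ht' ↦ α.compProj_mem_closedBall hPL.mul_max_le)
      y₀ ht |>.congr_of_mem _ ht
    intro t' ht'
    nth_rw 1 [← hα]
    rw [ODE.FunSpace.compProj_of_mem ht', ODE.FunSpace.next_apply]

/-- Mean value inequality for `H` minus its linear part at `y`, whose derivative on the segment is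
at most `K * ‖z - y‖`. -/
theorem norm_sub_sub_le_of_lipschitzOnWith_fderiv {G : Type*} [NormedAddCommGroup G]
    [NormedSpace ℝ G] {H : E → G} {s : Set E} (hs : Convex ℝ s) {K : ℝ≥0}
    (hd : ∀ y ∈ s, DifferentiableAt ℝ H y) (hlip : LipschitzOnWith K (fderiv ℝ H) s)
    {y z : E} (hy : y ∈ s) (hz : z ∈ s) :
    ‖H z - H y - fderiv ℝ H y (z - y)‖ ≤ K * ‖z - y‖ ^ 2 := by
  have hseg : segment ℝ y z ⊆ s := hs.segment_subset hy hz
  have := (convex_segment y z).norm_image_sub_le_of_norm_hasFDerivWithin_le' (f := H)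
    (f' := fderiv ℝ H) (φ := fderiv ℝ H y) (C := K * ‖z - y‖) (𝕜 := ℝ)
    (fun x hx ↦ (hd x (hseg hx)).hasFDerivAt.hasFDerivWithinAt) (fun x hx ↦ ?_)
    (left_mem_segment ℝ y z) (right_mem_segment ℝ y z)
  · refine this.trans (le_of_eq (by ring))
  · have h1 := hlip.dist_le_mul x (hseg hx) y hy
    rw [dist_eq_norm, dist_eq_norm] at h1
    refine h1.trans (mul_le_mul_of_nonneg_left ?_ K.2)
    exact norm_sub_le_of_mem_segment hx

/-- The curve `t ↦ γ t + t • H (γ t) w` solves the equation of `η` up to an error of order `‖w‖ ^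
2`, precisely because the fields commute; Gronwall's inequality then compares it with `η`. At time
one this says that `H (γ 1)` is the derivative of the endpoint with respect to `p`. -/
theorem norm_sub_le_sq_of_trajectories {H : E → F →L[ℝ] E} {y₀ : E} {R : ℝ} {K K₂ L : ℝ≥0}
    (hlip : LipschitzOnWith K H (closedBall y₀ R)) (hL : ∀ y ∈ closedBall y₀ R, ‖H y‖ ≤ L)
    (hd : ∀ y ∈ closedBall y₀ R, DifferentiableAt ℝ H y)
    (hdb : ∀ y ∈ closedBall y₀ R, ‖fderiv ℝ H y‖ ≤ K)
    (hlip₂ : LipschitzOnWith K₂ (fderiv ℝ H) (closedBall y₀ R))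
    (hcomm : ∀ y ∈ closedBall y₀ R, ∀ v w,
      fderiv ℝ H y (H y v) w = fderiv ℝ H y (H y w) v)
    {p w : F} {D : ℝ≥0} (hD : ‖p + w‖ ≤ D) (hw : L * ‖w‖ ≤ R / 2) {γ η : ℝ → E}
    (h0 : γ 0 = η 0)
    (hγ : ∀ t, γ t ∈ closedBall y₀ (R / 2))
    (hη : ∀ t, η t ∈ closedBall y₀ (R / 2))
    (hγ' : ∀ t ∈ Icc (0 : ℝ) 1, HasDerivWithinAt γ (H (γ t) p) (Icc 0 1) t)
    (hη' : ∀ t ∈ Icc (0 : ℝ) 1, HasDerivWithinAt η (H (η t) (p + w)) (Icc 0 1) t) :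
    ‖η 1 - (γ 1 + H (γ 1) w)‖ ≤ gronwallBound 0 (K * D) (K * L + K₂ * L ^ 2 * D) 1 * ‖w‖ ^ 2 := by
  have hR : 0 ≤ R / 2 := le_trans (by positivity) hw
  have hsub : closedBall y₀ (R / 2) ⊆ closedBall y₀ R := closedBall_subset_closedBall (by linarith)
  have hIci : ∀ {f : ℝ → E} {f' : E} {t : ℝ}, t ∈ Ico (0 : ℝ) 1 →
      HasDerivWithinAt f f' (Icc 0 1) t → HasDerivWithinAt f f' (Ici t) t := by
    intro f f' t ht h
    exact (h.mono (Icc_subset_Icc_left ht.1)).mono_of_mem_nhdsWithin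
      (Icc_mem_nhdsGE ht.2)
  -- The first-order guess for `η`. It may leave the half ball containing `γ`, but by `hw` it stays
  -- in the ball of radius `R`.
  set g : ℝ → E := fun t ↦ γ t + t • H (γ t) w with hg
  have hgR : ∀ t ∈ Icc (0 : ℝ) 1, g t ∈ closedBall y₀ R := by
    intro t ht
    have h1 := hγ t
    rw [mem_closedBall, dist_eq_norm] at h1 ⊢
    have h2 : ‖t • H (γ t) w‖ ≤ R / 2 := by
      rw [norm_smul, Real.norm_of_nonneg ht.1]
      calc t * ‖H (γ t) w‖ ≤ 1 * (L * ‖w‖) :=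
            mul_le_mul ht.2 (((H (γ t)).le_opNorm w).trans
              (mul_le_mul_of_nonneg_right (hL _ (hsub (hγ t))) (norm_nonneg _)))
              (norm_nonneg _) zero_le_one
        _ ≤ R / 2 := by linarith
    calc ‖g t - y₀‖ = ‖(γ t - y₀) + t • H (γ t) w‖ := by simp only [hg]; congr 1; abel
      _ ≤ _ := norm_add_le _ _
      _ ≤ R := by linarith
  have hg' : ∀ t ∈ Icc (0 : ℝ) 1, HasDerivWithinAt g
      (H (γ t) p + (t • fderiv ℝ H (γ t) (H (γ t) p) w + (1 : ℝ) • H (γ t) w)) (Icc 0 1) t := by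
    intro t ht
    have h1 : HasDerivWithinAt (fun t ↦ H (γ t)) (fderiv ℝ H (γ t) (H (γ t) p)) (Icc 0 1) t :=
      (hd _ (hsub (hγ t))).hasFDerivAt.comp_hasDerivWithinAt t (hγ' t ht)
    have h2 : HasDerivWithinAt (fun t ↦ H (γ t) w) (fderiv ℝ H (γ t) (H (γ t) p) w)
        (Icc 0 1) t := by
      simpa using h1.clm_apply (hasDerivWithinAt_const t (Icc 0 1) w)
    exact (hγ' t ht).add ((hasDerivWithinAt_id t _).smul h2)
  have key := dist_le_of_approx_trajectories_ODE_of_mem (v := fun _ y ↦ H y (p + w))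
    (s := fun _ ↦ closedBall y₀ R) (K := K * D) (a := 0) (b := 1) (f := η) (g := g)
    (f' := fun t ↦ H (η t) (p + w))
    (g' := fun t ↦ H (γ t) p + (t • fderiv ℝ H (γ t) (H (γ t) p) w + (1 : ℝ) • H (γ t) w))
    (εf := 0) (εg := (K * L + K₂ * L ^ 2 * D) * ‖w‖ ^ 2) (δ := 0)
    (fun t _ ↦ ?_) (fun t ht ↦ (hη' t ht).continuousWithinAt)
    (fun t ht ↦ hIci ht (hη' t (Ico_subset_Icc_self ht))) (fun t _ ↦ by simp)
    (fun t _ ↦ hsub (hη t)) (fun t ht ↦ (hg' t ht).continuousWithinAt)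
    (fun t ht ↦ hIci ht (hg' t (Ico_subset_Icc_self ht))) (fun t ht ↦ ?_)
    (fun t ht ↦ hgR t (Ico_subset_Icc_self ht)) (by simp [hg, h0]) 1 (by simp)
  · rw [dist_eq_norm, zero_add, sub_zero] at key
    have hg1 : g 1 = γ 1 + H (γ 1) w := by simp [hg]
    rw [hg1] at key
    refine key.trans (le_of_eq ?_)
    -- `gronwallBound` has a separate formula at rate zero; in both cases it is linear in the error
    -- when the initial gap is zero, so `‖w‖ ^ 2` factors out.
    by_cases hK : ((K * D : ℝ≥0) : ℝ) = 0
    · push_cast at hK ⊢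
      simp [hK, gronwallBound_K0]
    · push_cast at hK ⊢
      simp only [gronwallBound_of_K_ne_0 hK]; ring
  · refine LipschitzOnWith.of_dist_le_mul fun x hx y hy ↦ ?_
    have := hlip.dist_le_mul x hx y hy
    rw [dist_eq_norm] at this ⊢
    rw [← sub_apply]
    refine ((H x - H y).le_opNorm _).trans ?_
    push_cast
    calc ‖H x - H y‖ * ‖p + w‖ ≤ (K * dist x y) * D :=
          mul_le_mul this hD (norm_nonneg _) (by positivity)
      _ = _ := by ring
  · have htI := Ico_subset_Icc_self ht
    set y := γ t with hy
    have hyR := hsub (hγ t)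
    rw [← hy] at hyR
    have hTaylor := norm_sub_sub_le_of_lipschitzOnWith_fderiv (convex_closedBall y₀ R) hd hlip₂
      hyR (hgR t htI)
    have hgy : g t - y = t • H y w := by simp [hg, hy]
    rw [hgy] at hTaylor
    have hHw : ‖H y w‖ ≤ L * ‖w‖ := ((H y).le_opNorm w).trans
      (mul_le_mul_of_nonneg_right (hL _ hyR) (norm_nonneg _))
    have htH : ‖t • H y w‖ ≤ L * ‖w‖ := by
      rw [norm_smul, Real.norm_of_nonneg ht.1]
      calc t * ‖H y w‖ ≤ 1 * (L * ‖w‖) :=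
            mul_le_mul htI.2 hHw (norm_nonneg _) zero_le_one
        _ = _ := one_mul _
    -- Commutation turns `DH(H p) w` into `DH(H w) p`, which cancels the first-order term of `H (g
    -- t) p`. Only a term quadratic in `w` and the Taylor remainder survive.
    have hexp : (H y p + (t • fderiv ℝ H y (H y p) w + (1 : ℝ) • H y w)) - H (g t) (p + w)
        = -(t • fderiv ℝ H y (H y w) w)
          - (H (g t) - H y - fderiv ℝ H y (t • H y w)) (p + w) := by
      rw [hcomm y hyR p w]
      simp only [sub_apply, map_add, map_smul, one_smul,
        smul_apply]
      abel
    rw [dist_eq_norm, hexp]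
    have hA : ‖-(t • fderiv ℝ H y (H y w) w)‖ ≤ K * L * ‖w‖ ^ 2 := by
      rw [norm_neg, ← smul_apply, ← map_smul]
      calc ‖fderiv ℝ H y (t • H y w) w‖ ≤ ‖fderiv ℝ H y (t • H y w)‖ * ‖w‖ :=
            ContinuousLinearMap.le_opNorm _ _
        _ ≤ (K * (L * ‖w‖)) * ‖w‖ := by
            refine mul_le_mul_of_nonneg_right ?_ (norm_nonneg _)
            exact (ContinuousLinearMap.le_opNorm _ _).trans
              (mul_le_mul (hdb y hyR) htH (norm_nonneg _) K.2)
        _ = _ := by ring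
    have hB : ‖(H (g t) - H y - fderiv ℝ H y (t • H y w)) (p + w)‖ ≤
        K₂ * L ^ 2 * D * ‖w‖ ^ 2 := by
      calc _ ≤ ‖H (g t) - H y - fderiv ℝ H y (t • H y w)‖ * ‖p + w‖ :=
            ContinuousLinearMap.le_opNorm _ _
        _ ≤ (K₂ * (L * ‖w‖) ^ 2) * D := by
            refine mul_le_mul (hTaylor.trans ?_) hD (norm_nonneg _) (by positivity)
            gcongr
        _ = _ := by ring
    refine (norm_sub_le _ _).trans ?_
    linarith

/-- Frobenius: the total differential equation `Ds(p) = H (s p)` is locally solvable when the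
vector fields `y ↦ H y v` commute. -/
theorem exists_hasFDerivAt_of_commuting [CompleteSpace E] {H : E → F →L[ℝ] E} {y₀ : E}
    (hH : ContDiffAt ℝ 2 H y₀)
    (hcomm : ∀ᶠ y in 𝓝 y₀, ∀ v w, fderiv ℝ H y (H y v) w = fderiv ℝ H y (H y w) v) :
    ∃ δ > 0, ∃ s : F → E, s 0 = y₀ ∧ ∀ p ∈ ball (0 : F) δ, HasFDerivAt s (H (s p)) p := by
  obtain ⟨K₁, t₁, ht₁, hlip₁⟩ := (hH.of_le one_le_two).exists_lipschitzOnWith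
  obtain ⟨K₂, t₂, ht₂, hlip₂⟩ := (hH.fderiv_right (m := 1) (by norm_num)).exists_lipschitzOnWith
  have hd : ∀ᶠ y in 𝓝 y₀, DifferentiableAt ℝ H y := by
    filter_upwards [hH.eventually (by simp)] with y hy
    exact hy.differentiableAt (by simp)
  have hb : ∀ᶠ y in 𝓝 y₀, ‖H y‖ < ‖H y₀‖ + 1 :=
    hH.continuousAt.norm.eventually_lt continuousAt_const (by simp)
  have hdb : ∀ᶠ y in 𝓝 y₀, ‖fderiv ℝ H y‖ < ‖fderiv ℝ H y₀‖ + 1 :=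
    (hH.fderiv_right (m := 1) (by norm_num)).continuousAt.norm.eventually_lt
      continuousAt_const (by simp)
  obtain ⟨R, hR, hball⟩ := nhds_basis_closedBall.eventually_iff.1
    ((((hd.and hb).and hdb).and hcomm).and ((eventually_mem_set.2 ht₁).and
      (eventually_mem_set.2 ht₂)))
  set L : ℝ≥0 := ⟨‖H y₀‖ + 1, by positivity⟩ with hLdef
  set K : ℝ≥0 := max K₁ ⟨‖fderiv ℝ H y₀‖ + 1, by positivity⟩ with hKdef
  have hL : ∀ y ∈ closedBall y₀ R, ‖H y‖ ≤ L := fun y hy ↦ (hball hy).1.1.1.2.le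
  have hK : ∀ y ∈ closedBall y₀ R, ‖fderiv ℝ H y‖ ≤ K := fun y hy ↦
    (hball hy).1.1.2.le.trans (by rw [hKdef]; exact_mod_cast le_max_right _ _)
  have hlip : LipschitzOnWith K H (closedBall y₀ R) :=
    (hlip₁.mono fun y hy ↦ (hball hy).2.1).weaken (le_max_left _ _)
  have hlip' : LipschitzOnWith K₂ (fderiv ℝ H) (closedBall y₀ R) :=
    hlip₂.mono fun y hy ↦ (hball hy).2.2
  have hLpos : (0 : ℝ) < L := by rw [hLdef]; change 0 < ‖H y₀‖ + 1; positivity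
  -- The speed is at most `L * ‖p‖`, so for `‖p‖ ≤ δ` a trajectory stays within `R / 2` up to time
  -- one. The other half of the radius is left for the variation in `w`.
  set δ : ℝ := R / 2 / L with hδ
  have hδpos : 0 < δ := by positivity
  have hsub : closedBall y₀ (R / 2) ⊆ closedBall y₀ R := closedBall_subset_closedBall (by linarith)
  have hex : ∀ p : F, ∃ γ : ℝ → E, ‖p‖ ≤ δ → γ 0 = y₀ ∧ (∀ t, γ t ∈ closedBall y₀ (R / 2)) ∧
      ∀ t ∈ Icc (0 : ℝ) 1, HasDerivWithinAt γ (H (γ t) p) (Icc 0 1) t := by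
    intro p
    by_cases hp : ‖p‖ ≤ δ
    · obtain ⟨γ, hγ⟩ := exists_trajectory_mem_closedBall (half_pos hR) (hlip.mono hsub)
        (fun y hy ↦ hL y (hsub hy)) (p := p) (by
          calc (L : ℝ) * ‖p‖ ≤ L * δ := by gcongr
            _ = R / 2 := by rw [hδ]; field_simp)
      exact ⟨γ, fun _ ↦ hγ⟩
    · exact ⟨0, fun h ↦ absurd h hp⟩
  choose γ hγ using hex
  -- The solution is obtained by integrating along rays from the origin.
  refine ⟨δ, hδpos, fun p ↦ γ p 1, ?_, fun p hp ↦ ?_⟩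
  · obtain ⟨h1, -, h2⟩ := hγ 0 (by simp [hδpos.le])
    have hc := (convex_Icc (0 : ℝ) 1).norm_image_sub_le_of_norm_hasDerivWithin_le (C := 0)
      (f := γ 0) (f' := fun t ↦ H (γ 0 t) 0) h2 (fun t _ ↦ by simp)
      (left_mem_Icc.2 zero_le_one) (right_mem_Icc.2 zero_le_one)
    rw [h1] at hc
    simpa [sub_eq_zero] using hc
  · set D : ℝ≥0 := ⟨δ, hδpos.le⟩ with hD
    have hp' : ‖p‖ < δ := by simpa using hp
    obtain ⟨g0, gm, gd⟩ := hγ p hp'.le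
    rw [hasFDerivAt_iff_isLittleO_nhds_zero]
    have hbig : (fun w ↦ γ (p + w) 1 - γ p 1 - H (γ p 1) w) =O[𝓝 0] fun w ↦ ‖w‖ ^ 2 := by
      refine Asymptotics.IsBigO.of_bound
        (gronwallBound 0 (K * D) (K * L + K₂ * L ^ 2 * D) 1) ?_
      have h1 : ∀ᶠ w in 𝓝 (0 : F), ‖p + w‖ < δ :=
        (continuous_const.add continuous_id).norm.continuousAt.eventually_lt
          continuousAt_const (by simpa using hp')
      have h2 : ∀ᶠ w in 𝓝 (0 : F), ‖w‖ < δ :=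
        continuous_norm.continuousAt.eventually_lt continuousAt_const (by simpa using hδpos)
      filter_upwards [h1, h2] with w hw1 hw2
      obtain ⟨e0, em, ed⟩ := hγ (p + w) hw1.le
      have := norm_sub_le_sq_of_trajectories (D := D) hlip hL (fun y hy ↦ (hball hy).1.1.1.1) hK
        hlip' (fun y hy ↦ (hball hy).1.2) hw1.le (by
          calc (L : ℝ) * ‖w‖ ≤ L * δ := by gcongr
            _ = R / 2 := by rw [hδ]; field_simp) (g0.trans e0.symm) gm em gd ed
      rw [sub_sub]
      simpa using this
    refine hbig.trans_isLittleO ?_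
    simpa using (Asymptotics.isLittleO_norm_pow_id (E' := F) one_lt_two)

/-- A differentiable solution of a total differential equation with smooth right-hand side is
smooth. -/
theorem contDiffOn_of_hasFDerivAt {H : E → F →L[ℝ] E} {W : Set E} (hH : ContDiffOn ℝ ∞ H W)
    {s : F → E} {O : Set F} (hO : IsOpen O) (hs : ∀ p ∈ O, HasFDerivAt s (H (s p)) p)
    (hW : MapsTo s O W) : ContDiffOn ℝ ∞ s O := by
  rw [contDiffOn_infty]
  intro n
  induction n with
  | zero =>
    exact contDiffOn_zero.2 fun p hp ↦ (hs p hp).continuousAt.continuousWithinAt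
  | succ n ih =>
    push_cast
    rw [contDiffOn_succ_iff_fderiv_of_isOpen hO]
    refine ⟨fun p hp ↦ (hs p hp).differentiableAt.differentiableWithinAt, by simp, ?_⟩
    have : ContDiffOn ℝ n (fun p ↦ H (s p)) O := (hH.of_le (by exact_mod_cast le_top)).comp ih hW
    exact this.congr fun p hp ↦ (hs p hp).fderiv

end TotalODE

/-! ### Pullback of forms to normed spaces, and the exterior derivative -/

section Pullback

open Filter Topology

variable {E M P : Type*} [NormedAddCommGroup E] [NormedSpace ℝ E]
  [TopologicalSpace M] [ChartedSpace E M]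
  [NormedAddCommGroup P] [NormedSpace ℝ P]

/-- The pullback of a `1`-form by a map defined on a normed space. -/
def OneForm.pullback (α : OneForm E M) (Ψ : P → M) (q : P) : P →L[ℝ] ℝ :=
  (α (Ψ q)).comp (mfderiv 𝓘(ℝ, P) 𝓘(ℝ, E) Ψ q)

theorem OneForm.pullback_apply (α : OneForm E M) (Ψ : P → M) (q v : P) :
    α.pullback Ψ q v = α (Ψ q) (mfderiv 𝓘(ℝ, P) 𝓘(ℝ, E) Ψ q v) := rfl

theorem two_le_infty : (2 : WithTop ℕ∞) ≤ ∞ := WithTop.coe_le_coe.2 le_top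

theorem extDeriv_ofSubsingleton_apply {a : E → E →L[ℝ] ℝ} {y : E} (ha : DifferentiableAt ℝ a y)
    (v w : E) :
    extDeriv (fun y ↦ ContinuousAlternatingMap.ofSubsingleton ℝ E ℝ (0 : Fin 1) (a y)) y ![v, w] =
      fderiv ℝ a y v w - fderiv ℝ a y w v := by
  have hd : DifferentiableAt ℝ
      (fun y ↦ ContinuousAlternatingMap.ofSubsingleton ℝ E ℝ (0 : Fin 1) (a y)) y :=
    (ContinuousAlternatingMap.ofSubsingletonLIE (𝕜 := ℝ) (E := E) (F := ℝ)
      (0 : Fin 1)).toContinuousLinearEquiv.differentiableAt.comp y ha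
  have hc : ∀ u : E, fderiv ℝ (fun y ↦ a y u) y = (fderiv ℝ a y).flip u := fun u ↦ by
    ext z
    rw [fderiv_clm_apply ha (differentiableAt_const u)]
    simp
  rw [extDeriv_apply hd]
  simp [Fin.sum_univ_two, Fin.removeNth, hc, sub_eq_add_neg]

variable [IsManifold 𝓘(ℝ, E) ∞ M]

/-- The derivative of the inverse chart is the inverse of the tangent bundle trivialization, so the
coordinate expression is the section read in the trivialization of the cotangent bundle. -/
theorem OneForm.IsSmooth.contDiffOn_inChart {α : OneForm E M} (hα : α.IsSmooth) (x₀ : M) :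
    ContDiffOn ℝ ∞ (α.inChart x₀) (extChartAt 𝓘(ℝ, E) x₀).target := by
  have h1 : ContMDiffOn 𝓘(ℝ, E) 𝓘(ℝ, E →L[ℝ] ℝ) ∞
      (fun x ↦ (α x).comp ((trivializationAt E (TangentSpace 𝓘(ℝ, E)) x₀).symmL ℝ x))
      (chartAt E x₀).source := by
    have h2 := ((trivializationAt (E →L[ℝ] ℝ)
      (fun x : M ↦ TangentSpace 𝓘(ℝ, E) x →L[ℝ] Bundle.Trivial M ℝ x) x₀).contMDiffOn_section_iff
      (IB := 𝓘(ℝ, E)) (n := ∞) (s := α) (a := (chartAt E x₀).source) (chartAt E x₀).open_source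
      (fun x hx ↦ by simpa using hx)).1 hα.contMDiffOn
    refine h2.congr fun x hx ↦ ?_
    ext v
    change _ = (Bundle.Trivial.trivialization M ℝ).continuousLinearMapAt ℝ x _
    rw [Bundle.Trivial.continuousLinearMapAt_trivialization]
    rfl
  refine contMDiffOn_iff_contDiffOn.1 ((h1.comp (contMDiffOn_extChartAt_symm x₀)
    fun y hy ↦ by simpa using (extChartAt 𝓘(ℝ, E) x₀).map_target hy).congr fun y hy ↦ ?_)
  have hy' : (extChartAt 𝓘(ℝ, E) x₀).symm y ∈ (chartAt E x₀).source := by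
    simpa using (extChartAt 𝓘(ℝ, E) x₀).map_target hy
  rw [Function.comp_apply, TangentBundle.symmL_trivializationAt hy',
    ModelWithCorners.range_eq_univ, mfderivWithin_univ, (extChartAt 𝓘(ℝ, E) x₀).right_inv hy]
  rfl

/-- The chart is kept fixed at `Ψ q₀` while `q` varies, since this is the chart in which `OneForm.d`
is computed at `Ψ q₀`. -/
theorem OneForm.pullback_eventuallyEq (α : OneForm E M) {Ψ : P → M} {q₀ : P}
    (hΨ : ContMDiffAt 𝓘(ℝ, P) 𝓘(ℝ, E) ∞ Ψ q₀) :
    α.pullback Ψ =ᶠ[𝓝 q₀] fun q ↦ (α.inChart (Ψ q₀) (extChartAt 𝓘(ℝ, E) (Ψ q₀) (Ψ q))).comp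
      (fderiv ℝ (fun q ↦ extChartAt 𝓘(ℝ, E) (Ψ q₀) (Ψ q)) q) := by
  have h1 : ∀ᶠ q in 𝓝 q₀, ContMDiffAt 𝓘(ℝ, P) 𝓘(ℝ, E) 1 Ψ q :=
    (contMDiffAt_iff_contMDiffAt_nhds (by simp)).1 (hΨ.of_le (by simp))
  have h2 : ∀ᶠ q in 𝓝 q₀, Ψ q ∈ (chartAt E (Ψ q₀)).source :=
    hΨ.continuousAt.eventually_mem ((chartAt E (Ψ q₀)).open_source.mem_nhds
      (mem_chart_source E (Ψ q₀)))
  filter_upwards [h1, h2, h2.eventually_nhds] with q hq hqs hqs'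
  have hs : Ψ q ∈ (extChartAt 𝓘(ℝ, E) (Ψ q₀)).source := by simpa using hqs
  have hmd : MDifferentiableAt 𝓘(ℝ, P) 𝓘(ℝ, E) (fun q ↦ extChartAt 𝓘(ℝ, E) (Ψ q₀) (Ψ q)) q :=
    MDifferentiableAt.comp q (mdifferentiableAt_extChartAt hqs) (hq.mdifferentiableAt (by simp))
  have hsymm : MDifferentiableAt 𝓘(ℝ, E) 𝓘(ℝ, E) (extChartAt 𝓘(ℝ, E) (Ψ q₀)).symm
      (extChartAt 𝓘(ℝ, E) (Ψ q₀) (Ψ q)) := by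
    have := mdifferentiableWithinAt_extChartAt_symm (I := 𝓘(ℝ, E)) (x := Ψ q₀)
      ((extChartAt 𝓘(ℝ, E) (Ψ q₀)).map_source hs)
    rwa [ModelWithCorners.range_eq_univ, mdifferentiableWithinAt_univ] at this
  have hcomp : mfderiv 𝓘(ℝ, P) 𝓘(ℝ, E) Ψ q =
      (mfderiv 𝓘(ℝ, E) 𝓘(ℝ, E) (extChartAt 𝓘(ℝ, E) (Ψ q₀)).symm
        (extChartAt 𝓘(ℝ, E) (Ψ q₀) (Ψ q))).comp
      (mfderiv 𝓘(ℝ, P) 𝓘(ℝ, E) (fun q ↦ extChartAt 𝓘(ℝ, E) (Ψ q₀) (Ψ q)) q) := by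
    rw [← mfderiv_comp q hsymm hmd]
    refine Filter.EventuallyEq.mfderiv_eq ?_
    filter_upwards [hqs'] with q' hq'
    exact ((extChartAt 𝓘(ℝ, E) (Ψ q₀)).left_inv (by simpa using hq')).symm
  -- All tangent spaces are definitionally `E`, so an equality of base points is substituted with
  -- the vector held fixed in `E`; this avoids rewriting in dependent types.
  have hα : ∀ x : M, x = Ψ q → ∀ u : E, α x u = α (Ψ q) u := by rintro x rfl u; rfl
  ext v
  rw [OneForm.pullback_apply, hcomp, mfderiv_eq_fderiv]
  exact (hα _ ((extChartAt 𝓘(ℝ, E) (Ψ q₀)).left_inv hs) _).symm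

theorem contDiffAt_extChartAt_comp {Ψ : P → M} {q₀ : P}
    (hΨ : ContMDiffAt 𝓘(ℝ, P) 𝓘(ℝ, E) ∞ Ψ q₀) :
    ContDiffAt ℝ ∞ (fun q ↦ extChartAt 𝓘(ℝ, E) (Ψ q₀) (Ψ q)) q₀ :=
  contMDiffAt_iff_contDiffAt.1 (contMDiffAt_extChartAt.comp q₀ hΨ)

theorem mfderiv_eq_fderiv_extChartAt_comp {Ψ : P → M} {q₀ : P}
    (hΨ : ContMDiffAt 𝓘(ℝ, P) 𝓘(ℝ, E) ∞ Ψ q₀) (u : P) :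
    (mfderiv 𝓘(ℝ, P) 𝓘(ℝ, E) Ψ q₀ u : E) =
      fderiv ℝ (fun q ↦ extChartAt 𝓘(ℝ, E) (Ψ q₀) (Ψ q)) q₀ u := by
  let D : P →L[ℝ] E := mfderiv 𝓘(ℝ, P) 𝓘(ℝ, E) Ψ q₀
  have h : HasFDerivWithinAt (fun q ↦ extChartAt 𝓘(ℝ, E) (Ψ q₀) (Ψ q)) D (range 𝓘(ℝ, P)) q₀ :=
    (hΨ.mdifferentiableAt (by simp)).hasMFDerivAt.2
  exact DFunLike.congr_fun (h.hasFDerivAt (by simp)).fderiv.symm u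

theorem OneForm.IsSmooth.contDiffAt_pullback {α : OneForm E M} (hα : α.IsSmooth) {Ψ : P → M}
    {q₀ : P} (hΨ : ContMDiffAt 𝓘(ℝ, P) 𝓘(ℝ, E) ∞ Ψ q₀) : ContDiffAt ℝ ∞ (α.pullback Ψ) q₀ := by
  refine ContDiffAt.congr_of_eventuallyEq ?_ (α.pullback_eventuallyEq hΨ)
  have hf := contDiffAt_extChartAt_comp hΨ
  have ha : ContDiffAt ℝ ∞ (α.inChart (Ψ q₀)) (extChartAt 𝓘(ℝ, E) (Ψ q₀) (Ψ q₀)) :=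
    (hα.contDiffOn_inChart (Ψ q₀)).contDiffAt (extChartAt_target_mem_nhds (Ψ q₀))
  exact (ha.comp q₀ hf).clm_comp (hf.fderiv_right (by simp))

/-- The exterior derivative commutes with pullback. -/
theorem OneForm.IsSmooth.fderiv_pullback_sub {α : OneForm E M} (hα : α.IsSmooth) {Ψ : P → M}
    {q₀ : P} (hΨ : ContMDiffAt 𝓘(ℝ, P) 𝓘(ℝ, E) ∞ Ψ q₀) (v w : P) :
    fderiv ℝ (α.pullback Ψ) q₀ v w - fderiv ℝ (α.pullback Ψ) q₀ w v =
      α.d (Ψ q₀) ![mfderiv 𝓘(ℝ, P) 𝓘(ℝ, E) Ψ q₀ v, mfderiv 𝓘(ℝ, P) 𝓘(ℝ, E) Ψ q₀ w] := by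
  have hf := contDiffAt_extChartAt_comp hΨ
  set f : P → E := fun q ↦ extChartAt 𝓘(ℝ, E) (Ψ q₀) (Ψ q) with hfdef
  have ha : ContDiffAt ℝ ∞ (α.inChart (Ψ q₀)) (f q₀) :=
    (hα.contDiffOn_inChart (Ψ q₀)).contDiffAt (extChartAt_target_mem_nhds (Ψ q₀))
  have had : DifferentiableAt ℝ (α.inChart (Ψ q₀)) (f q₀) := ha.differentiableAt (by simp)
  have hfd : DifferentiableAt ℝ f q₀ := hf.differentiableAt (by simp)
  have hf' : DifferentiableAt ℝ (fderiv ℝ f) q₀ :=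
    (hf.fderiv_right (m := ∞) (by simp)).differentiableAt (by simp)
  have hmf : ∀ u : P, (mfderiv 𝓘(ℝ, P) 𝓘(ℝ, E) Ψ q₀ u : E) = fderiv ℝ f q₀ u :=
    mfderiv_eq_fderiv_extChartAt_comp hΨ
  have hD : ∀ v w : P, fderiv ℝ (α.pullback Ψ) q₀ v w =
      fderiv ℝ (α.inChart (Ψ q₀)) (f q₀) (fderiv ℝ f q₀ v) (fderiv ℝ f q₀ w) +
        α.inChart (Ψ q₀) (f q₀) (fderiv ℝ (fderiv ℝ f) q₀ v w) := by
    intro v w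
    rw [(α.pullback_eventuallyEq hΨ).fderiv_eq]
    have h1 : HasFDerivAt (fun q ↦ α.inChart (Ψ q₀) (f q))
        ((fderiv ℝ (α.inChart (Ψ q₀)) (f q₀)).comp (fderiv ℝ f q₀)) q₀ :=
      had.hasFDerivAt.comp q₀ hfd.hasFDerivAt
    rw [(h1.clm_comp hf'.hasFDerivAt).fderiv]
    simp [add_comm]
  -- The second-derivative terms are symmetric and drop out on antisymmetrizing.
  have hsymm : fderiv ℝ (fderiv ℝ f) q₀ v w = fderiv ℝ (fderiv ℝ f) q₀ w v :=
    (hf.isSymmSndFDerivAt (by simp [two_le_infty])) v w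
  rw [hD, hD, hsymm, add_sub_add_right_eq_sub]
  exact (extDeriv_ofSubsingleton_apply had _ _).symm.trans (by
    change _ = extDeriv _ _ _
    congr 1
    ext i
    fin_cases i
    · exact (hmf v).symm
    · exact (hmf w).symm)

/-- The working form of the structure equations: on a normed space `d` is just the antisymmetrized
derivative. -/
theorem SatisfiesStructureEquations.fderiv_pullback_sub {ι : Type*} [Fintype ι]
    {C : ι → ι → ι → ℝ} {θ : ι → OneForm E M} (hθ : SatisfiesStructureEquations C θ)
    (hs : ∀ i, (θ i).IsSmooth) {Ψ : P → M} {q₀ : P}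
    (hΨ : ContMDiffAt 𝓘(ℝ, P) 𝓘(ℝ, E) ∞ Ψ q₀) (i : ι) (v w : P) :
    fderiv ℝ ((θ i).pullback Ψ) q₀ v w - fderiv ℝ ((θ i).pullback Ψ) q₀ w v =
      (1 / 2 : ℝ) * ∑ j, ∑ k, C i j k *
        ((θ j).pullback Ψ q₀ v * (θ k).pullback Ψ q₀ w -
          (θ j).pullback Ψ q₀ w * (θ k).pullback Ψ q₀ v) := by
  rw [(hs i).fderiv_pullback_sub hΨ]
  exact hθ i _ _ _

end Pullback

/-! ### Dimension of the fibres -/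

section Dimension

open Filter Topology Module
open scoped Pointwise

/-- A compact neighbourhood `L` of `1` generates an open, hence closed, subgroup, which is
everything; so the group is the union of the compact powers of `L ∪ L⁻¹`. -/
theorem sigmaCompactSpace_of_connectedSpace (G : Type*) [TopologicalSpace G] [Group G]
    [IsTopologicalGroup G] [WeaklyLocallyCompactSpace G] [ConnectedSpace G] :
    SigmaCompactSpace G := by
  obtain ⟨L, hLc, hL1⟩ := exists_compact_mem_nhds (1 : G)
  have htop : (Subgroup.closure L : Set G) = univ := by
    have ho : IsOpen (Subgroup.closure L : Set G) :=
      Subgroup.isOpen_of_mem_nhds _ (mem_of_superset hL1 Subgroup.subset_closure)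
    exact IsClopen.eq_univ ⟨Subgroup.isClosed_of_isOpen _ ho, ho⟩ ⟨1, one_mem _⟩
  have hA : (L ∪ L⁻¹)⁻¹ = L ∪ L⁻¹ := by rw [union_inv, inv_inv, union_comm]
  refine ⟨⟨fun n ↦ (L ∪ L⁻¹) ^ n, fun n ↦ ?_, eq_univ_of_forall fun x ↦ ?_⟩⟩
  · induction n with
    | zero => simp only [pow_zero]; exact isCompact_singleton
    | succ n ih => simp only [pow_succ]; exact ih.mul (hLc.union hLc.inv)
  · have hx : x ∈ Subgroup.closure L := by
      rw [← SetLike.mem_coe, htop]; trivial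
    induction hx using Subgroup.closure_induction with
    | mem x hx => exact mem_iUnion.2 ⟨1, by rw [pow_one]; exact Or.inl hx⟩
    | one => exact mem_iUnion.2 ⟨0, by simp⟩
    | mul x y _ _ hx hy =>
      obtain ⟨n, hn⟩ := mem_iUnion.1 hx
      obtain ⟨m, hm⟩ := mem_iUnion.1 hy
      exact mem_iUnion.2 ⟨n + m, by rw [pow_add]; exact mul_mem_mul hn hm⟩
    | inv x _ hx =>
      obtain ⟨n, hn⟩ := mem_iUnion.1 hx
      refine mem_iUnion.2 ⟨n, ?_⟩
      rw [← hA, inv_pow]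
      exact inv_mem_inv.2 hn

variable {E M EG G F N : Type*} [NormedAddCommGroup E] [NormedSpace ℝ E]
  [TopologicalSpace M] [ChartedSpace E M] [IsManifold 𝓘(ℝ, E) ∞ M]
  [NormedAddCommGroup EG] [NormedSpace ℝ EG] [TopologicalSpace G] [ChartedSpace EG G]
  [IsManifold 𝓘(ℝ, EG) ∞ G]
  [NormedAddCommGroup F] [NormedSpace ℝ F] [TopologicalSpace N] [ChartedSpace F N]
  [IsManifold 𝓘(ℝ, F) ∞ N]

/-- A `C^1` map does not raise Hausdorff dimension locally, and second countability reduces the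
image to a countable union of local pieces. -/
theorem dimH_image_le_finrank [FiniteDimensional ℝ EG] [SecondCountableTopology G]
    {κ : G → E} {O : Set G} (hO : IsOpen O)
    (hκ : ContMDiffOn 𝓘(ℝ, EG) 𝓘(ℝ, E) 1 κ O) : dimH (κ '' O) ≤ finrank ℝ EG := by
  have key : ∀ g ∈ O, ∃ U ∈ 𝓝[O] g, dimH (κ '' U) ≤ finrank ℝ EG := by
    intro g hg
    have h1 : ContMDiffAt 𝓘(ℝ, EG) 𝓘(ℝ, E) 1 κ g := (hκ g hg).contMDiffAt (hO.mem_nhds hg)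
    have hz : (extChartAt 𝓘(ℝ, EG) g).symm (extChartAt 𝓘(ℝ, EG) g g) = g :=
      extChartAt_to_inv (I := 𝓘(ℝ, EG)) g
    have h2 : ContDiffAt ℝ 1 (κ ∘ (extChartAt 𝓘(ℝ, EG) g).symm) (extChartAt 𝓘(ℝ, EG) g g) := by
      refine contMDiffAt_iff_contDiffAt.1 (ContMDiffAt.comp _ (by rwa [hz]) ?_)
      have h3 := (contMDiffOn_extChartAt_symm (I := 𝓘(ℝ, EG)) (n := 1) g)
      exact h3.contMDiffAt (extChartAt_target_mem_nhds g)
    obtain ⟨u, hu, -, h4⟩ := (h2.contDiffWithinAt (s := univ)).contDiffOn le_rfl (by simp)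
    rw [insert_eq_of_mem (mem_univ _), nhdsWithin_univ] at hu
    obtain ⟨r, hr, hru⟩ := Metric.mem_nhds_iff.1 hu
    refine ⟨(chartAt EG g).source ∩ extChartAt 𝓘(ℝ, EG) g ⁻¹' Metric.ball
      (extChartAt 𝓘(ℝ, EG) g g) r, mem_nhdsWithin_of_mem_nhds (inter_mem
        (chart_source_mem_nhds EG g) ((continuousAt_extChartAt g).preimage_mem_nhds
          (Metric.ball_mem_nhds _ hr))), ?_⟩
    have hsub : κ '' ((chartAt EG g).source ∩ extChartAt 𝓘(ℝ, EG) g ⁻¹' Metric.ball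
        (extChartAt 𝓘(ℝ, EG) g g) r) ⊆
        (κ ∘ (extChartAt 𝓘(ℝ, EG) g).symm) '' Metric.ball (extChartAt 𝓘(ℝ, EG) g g) r := by
      rintro _ ⟨h, ⟨hs, hb⟩, rfl⟩
      exact ⟨_, hb, by
        rw [Function.comp_apply, (extChartAt 𝓘(ℝ, EG) g).left_inv (by simpa using hs)]⟩
    calc _ ≤ _ := dimH_mono hsub
      _ ≤ dimH (Metric.ball (extChartAt 𝓘(ℝ, EG) g g) r) :=
        (h4.mono hru).dimH_image_le (convex_ball _ _) Subset.rfl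
      _ ≤ dimH (univ : Set EG) := dimH_mono (subset_univ _)
      _ = _ := Real.dimH_univ_eq_finrank EG
  choose! U hU hdim using key
  obtain ⟨t, htO, htc, hcov⟩ := TopologicalSpace.countable_cover_nhdsWithin hU
  calc dimH (κ '' O) ≤ dimH (⋃ g ∈ t, κ '' U g) := by
        refine dimH_mono ?_
        rw [← image_iUnion₂]
        exact image_mono hcov
    _ = ⨆ g ∈ t, dimH (κ '' U g) := dimH_bUnion htc _
    _ ≤ _ := iSup₂_le fun g hg ↦ hdim g (htO hg)

/-- If a fibre of a submersion is the image of a manifold, the dimension of that manifold is at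
least that of the fibre. -/
theorem finrank_le_of_fiber_subset_range [FiniteDimensional ℝ E] [FiniteDimensional ℝ F]
    [FiniteDimensional ℝ EG] [SecondCountableTopology G] {π : M → N} {x : M}
    (h : Manifold.IsSubmersionAt 𝓘(ℝ, E) 𝓘(ℝ, F) ∞ π x) {A : G → M}
    (hA : ContMDiff 𝓘(ℝ, EG) 𝓘(ℝ, E) ∞ A) (hfib : ∀ y, π y = π x → ∃ g, A g = y) :
    finrank ℝ E ≤ finrank ℝ F + finrank ℝ EG := by
  have hfd : FiniteDimensional ℝ (F × h.complement) :=
    LinearEquiv.finiteDimensional h.equiv.toLinearEquiv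
  have hfc : FiniteDimensional ℝ h.complement :=
    Module.Finite.of_surjective (LinearMap.snd ℝ F h.complement) LinearMap.snd_surjective
  have hE : finrank ℝ E = finrank ℝ F + finrank ℝ h.complement := by
    rw [h.equiv.toLinearEquiv.finrank_eq, finrank_prod]
  rw [hE]
  refine Nat.add_le_add_left ?_ _
  set φ := h.domChart with hφ
  set c₀ := (h.equiv (φ x)) with hc₀
  -- The fibre coordinate of `A g` in the normal form of the submersion. The fibre through `x` is a
  -- slice there, so the image of `κ` contains a neighbourhood in the complement.
  set κ : G → h.complement := fun g ↦ (h.equiv (φ (A g))).2 with hκ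
  have hO : IsOpen (A ⁻¹' φ.source) := φ.open_source.preimage hA.continuous
  have hκs : ContMDiffOn 𝓘(ℝ, EG) 𝓘(ℝ, h.complement) 1 κ (A ⁻¹' φ.source) := by
    have h1 : ContMDiffOn 𝓘(ℝ, EG) 𝓘(ℝ, E) 1 (fun g ↦ φ (A g)) (A ⁻¹' φ.source) :=
      ((contMDiffOn_of_mem_maximalAtlas h.domChart_mem_maximalAtlas).comp hA.contMDiffOn
        (fun g hg ↦ hg)).of_le (by simp)
    have h2 : ContDiff ℝ 1 (fun e : E ↦ (h.equiv e).2) :=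
      contDiff_snd.comp h.equiv.contDiff
    exact h2.contMDiff.comp_contMDiffOn h1
  have hS : {c : h.complement | h.equiv.symm (c₀.1, c) ∈ φ.target} ∈ 𝓝 c₀.2 := by
    have hcont : Continuous fun c : h.complement ↦ h.equiv.symm (c₀.1, c) := by fun_prop
    refine hcont.continuousAt.preimage_mem_nhds (φ.open_target.mem_nhds ?_)
    have : h.equiv.symm (c₀.1, c₀.2) = φ x := by simp [hc₀]
    rw [this]
    exact φ.map_source h.mem_domChart_source
  have hsub : {c : h.complement | h.equiv.symm (c₀.1, c) ∈ φ.target} ⊆ κ '' (A ⁻¹' φ.source) := by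
    intro c hc
    have hw : ∀ e ∈ φ.target, h.codChart (π (φ.symm e)) = (h.equiv e).1 := by
      intro e he
      have := h.writtenInCharts (show e ∈ (h.domChart.extend 𝓘(ℝ, E)).target by simpa [hφ] using he)
      simpa [hφ] using this
    set y := φ.symm (h.equiv.symm (c₀.1, c)) with hy
    have hys : y ∈ φ.source := φ.map_target hc
    have h1 : h.codChart (π y) = c₀.1 := by rw [hy, hw _ hc]; simp
    have h2 : h.codChart (π x) = c₀.1 := by
      have := hw (φ x) (φ.map_source h.mem_domChart_source)
      rwa [φ.left_inv h.mem_domChart_source] at this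
    have h3 : π y = π x := h.codChart.injOn (h.source_subset_preimage_source hys)
      h.mem_codChart_source (h1.trans h2.symm)
    obtain ⟨g, hg⟩ := hfib y h3
    refine ⟨g, by rw [mem_preimage, hg]; exact hys, ?_⟩
    rw [hκ]
    simp only
    rw [hg, hy, φ.right_inv hc]
    simp
  have := (dimH_mono hsub).trans (dimH_image_le_finrank hO hκs)
  rw [Real.dimH_of_mem_nhds hS] at this
  exact_mod_cast this

end Dimension

/-! ### Flat connections on principal bundles -/

section FlatConnection

open Module

variable {E M EG G F N ι : Type*} [NormedAddCommGroup E] [NormedSpace ℝ E]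
  [TopologicalSpace M] [ChartedSpace E M] [IsManifold 𝓘(ℝ, E) ∞ M]
  [NormedAddCommGroup EG] [NormedSpace ℝ EG] [TopologicalSpace G] [ChartedSpace EG G] [Group G]
  [NormedAddCommGroup F] [NormedSpace ℝ F] [TopologicalSpace N] [ChartedSpace F N]
  [MulAction Gᵐᵒᵖ M] [Fintype ι] [DecidableEq ι]

/-- Any lift through `D` can be corrected by a combination of the `X j`, which `D` does not see and
on which `Θ` takes arbitrary values. -/
theorem surjective_prod_pi_of_dual {D : E →ₗ[ℝ] F} {Θ : ι → E →ₗ[ℝ] ℝ} {X : ι → E}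
    (hD : Function.Surjective D) (hX : ∀ i j, Θ i (X j) = if i = j then 1 else 0)
    (hDX : ∀ j, D (X j) = 0) : Function.Surjective (D.prod (LinearMap.pi Θ)) := by
  rintro ⟨f, c⟩
  obtain ⟨v₀, hv₀⟩ := hD f
  refine ⟨v₀ + ∑ j, (c j - Θ j v₀) • X j, Prod.ext ?_ (funext fun i ↦ ?_)⟩
  · change D _ = f
    simp [hDX, hv₀]
  · change Θ i _ = c i
    simp [hX]

/-- The composite `π ∘ A` is constant: generators are vertical. -/
theorem mfderiv_mfderiv_orbit_eq_zero {π : M → N} (hπ : ContMDiff 𝓘(ℝ, E) 𝓘(ℝ, F) ∞ π)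
    {A : G → M} (hA : ContMDiff 𝓘(ℝ, EG) 𝓘(ℝ, E) ∞ A) {x : M} (h1 : A 1 = x)
    (hπA : ∀ g, π (A g) = π x) (ξ : GroupLieAlgebra 𝓘(ℝ, EG) G) :
    (mfderiv 𝓘(ℝ, E) 𝓘(ℝ, F) π x (mfderiv 𝓘(ℝ, EG) 𝓘(ℝ, E) A 1 ξ : E) : F) = 0 := by
  subst h1
  have hcomp := mfderiv_comp (1 : G) (hπ.mdifferentiable (by simp) (A 1))
    (hA.mdifferentiable (by simp) 1)
  refine (DFunLike.congr_fun hcomp ξ).symm.trans ?_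
  rw [show π ∘ A = fun _ ↦ π (A 1) from funext hπA, mfderiv_const]
  rfl

variable (F) in
/-- The forms `θ` define a flat connection on the principal bundle `π`, with respect to a free right
action of `G`. -/
structure IsFlatConnection (b : Module.Basis ι ℝ (GroupLieAlgebra 𝓘(ℝ, EG) G))
    (C : ι → ι → ι → ℝ) (θ : ι → OneForm E M) (π : M → N) : Prop where
  contMDiff_smul : ContMDiff (𝓘(ℝ, EG).prod 𝓘(ℝ, E)) 𝓘(ℝ, E) ∞
    (fun p : G × M ↦ MulOpposite.op p.1 • p.2)
  free : ∀ (g : G) (x : M), MulOpposite.op g • x = x → g = 1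
  contMDiff_proj : ContMDiff 𝓘(ℝ, E) 𝓘(ℝ, F) ∞ π
  surjective_mfderiv_proj : ∀ x, Function.Surjective (mfderiv 𝓘(ℝ, E) 𝓘(ℝ, F) π x)
  proj_eq_iff : ∀ x y, π x = π y ↔ ∃ g : G, MulOpposite.op g • x = y
  finrank_eq : finrank ℝ E = finrank ℝ F + Fintype.card ι
  isSmooth : ∀ i, (θ i).IsSmooth
  dual : ∀ (i j : ι) (x : M), θ i x (rightGenerator (b j) x) = if i = j then 1 else 0
  structureEquations : SatisfiesStructureEquations C θ

variable {b : Module.Basis ι ℝ (GroupLieAlgebra 𝓘(ℝ, EG) G)} {C : ι → ι → ι → ℝ}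
  {θ : ι → OneForm E M} {π : M → N}

namespace IsFlatConnection

theorem proj_smul (h : IsFlatConnection F b C θ π) (g : G) (x : M) :
    π (MulOpposite.op g • x) = π x := ((h.proj_eq_iff _ _).2 ⟨g, rfl⟩).symm

theorem contMDiff_orbit [IsManifold 𝓘(ℝ, EG) ∞ G] (h : IsFlatConnection F b C θ π) (x : M) :
    ContMDiff 𝓘(ℝ, EG) 𝓘(ℝ, E) ∞ (fun g : G ↦ MulOpposite.op g • x) :=
  h.contMDiff_smul.comp (contMDiff_id.prodMk contMDiff_const)

theorem mfderiv_proj_rightGenerator [IsManifold 𝓘(ℝ, EG) ∞ G] (h : IsFlatConnection F b C θ π)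
    (ξ : GroupLieAlgebra 𝓘(ℝ, EG) G) (x : M) :
    mfderiv 𝓘(ℝ, E) 𝓘(ℝ, F) π x (rightGenerator ξ x) = 0 :=
  mfderiv_mfderiv_orbit_eq_zero h.contMDiff_proj (h.contMDiff_orbit x) (by simp)
    (fun g ↦ h.proj_smul g x) ξ

/-- A tangent vector killed by the connection and by the projection vanishes. -/
theorem eq_zero_of_mfderiv_proj_eq_zero [FiniteDimensional ℝ E] [FiniteDimensional ℝ F]
    [IsManifold 𝓘(ℝ, EG) ∞ G] (h : IsFlatConnection F b C θ π) {x : M}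
    {v : TangentSpace 𝓘(ℝ, E) x} (hv : mfderiv 𝓘(ℝ, E) 𝓘(ℝ, F) π x v = 0)
    (hθ : ∀ i, θ i x v = 0) : v = 0 := by
  let D : E →ₗ[ℝ] F := (mfderiv 𝓘(ℝ, E) 𝓘(ℝ, F) π x).toLinearMap
  let Θ : ι → E →ₗ[ℝ] ℝ := fun i ↦ (θ i x).toLinearMap
  let T : E →ₗ[ℝ] F × (ι → ℝ) := D.prod (LinearMap.pi Θ)
  have hsurj : Function.Surjective T :=
    surjective_prod_pi_of_dual (X := fun j ↦ (rightGenerator (b j) x : E))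
      (h.surjective_mfderiv_proj x) (fun i j ↦ h.dual i j x)
      fun j ↦ h.mfderiv_proj_rightGenerator (b j) x
  have hinj := (LinearMap.injective_iff_surjective_of_finrank_eq_finrank (f := T)
    (by rw [h.finrank_eq, finrank_prod, finrank_fintype_fun_eq_card])).2 hsurj
  have : T v = 0 := Prod.ext hv (funext hθ)
  exact hinj (this.trans (map_zero T).symm)

end IsFlatConnection

end FlatConnection

/-! ### Local leaves in coordinates -/

section LocalLeaf

open Filter Topology Module Metric

variable {E F ι : Type*} [NormedAddCommGroup E] [NormedSpace ℝ E] [FiniteDimensional ℝ E]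
  [NormedAddCommGroup F] [NormedSpace ℝ F] [FiniteDimensional ℝ F] [Fintype ι]

/-- The horizontal lift determined by a submersion `f` and complementary `1`-forms `β`. -/
theorem exists_horizontal_lift {W : Set E} (hW : IsOpen W) {f : E → F} {β : ι → E → E →L[ℝ] ℝ}
    (hf : ContDiffOn ℝ ∞ f W) (hβ : ∀ i, ContDiffOn ℝ ∞ (β i) W)
    (hdim : finrank ℝ E = finrank ℝ F + Fintype.card ι)
    (hinj : ∀ u ∈ W, ∀ v, fderiv ℝ f u v = 0 → (∀ i, β i u v = 0) → v = 0) :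
    ∃ H : E → F →L[ℝ] E, ContDiffOn ℝ ∞ H W ∧
      ∀ u ∈ W, ∀ w, fderiv ℝ f u (H u w) = w ∧ ∀ i, β i u (H u w) = 0 := by
  set T : E → E →L[ℝ] F × (ι → ℝ) := fun u ↦
    (fderiv ℝ f u).prod (ContinuousLinearMap.pi fun i ↦ β i u) with hT
  have hTs : ContDiffOn ℝ ∞ T W := by
    have h1 : ContDiffOn ℝ ∞ (fderiv ℝ f) W := hf.fderiv_of_isOpen hW (by simp)
    have h2 : ContDiffOn ℝ ∞ (fun u ↦ ContinuousLinearMap.pi fun i ↦ β i u) W :=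
      contDiffOn_clm_apply.2 fun v ↦ contDiffOn_pi.2 fun i ↦ (hβ i).clm_apply contDiffOn_const
    exact (ContinuousLinearMap.prodₗᵢ ℝ).contDiff.comp_contDiffOn (h1.prodMk h2)
  have hTinv : ∀ u ∈ W, ∃ L : E ≃L[ℝ] F × (ι → ℝ), (L : E →L[ℝ] F × (ι → ℝ)) = T u := by
    intro u hu
    have hi : Function.Injective (T u).toLinearMap := by
      rw [injective_iff_map_eq_zero]
      intro v hv
      exact hinj u hu v (congrArg Prod.fst hv) fun i ↦ congrFun (congrArg Prod.snd hv) i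
    refine ⟨(LinearEquiv.ofInjectiveOfFinrankEq (T u).toLinearMap hi
      (by rw [hdim, finrank_prod, finrank_fintype_fun_eq_card])).toContinuousLinearEquiv, ?_⟩
    ext v <;> rfl
  refine ⟨fun u ↦ (T u).inverse.comp (ContinuousLinearMap.inl ℝ F (ι → ℝ)), fun u hu ↦ ?_,
    fun u hu w ↦ ?_⟩
  · obtain ⟨L, hL⟩ := hTinv u hu
    have h1 : ContDiffAt ℝ ∞ ContinuousLinearMap.inverse (T u) := hL ▸ contDiffAt_map_inverse L
    exact (h1.comp_contDiffWithinAt u (hTs u hu)).clm_comp contDiffWithinAt_const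
  · obtain ⟨L, hL⟩ := hTinv u hu
    have h1 : T u ((T u).inverse (w, 0)) = (w, 0) := by
      rw [← hL, ContinuousLinearMap.inverse_equiv]; simp
    exact ⟨congrArg Prod.fst h1, fun i ↦ congrFun (congrArg Prod.snd h1) i⟩

/-- A flat section solves `Ds = H(s)` with `H` the horizontal lift, so it suffices that `DH(H v) w`
is symmetric in `v, w`. Differentiating `Df (H w) = w` and `β (H w) = 0` along `H v`, symmetry of
`D²f` and closedness of `β` on horizontal pairs show that the antisymmetric part is killed by both
`Df` and `β`, hence zero. -/
theorem exists_contDiffOn_flat_section {W : Set E} (hW : IsOpen W) {f : E → F}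
    {β : ι → E → E →L[ℝ] ℝ}
    (hf : ContDiffOn ℝ ∞ f W) (hβ : ∀ i, ContDiffOn ℝ ∞ (β i) W)
    (hdim : finrank ℝ E = finrank ℝ F + Fintype.card ι)
    (hinj : ∀ u ∈ W, ∀ v, fderiv ℝ f u v = 0 → (∀ i, β i u v = 0) → v = 0)
    (hflat : ∀ u ∈ W, ∀ v w, (∀ i, β i u v = 0) → (∀ i, β i u w = 0) → ∀ i,
      fderiv ℝ (β i) u v w = fderiv ℝ (β i) u w v) {u₀ : E} (hu₀ : u₀ ∈ W) :
    ∃ r > 0, ∃ s : F → E, s (f u₀) = u₀ ∧ ContDiffOn ℝ ∞ s (ball (f u₀) r) ∧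
      ∀ p ∈ ball (f u₀) r, s p ∈ W ∧ f (s p) = p ∧ ∀ i w, β i (s p) (fderiv ℝ s p w) = 0 := by
  obtain ⟨H, hH, hHw⟩ := exists_horizontal_lift hW hf hβ hdim hinj
  have hHat : ∀ u ∈ W, ContDiffAt ℝ ∞ H u := fun u hu ↦ (hH u hu).contDiffAt (hW.mem_nhds hu)
  have hcomm : ∀ u ∈ W, ∀ v w, fderiv ℝ H u (H u v) w = fderiv ℝ H u (H u w) v := by
    intro u hu v w
    have hnear : ∀ᶠ z in 𝓝 u, z ∈ W := hW.mem_nhds hu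
    have hHd : DifferentiableAt ℝ H u := (hHat u hu).differentiableAt (by simp)
    have hfat : ContDiffAt ℝ ∞ f u := (hf u hu).contDiffAt (hW.mem_nhds hu)
    have hfd : DifferentiableAt ℝ (fderiv ℝ f) u :=
      (hfat.fderiv_right (m := ∞) (by simp)).differentiableAt (by simp)
    have hA : ∀ (w : F) (z : E), (fderiv ℝ (fderiv ℝ f) u z (H u w) : F) + fderiv ℝ f u (fderiv ℝ H u z w) = 0 := by
      intro w z
      have h1 : (fun x ↦ fderiv ℝ f x (H x w)) =ᶠ[𝓝 u] fun _ ↦ w := by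
        filter_upwards [hnear] with x hx using (hHw x hx w).1
      have h2 := h1.fderiv_eq (𝕜 := ℝ)
      rw [fderiv_clm_apply hfd (hHd.clm_apply (differentiableAt_const w)),
        fderiv_clm_apply hHd (differentiableAt_const w)] at h2
      have h3 := DFunLike.congr_fun h2 z
      simp at h3
      rw [add_comm]; exact h3
    have hB : ∀ (i : ι) (w : F) (z : E), fderiv ℝ (β i) u z (H u w) + β i u (fderiv ℝ H u z w) = 0 := by
      intro i w z
      have hβd : DifferentiableAt ℝ (β i) u :=
        ((hβ i u hu).contDiffAt (hW.mem_nhds hu)).differentiableAt (by simp)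
      have h1 : (fun x ↦ β i x (H x w)) =ᶠ[𝓝 u] fun _ ↦ 0 := by
        filter_upwards [hnear] with x hx using (hHw x hx w).2 i
      have h2 := h1.fderiv_eq (𝕜 := ℝ)
      rw [fderiv_clm_apply hβd (hHd.clm_apply (differentiableAt_const w)),
        fderiv_clm_apply hHd (differentiableAt_const w)] at h2
      have h3 := DFunLike.congr_fun h2 z
      simp at h3
      rw [add_comm]; exact h3
    rw [← sub_eq_zero]
    refine hinj u hu _ ?_ fun i ↦ ?_
    · have hs : fderiv ℝ (fderiv ℝ f) u (H u v) (H u w) = fderiv ℝ (fderiv ℝ f) u (H u w) (H u v) :=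
        (hfat.isSymmSndFDerivAt (by simp [two_le_infty])) _ _
      have h1 := hA w (H u v)
      have h2 := hA v (H u w)
      rw [map_sub, sub_eq_zero]
      rw [hs, ← h2] at h1
      exact add_left_cancel h1
    · have hs := hflat u hu (H u v) (H u w) (hHw u hu v).2 (hHw u hu w).2 i
      have h1 := hB i w (H u v)
      have h2 := hB i v (H u w)
      rw [map_sub, sub_eq_zero]
      rw [hs, ← h2] at h1
      exact add_left_cancel h1
  obtain ⟨δ, hδ, s, hs0, hs⟩ := exists_hasFDerivAt_of_commuting
    ((hHat u₀ hu₀).of_le two_le_infty) (by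
      filter_upwards [hW.mem_nhds hu₀] with u hu using hcomm u hu)
  have hcont : ContinuousAt s 0 := (hs 0 (mem_ball_self hδ)).continuousAt
  obtain ⟨r', hr', hr'W⟩ := Metric.mem_nhds_iff.1
    (hcont.preimage_mem_nhds (by rw [hs0]; exact hW.mem_nhds hu₀))
  set r := min δ r' with hr
  have hrpos : 0 < r := lt_min hδ hr'
  have hsd : ∀ p ∈ ball (0 : F) r, HasFDerivAt s (H (s p)) p := fun p hp ↦
    hs p (ball_subset_ball (min_le_left _ _) hp)
  have hsW : MapsTo s (ball (0 : F) r) W := fun p hp ↦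
    hr'W (ball_subset_ball (min_le_right _ _) hp)
  have hss : ContDiffOn ℝ ∞ s (ball (0 : F) r) := contDiffOn_of_hasFDerivAt hH isOpen_ball hsd hsW
  -- The lift satisfies `Df ∘ H = id`, so `f (s p) - p` has zero derivative on the ball.
  have hfs : ∀ p ∈ ball (0 : F) r, f (s p) = f u₀ + p := by
    have h1 : ∀ p ∈ ball (0 : F) r, HasFDerivAt (fun p ↦ f (s p) - p) (0 : F →L[ℝ] F) p := by
      intro p hp
      have h2 : HasFDerivAt f (fderiv ℝ f (s p)) (s p) :=
        (((hf _ (hsW hp)).contDiffAt (hW.mem_nhds (hsW hp))).differentiableAt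
          (by simp)).hasFDerivAt
      have h3 := (h2.comp p (hsd p hp)).fun_sub (hasFDerivAt_id p)
      refine h3.congr_fderiv ?_
      ext w
      simp [(hHw _ (hsW hp) w).1]
    intro p hp
    have h2 := (convex_ball (0 : F) r).is_const_of_fderivWithin_eq_zero (𝕜 := ℝ)
      (f := fun p ↦ f (s p) - p)
      (fun p hp ↦ (h1 p hp).differentiableAt.differentiableWithinAt)
      (fun p hp ↦ by
        rw [fderivWithin_of_isOpen isOpen_ball hp]
        exact (h1 p hp).fderiv) hp (mem_ball_self hrpos)
    simp only [hs0, sub_zero] at h2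
    exact sub_eq_iff_eq_add.1 h2
  have hmap : ∀ p ∈ ball (f u₀) r, p - f u₀ ∈ ball (0 : F) r := by
    intro p hp
    simpa [dist_eq_norm] using hp
  refine ⟨r, hrpos, fun p ↦ s (p - f u₀), by simp [hs0],
    hss.comp (contDiffOn_id.sub contDiffOn_const) hmap, fun p hp ↦
      ⟨hsW (hmap p hp), by rw [hfs _ (hmap p hp)]; abel, fun i w ↦ ?_⟩⟩
  rw [fderiv_comp_sub, (hsd _ (hmap p hp)).fderiv]
  exact (hHw _ (hsW (hmap p hp)) w).2 i

end LocalLeaf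

/-! ### Local leaves on the manifold -/

section FlatPlot

open Filter Topology Metric

variable {E M EG G F N P ι : Type*} [NormedAddCommGroup E] [NormedSpace ℝ E]
  [TopologicalSpace M] [ChartedSpace E M] [NormedAddCommGroup P] [NormedSpace ℝ P]

/-- A smooth map on an open set whose image is tangent to the common kernel of the forms `θ`. -/
structure IsFlatPlot (θ : ι → OneForm E M) (σ : P → M) (O : Set P) : Prop where
  contMDiffOn : ContMDiffOn 𝓘(ℝ, P) 𝓘(ℝ, E) ∞ σ O
  pullback_eq_zero : ∀ p ∈ O, ∀ i, (θ i).pullback σ p = 0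

theorem mfderiv_extChartAt_symm_injective [IsManifold 𝓘(ℝ, E) ∞ M] (x : M) {u : E}
    (hu : u ∈ (extChartAt 𝓘(ℝ, E) x).target) {v : E}
    (hv : mfderiv 𝓘(ℝ, E) 𝓘(ℝ, E) (extChartAt 𝓘(ℝ, E) x).symm u v = 0) : v = 0 := by
  have h1 := mfderiv_extChartAt_comp_mfderivWithin_extChartAt_symm (I := 𝓘(ℝ, E)) hu
  rw [ModelWithCorners.range_eq_univ, mfderivWithin_univ] at h1
  have h2 := DFunLike.congr_fun h1 v
  refine h2.symm.trans ?_
  refine (congrArg (mfderiv 𝓘(ℝ, E) 𝓘(ℝ, E) (extChartAt 𝓘(ℝ, E) x)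
    ((extChartAt 𝓘(ℝ, E) x).symm u)) hv).trans (map_zero (mfderiv 𝓘(ℝ, E) 𝓘(ℝ, E)
      (extChartAt 𝓘(ℝ, E) x) ((extChartAt 𝓘(ℝ, E) x).symm u)))

theorem mfderiv_extChartAt_injective [IsManifold 𝓘(ℝ, E) ∞ M] (x : M) {y : M}
    (hy : y ∈ (extChartAt 𝓘(ℝ, E) x).source) {v : TangentSpace 𝓘(ℝ, E) y}
    (hv : mfderiv 𝓘(ℝ, E) 𝓘(ℝ, E) (extChartAt 𝓘(ℝ, E) x) y v = 0) : v = 0 :=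
  (isInvertible_mfderiv_extChartAt hy).injective (hv.trans (map_zero _).symm)

variable [FiniteDimensional ℝ E] [IsManifold 𝓘(ℝ, E) ∞ M]
  [NormedAddCommGroup EG] [NormedSpace ℝ EG] [TopologicalSpace G] [ChartedSpace EG G] [Group G]
  [IsManifold 𝓘(ℝ, EG) ∞ G]
  [NormedAddCommGroup F] [NormedSpace ℝ F] [FiniteDimensional ℝ F]
  [TopologicalSpace N] [ChartedSpace F N] [IsManifold 𝓘(ℝ, F) ∞ N]
  [MulAction Gᵐᵒᵖ M] [Fintype ι] [DecidableEq ι]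
  {b : Module.Basis ι ℝ (GroupLieAlgebra 𝓘(ℝ, EG) G)} {C : ι → ι → ι → ℝ}
  {θ : ι → OneForm E M} {π : M → N}

/-- Through every point passes a local leaf of a flat connection. -/
theorem IsFlatConnection.exists_isFlatPlot (h : IsFlatConnection F b C θ π) (y : M) :
    ∃ r > 0, ∃ σ : F → M, σ (extChartAt 𝓘(ℝ, F) (π y) (π y)) = y ∧
      ball (extChartAt 𝓘(ℝ, F) (π y) (π y)) r ⊆ (extChartAt 𝓘(ℝ, F) (π y)).target ∧
      IsFlatPlot θ σ (ball (extChartAt 𝓘(ℝ, F) (π y) (π y)) r) ∧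
      ∀ p ∈ ball (extChartAt 𝓘(ℝ, F) (π y) (π y)) r,
        π (σ p) = (extChartAt 𝓘(ℝ, F) (π y)).symm p := by
  set e := extChartAt 𝓘(ℝ, E) y with he
  set c := extChartAt 𝓘(ℝ, F) (π y) with hc
  set f : E → F := fun u ↦ c (π (e.symm u)) with hf
  have hsymm : ContMDiffOn 𝓘(ℝ, E) 𝓘(ℝ, E) ∞ e.symm e.target := contMDiffOn_extChartAt_symm y
  have hsat : ∀ u ∈ e.target, ContMDiffAt 𝓘(ℝ, E) 𝓘(ℝ, E) ∞ e.symm u := fun u hu ↦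
    (hsymm u hu).contMDiffAt ((isOpen_extChartAt_target y).mem_nhds hu)
  set W : Set E := e.target ∩ (fun u ↦ π (e.symm u)) ⁻¹' c.source with hWdef
  have hπe : ContMDiffOn 𝓘(ℝ, E) 𝓘(ℝ, F) ∞ (fun u ↦ π (e.symm u)) e.target :=
    h.contMDiff_proj.comp_contMDiffOn hsymm
  have hW : IsOpen W := hπe.continuousOn.isOpen_inter_preimage (isOpen_extChartAt_target y)
    (isOpen_extChartAt_source (π y))
  have hfs : ContMDiffOn 𝓘(ℝ, E) 𝓘(ℝ, F) ∞ f W := by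
    refine (contMDiffOn_extChartAt (I := 𝓘(ℝ, F)) (x := π y)).comp
      (hπe.mono inter_subset_left) fun u hu ↦ ?_
    simpa [hc] using hu.2
  have hmemy : y ∈ e.source := mem_extChartAt_source y
  have hey : e.symm (e y) = y := e.left_inv hmemy
  have hy0 : e y ∈ W := ⟨e.map_source hmemy, by
    rw [mem_preimage, hey]; exact mem_extChartAt_source (π y)⟩
  have hfey : f (e y) = c (π y) := by rw [hf]; simp only [hey]
  have hinj : ∀ u ∈ W, ∀ v, fderiv ℝ f u v = 0 → (∀ i, (θ i).pullback e.symm u v = 0) → v = 0 := by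
    intro u hu v hv hθ
    refine mfderiv_extChartAt_symm_injective y hu.1 ?_
    refine h.eq_zero_of_mfderiv_proj_eq_zero ?_ fun i ↦ hθ i
    refine mfderiv_extChartAt_injective (π y) hu.2 ?_
    have h1 : mfderiv 𝓘(ℝ, E) 𝓘(ℝ, F) f u =
        (mfderiv 𝓘(ℝ, F) 𝓘(ℝ, F) c (π (e.symm u))).comp
          ((mfderiv 𝓘(ℝ, E) 𝓘(ℝ, F) π (e.symm u)).comp
            (mfderiv 𝓘(ℝ, E) 𝓘(ℝ, E) e.symm u)) := by
      have hms : MDifferentiableAt 𝓘(ℝ, E) 𝓘(ℝ, E) e.symm u :=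
        (hsat u hu.1).mdifferentiableAt (by simp)
      have hmπ : MDifferentiableAt 𝓘(ℝ, E) 𝓘(ℝ, F) π (e.symm u) :=
        h.contMDiff_proj.mdifferentiable (by simp) _
      have hmc : MDifferentiableAt 𝓘(ℝ, F) 𝓘(ℝ, F) c (π (e.symm u)) :=
        mdifferentiableAt_extChartAt (by simpa [hc] using hu.2)
      rw [← mfderiv_comp u hmπ hms]
      exact mfderiv_comp u hmc (hmπ.comp u hms)
    rw [mfderiv_eq_fderiv] at h1
    exact (DFunLike.congr_fun h1 v).symm.trans hv
  -- Every term on the right of the structure equations contains a factor that vanishes on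
  -- horizontal vectors.
  have hflat : ∀ u ∈ W, ∀ v w, (∀ i, (θ i).pullback e.symm u v = 0) →
      (∀ i, (θ i).pullback e.symm u w = 0) → ∀ i,
      fderiv ℝ ((θ i).pullback e.symm) u v w = fderiv ℝ ((θ i).pullback e.symm) u w v := by
    intro u hu v w hv hw i
    rw [← sub_eq_zero, h.structureEquations.fderiv_pullback_sub h.isSmooth (hsat u hu.1)]
    simp [hv, hw]
  obtain ⟨r, hr, s, hs0, hss, hsp⟩ := exists_contDiffOn_flat_section hW
    (contMDiffOn_iff_contDiffOn.1 hfs)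
    (fun i u hu ↦ ((h.isSmooth i).contDiffAt_pullback (hsat u hu.1)).contDiffWithinAt)
    h.finrank_eq hinj hflat hy0
  rw [hfey] at hs0 hss hsp
  have hcp : ∀ p ∈ ball (c (π y)) r, p ∈ c.target ∧ π (e.symm (s p)) = c.symm p := by
    intro p hp
    obtain ⟨h1, h2, -⟩ := hsp p hp
    have h3 : c (π (e.symm (s p))) = p := h2
    have h4 : c.symm (c (π (e.symm (s p)))) = π (e.symm (s p)) := c.left_inv h1.2
    exact ⟨h3 ▸ c.map_source h1.2, by rw [← h4, h3]⟩
  refine ⟨r, hr, fun p ↦ e.symm (s p), by simp only [hs0, hey], fun p hp ↦ (hcp p hp).1, ⟨?_, ?_⟩,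
    fun p hp ↦ (hcp p hp).2⟩
  · exact hsymm.comp hss.contMDiffOn fun p hp ↦ (hsp p hp).1.1
  · intro p hp i
    obtain ⟨h1, h2, h3⟩ := hsp p hp
    have hsd : MDifferentiableAt 𝓘(ℝ, F) 𝓘(ℝ, E) s p :=
      (((hss p hp).contDiffAt (isOpen_ball.mem_nhds hp)).differentiableAt
        (by simp)).mdifferentiableAt
    have h4 : mfderiv 𝓘(ℝ, F) 𝓘(ℝ, E) (fun p ↦ e.symm (s p)) p =
        (mfderiv 𝓘(ℝ, E) 𝓘(ℝ, E) e.symm (s p)).comp (mfderiv 𝓘(ℝ, F) 𝓘(ℝ, E) s p) :=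
      mfderiv_comp p ((hsat _ h1.1).mdifferentiableAt (by simp)) hsd
    ext w
    rw [OneForm.pullback_apply, h4, mfderiv_eq_fderiv]
    exact h3 i w

end FlatPlot

/-! ### Continuation arguments -/

section Connected

open Filter Topology

/-- The local hypothesis is symmetric in `a` and `b`, so both the set where `P` holds and its
complement are open. -/
theorem of_locally_iff {X : Type*} [TopologicalSpace X] [PreconnectedSpace X] {P : X → Prop}
    (h : ∀ x, ∃ U ∈ 𝓝 x, ∀ a ∈ U, ∀ b ∈ U, P a → P b) {x y : X} (hx : P x) : P y := by
  have hc : IsClopen {a | P a} := by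
    constructor
    · rw [← isOpen_compl_iff, isOpen_iff_mem_nhds]
      intro a ha
      obtain ⟨U, hU, hP⟩ := h a
      filter_upwards [hU] with c hc hPc using ha (hP c hc a (mem_of_mem_nhds hU) hPc)
    · rw [isOpen_iff_mem_nhds]
      intro a ha
      obtain ⟨U, hU, hP⟩ := h a
      filter_upwards [hU] with c hc using hP a (mem_of_mem_nhds hU) c hc ha
  exact (hc.eq_univ ⟨x, hx⟩).ge (mem_univ y)

/-- Gronwall's inequality along the segment from `a` to `c`. -/
theorem eq_zero_of_norm_fderiv_le {E V : Type*} [NormedAddCommGroup E] [NormedSpace ℝ E]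
    [NormedAddCommGroup V] [NormedSpace ℝ V] {u : E → V} {s : Set E} (hs : Convex ℝ s) {K : ℝ}
    (hd : ∀ z ∈ s, DifferentiableAt ℝ u z) (hK : ∀ z ∈ s, ‖fderiv ℝ u z‖ ≤ K * ‖u z‖)
    {a c : E} (ha : a ∈ s) (hc : c ∈ s) (h0 : u a = 0) : u c = 0 := by
  set ℓ : ℝ → E := fun t ↦ a + t • (c - a) with hℓ
  have hmem : ∀ t ∈ Icc (0 : ℝ) 1, ℓ t ∈ s := fun t ht ↦ hs.add_smul_sub_mem ha hc ht
  have hℓd : ∀ t, HasDerivAt ℓ (c - a) t := fun t ↦ by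
    simpa [hℓ] using ((hasDerivAt_id t).smul_const (c - a)).const_add a
  have hder : ∀ t ∈ Icc (0 : ℝ) 1,
      HasDerivAt (fun t ↦ u (ℓ t)) (fderiv ℝ u (ℓ t) (c - a)) t := fun t ht ↦
    (hd _ (hmem t ht)).hasFDerivAt.comp_hasDerivAt t (hℓd t)
  have := eq_zero_of_abs_deriv_le_mul_abs_self_of_eq_zero_right (f := fun t ↦ u (ℓ t))
    (f' := fun t ↦ fderiv ℝ u (ℓ t) (c - a)) (K := K * ‖c - a‖) (a := 0) (b := 1)
    (fun t ht ↦ (hder t ht).continuousAt.continuousWithinAt)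
    (fun t ht ↦ (hder t (Ico_subset_Icc_self ht)).hasDerivWithinAt) (by simp [hℓ, h0])
    (fun t ht ↦ ?_) 1 (by simp)
  · simpa [hℓ] using this
  · calc ‖fderiv ℝ u (ℓ t) (c - a)‖ ≤ ‖fderiv ℝ u (ℓ t)‖ * ‖c - a‖ :=
        ContinuousLinearMap.le_opNorm _ _
      _ ≤ (K * ‖u (ℓ t)‖) * ‖c - a‖ := mul_le_mul_of_nonneg_right
        (hK _ (hmem t (Ico_subset_Icc_self ht))) (norm_nonneg _)
      _ = _ := by ring

end Connected

/-! ### Translates of leaves -/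

section Translation

open Filter Topology Metric

variable {E M EG G F P ι : Type*} [NormedAddCommGroup E] [NormedSpace ℝ E]
  [TopologicalSpace M] [ChartedSpace E M]
  [NormedAddCommGroup EG] [NormedSpace ℝ EG] [TopologicalSpace G] [ChartedSpace EG G]
  [NormedAddCommGroup F] [NormedSpace ℝ F] [NormedAddCommGroup P] [NormedSpace ℝ P]

theorem OneForm.pullback_comp (α : OneForm E M) {Ψ : P → M} {f : F → P} {q : F}
    (hΨ : MDifferentiableAt 𝓘(ℝ, P) 𝓘(ℝ, E) Ψ (f q)) (hf : DifferentiableAt ℝ f q) :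
    α.pullback (fun x ↦ Ψ (f x)) q = (α.pullback Ψ (f q)).comp (fderiv ℝ f q) := by
  have h := mfderiv_comp q hΨ hf.mdifferentiableAt
  ext w
  rw [OneForm.pullback_apply]
  change α _ (mfderiv 𝓘(ℝ, F) 𝓘(ℝ, E) (Ψ ∘ f) q w) = _
  rw [h, mfderiv_eq_fderiv]
  rfl

theorem OneForm.pullback_comp_mfderiv (α : OneForm E M) {Ψ : G → M} {f : F → G} {q : F}
    (hΨ : MDifferentiableAt 𝓘(ℝ, EG) 𝓘(ℝ, E) Ψ (f q))
    (hf : MDifferentiableAt 𝓘(ℝ, F) 𝓘(ℝ, EG) f q) (w : F) :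
    α.pullback (fun x ↦ Ψ (f x)) q w =
      α (Ψ (f q)) (mfderiv 𝓘(ℝ, EG) 𝓘(ℝ, E) Ψ (f q) (mfderiv 𝓘(ℝ, F) 𝓘(ℝ, EG) f q w)) := by
  have h := mfderiv_comp q hΨ hf
  rw [OneForm.pullback_apply]
  change α _ (mfderiv 𝓘(ℝ, F) 𝓘(ℝ, E) (Ψ ∘ f) q w) = _
  rw [h]
  rfl

/-- Each bracket is at most `2 * (T * B)`; the factor cancels against `1 / 2`. -/
theorem abs_half_sum_le [Fintype ι] (C : ι → ι → ℝ) {x t : ι → ℝ} {B T : ℝ}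
    (hx : ∀ j, |x j| ≤ B) (ht : ∀ j, |t j| ≤ T) :
    |(1 / 2 : ℝ) * ∑ j, ∑ k, C j k * (x j * t k - t j * x k)| ≤
      (∑ j, ∑ k, |C j k|) * (T * B) := by
  rw [abs_mul, Finset.sum_mul]
  have h1 : |∑ j, ∑ k, C j k * (x j * t k - t j * x k)| ≤
      ∑ j, (∑ k, |C j k|) * (2 * (T * B)) := by
    refine (Finset.abs_sum_le_sum_abs _ _).trans (Finset.sum_le_sum fun j _ ↦ ?_)
    rw [Finset.sum_mul]
    refine (Finset.abs_sum_le_sum_abs _ _).trans (Finset.sum_le_sum fun k _ ↦ ?_)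
    rw [abs_mul]
    refine mul_le_mul_of_nonneg_left ?_ (abs_nonneg _)
    have hT : 0 ≤ T := (abs_nonneg _).trans (ht j)
    have h2 : |x j * t k| ≤ B * T := by
      rw [abs_mul]; exact mul_le_mul (hx j) (ht k) (abs_nonneg _) ((abs_nonneg _).trans (hx j))
    have h3 : |t j * x k| ≤ T * B := by
      rw [abs_mul]; exact mul_le_mul (ht j) (hx k) (abs_nonneg _) hT
    have := abs_sub (x j * t k) (t j * x k)
    linarith
  rw [abs_of_pos (by norm_num : (0 : ℝ) < 1 / 2)]
  calc (1 / 2 : ℝ) * |∑ j, ∑ k, C j k * (x j * t k - t j * x k)|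
      ≤ (1 / 2 : ℝ) * ∑ j, (∑ k, |C j k|) * (2 * (T * B)) := by gcongr
    _ = _ := by rw [Finset.mul_sum]; exact Finset.sum_congr rfl fun j _ ↦ by ring

/-- Translates of leaves under an action whose orbit maps pull the forms `θ` back to forms
independent of the orbit are leaves. -/
theorem IsFlatPlot.translate [IsManifold 𝓘(ℝ, E) ∞ M] [IsManifold 𝓘(ℝ, EG) ∞ G]
    [PreconnectedSpace G] [Fintype ι]
    {C : ι → ι → ι → ℝ} {θ : ι → OneForm E M}
    (hθ : ∀ i, (θ i).IsSmooth) (hd : SatisfiesStructureEquations C θ) {A : G → M → M}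
    (hA : ContMDiff (𝓘(ℝ, EG).prod 𝓘(ℝ, E)) 𝓘(ℝ, E) ∞ (fun p : G × M ↦ A p.1 p.2))
    {Θ : ι → OneForm EG G}
    (hΘ : ∀ i h x (ξ : TangentSpace 𝓘(ℝ, EG) h),
      θ i (A h x) (mfderiv 𝓘(ℝ, EG) 𝓘(ℝ, E) (fun h ↦ A h x) h ξ) = Θ i h ξ)
    {σ : F → M} {O : Set F} (hO : IsOpen O) {h₀ : G}
    (hσ : IsFlatPlot θ (fun p ↦ A h₀ (σ p)) O) (hσ' : ContMDiffOn 𝓘(ℝ, F) 𝓘(ℝ, E) ∞ σ O)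
    (h : G) : IsFlatPlot θ (fun p ↦ A h (σ p)) O := by
  refine ⟨fun p hp ↦ (hA.comp (contMDiff_const.prodMk contMDiff_id)).contMDiffAt.comp_contMDiffWithinAt
    p (hσ' p hp), fun p hp i ↦ ?_⟩
  have hσp : ∀ p ∈ O, ContMDiffAt 𝓘(ℝ, F) 𝓘(ℝ, E) ∞ σ p := fun p hp ↦
    (hσ' p hp).contMDiffAt (hO.mem_nhds hp)
  have hA1 : ∀ x, ContMDiff 𝓘(ℝ, EG) 𝓘(ℝ, E) ∞ (fun h ↦ A h x) := fun x ↦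
    hA.comp (contMDiff_id.prodMk contMDiff_const)
  ext w
  refine of_locally_iff (P := fun h ↦ ∀ i, (θ i).pullback (fun p ↦ A h (σ p)) p w = 0)
    (fun h₁ ↦ ?_) (x := h₀) (y := h) (fun i ↦ by simp [hσ.pullback_eq_zero p hp i]) i
  set χ := extChartAt 𝓘(ℝ, EG) h₁ with hχ
  have hχs : ContMDiffOn 𝓘(ℝ, EG) 𝓘(ℝ, EG) ∞ χ.symm χ.target := contMDiffOn_extChartAt_symm h₁
  have hχo : IsOpen χ.target := isOpen_extChartAt_target h₁
  have hχat : ∀ z ∈ χ.target, ContMDiffAt 𝓘(ℝ, EG) 𝓘(ℝ, EG) ∞ χ.symm z := fun z hz ↦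
    (hχs z hz).contMDiffAt (hχo.mem_nhds hz)
  -- Leaf and group parameters together, the group near the base point of the chart; the structure
  -- equations are pulled back to this product.
  set Ψ : F × EG → M := fun q ↦ A (χ.symm q.2) (σ q.1) with hΨ
  have hΨs : ∀ q : F × EG, q.1 ∈ O → q.2 ∈ χ.target → ContMDiffAt 𝓘(ℝ, F × EG) 𝓘(ℝ, E) ∞ Ψ q := by
    intro q h1 h2
    refine hA.contMDiffAt.comp q (ContMDiffAt.prodMk ?_ ?_)
    · exact (hχat _ h2).comp q contDiff_snd.contMDiff.contMDiffAt
    · exact (hσp _ h1).comp q contDiff_fst.contMDiff.contMDiffAt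
  set β : ι → F × EG → F × EG →L[ℝ] ℝ := fun i ↦ (θ i).pullback Ψ with hβ
  have hβs : ∀ i, ∀ q : F × EG, q.1 ∈ O → q.2 ∈ χ.target → ContDiffAt ℝ ∞ (β i) q := fun i q h1 h2 ↦
    (hθ i).contDiffAt_pullback (hΨs q h1 h2)
  have hβ1 : ∀ i z, z ∈ χ.target → ∀ v : F,
      β i (p, z) (v, 0) = (θ i).pullback (fun p ↦ A (χ.symm z) (σ p)) p v := by
    intro i z hz v
    have h1 := (θ i).pullback_comp (Ψ := Ψ) (f := fun p : F ↦ (p, z)) (q := p)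
      ((hΨs (p, z) hp hz).mdifferentiableAt (by simp)) (by fun_prop)
    have h2 : fderiv ℝ (fun p : F ↦ (p, z)) p = ContinuousLinearMap.inl ℝ F EG :=
      (hasFDerivAt_prodMk_left p z).fderiv
    rw [h2] at h1
    exact (DFunLike.congr_fun h1 v).symm
  have hβ2 : ∀ i (p' : F) z, p' ∈ O → z ∈ χ.target → ∀ ζ : EG,
      β i (p', z) (0, ζ) = Θ i (χ.symm z) (mfderiv 𝓘(ℝ, EG) 𝓘(ℝ, EG) χ.symm z ζ) := by
    intro i p' z hp' hz ζ
    have h1 := (θ i).pullback_comp (Ψ := Ψ) (f := fun z : EG ↦ (p', z)) (q := z)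
      ((hΨs (p', z) hp' hz).mdifferentiableAt (by simp)) (by fun_prop)
    have h2 : fderiv ℝ (fun z : EG ↦ (p', z)) z = ContinuousLinearMap.inr ℝ F EG :=
      (hasFDerivAt_prodMk_right p' z).fderiv
    rw [h2] at h1
    refine (DFunLike.congr_fun h1 ζ).symm.trans ?_
    refine ((θ i).pullback_comp_mfderiv (Ψ := fun h ↦ A h (σ p')) (f := χ.symm)
      ((hA1 _).mdifferentiable (by simp) _) ((hχat z hz).mdifferentiableAt (by simp)) ζ).trans ?_
    exact hΘ i _ _ _
  -- The values of the forms on the translated leaf vector, as a function of the group coordinate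
  -- alone. The aim is a homogeneous linear bound on its derivative.
  set u : EG → ι → ℝ := fun z i ↦ β i (p, z) (w, 0) with hu
  have hud : ∀ z ∈ χ.target, ∀ i, HasFDerivAt (fun z ↦ u z i)
      (((ContinuousLinearMap.apply ℝ ℝ ((w, 0) : F × EG)).comp (fderiv ℝ (β i) (p, z))).comp
        (ContinuousLinearMap.inr ℝ F EG)) z := by
    intro z hz i
    have h1 : HasFDerivAt (β i) (fderiv ℝ (β i) (p, z)) (p, z) :=
      ((hβs i (p, z) hp hz).differentiableAt (by simp)).hasFDerivAt
    exact ((ContinuousLinearMap.apply ℝ ℝ ((w, 0) : F × EG)).hasFDerivAt.comp _ h1).comp z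
      (hasFDerivAt_prodMk_right p z)
  -- By `hΘ` the value on a group direction does not depend on the orbit, so its derivative along
  -- the leaf vanishes. This leaves a single derivative in the structure equation, the one in `hDu`.
  have hvert : ∀ z ∈ χ.target, ∀ i ζ, fderiv ℝ (β i) (p, z) (w, 0) (0, ζ) = 0 := by
    intro z hz i ζ
    have h1 : HasFDerivAt (β i) (fderiv ℝ (β i) (p, z)) (p, z) :=
      ((hβs i (p, z) hp hz).differentiableAt (by simp)).hasFDerivAt
    have h2 := HasFDerivAt.comp (f := fun p' : F ↦ (p', z)) p
      ((ContinuousLinearMap.apply ℝ ℝ ((0, ζ) : F × EG)).hasFDerivAt.comp _ h1)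
      (hasFDerivAt_prodMk_left p z)
    have h3 : (((ContinuousLinearMap.apply ℝ ℝ ((0, ζ) : F × EG)) ∘ β i) ∘ fun p' : F ↦ (p', z))
        =ᶠ[𝓝 p] fun _ ↦ Θ i (χ.symm z) (mfderiv 𝓘(ℝ, EG) 𝓘(ℝ, EG) χ.symm z ζ) := by
      filter_upwards [hO.mem_nhds hp] with p' hp'
      exact hβ2 i p' z hp' hz ζ
    have h4 := h2.unique ((hasFDerivAt_const _ p).congr_of_eventuallyEq h3)
    exact DFunLike.congr_fun h4 w
  have hDu : ∀ z ∈ χ.target, ∀ i ζ, fderiv ℝ (β i) (p, z) (0, ζ) (w, 0) =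
      -((1 / 2 : ℝ) * ∑ j, ∑ k, C i j k *
        (u z j * β k (p, z) (0, ζ) - β j (p, z) (0, ζ) * u z k)) := by
    intro z hz i ζ
    have h1 := hd.fderiv_pullback_sub hθ (hΨs (p, z) hp hz) i (w, 0) (0, ζ)
    have h2 := hvert z hz i ζ
    rw [← h1]
    simp only [hβ] at h2 ⊢
    rw [h2]; ring
  have hz₁ : χ h₁ ∈ χ.target := mem_extChartAt_target h₁
  have hbd : ∀ᶠ z in 𝓝 (χ h₁), ∀ i, ‖β i (p, z)‖ < ‖β i (p, χ h₁)‖ + 1 := by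
    rw [eventually_all]
    intro i
    have h1 : ContinuousAt (fun z ↦ β i (p, z)) (χ h₁) :=
      ContinuousAt.comp (f := fun z : EG ↦ (p, z)) (hβs i (p, χ h₁) hp hz₁).continuousAt
        (by fun_prop)
    exact h1.norm.eventually_lt continuousAt_const (by simp)
  obtain ⟨r, hr, hball⟩ := Metric.eventually_nhds_iff_ball.1 (hbd.and (hχo.mem_nhds hz₁))
  set B : ℝ := ∑ i, (‖β i (p, χ h₁)‖ + 1) with hB
  have hβB : ∀ z ∈ ball (χ h₁) r, ∀ i, ‖β i (p, z)‖ ≤ B := by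
    intro z hz i
    refine ((hball z hz).1 i).le.trans ?_
    exact Finset.single_le_sum (f := fun i ↦ ‖β i (p, χ h₁)‖ + 1) (fun j _ ↦ by positivity)
      (Finset.mem_univ i)
  set K : ℝ := (∑ i, ∑ j, ∑ k, |C i j k|) * B with hK
  have hudiff : ∀ z ∈ ball (χ h₁) r, HasFDerivAt u (ContinuousLinearMap.pi fun i ↦
      (((ContinuousLinearMap.apply ℝ ℝ ((w, 0) : F × EG)).comp (fderiv ℝ (β i) (p, z))).comp
        (ContinuousLinearMap.inr ℝ F EG))) z := fun z hz ↦
    hasFDerivAt_pi.2 (hud z (hball z hz).2)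
  have hB0 : 0 ≤ B := Finset.sum_nonneg fun i _ ↦ by positivity
  have hS0 : 0 ≤ ∑ i, ∑ j, ∑ k, |C i j k| :=
    Finset.sum_nonneg fun i _ ↦ Finset.sum_nonneg fun j _ ↦ Finset.sum_nonneg fun k _ ↦ abs_nonneg _
  refine ⟨χ.source ∩ χ ⁻¹' ball (χ h₁) r, inter_mem (extChartAt_source_mem_nhds h₁)
    ((continuousAt_extChartAt h₁).preimage_mem_nhds (ball_mem_nhds _ hr)), ?_⟩
  intro a ha c hc hPa i
  have hval : ∀ a ∈ χ.source ∩ χ ⁻¹' ball (χ h₁) r, ∀ i,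
      u (χ a) i = (θ i).pullback (fun p ↦ A a (σ p)) p w := by
    intro a ha i
    rw [hu]
    simp only
    rw [hβ1 i _ (hball _ ha.2).2, χ.left_inv ha.1]
  rw [← hval c hc]
  have hfin := eq_zero_of_norm_fderiv_le (u := u) (s := ball (χ h₁) r) (K := K) (convex_ball _ _)
    (fun z hz ↦ (hudiff z hz).differentiableAt) (fun z hz ↦ ?_) ha.2 hc.2
    (funext fun i ↦ by rw [hval a ha]; exact hPa i)
  · rw [hfin]; rfl
  · rw [(hudiff z hz).fderiv]
    refine ContinuousLinearMap.opNorm_le_bound _ (by positivity) fun ζ ↦ ?_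
    refine (pi_norm_le_iff_of_nonneg (by positivity)).2 fun i ↦ ?_
    change ‖fderiv ℝ (β i) (p, z) (0, ζ) (w, 0)‖ ≤ _
    rw [hDu z (hball z hz).2, norm_neg, Real.norm_eq_abs]
    refine (abs_half_sum_le (C i) (x := u z) (t := fun k ↦ β k (p, z) (0, ζ)) (B := ‖u z‖)
      (T := B * ‖ζ‖) (fun j ↦ norm_le_pi_norm (u z) j) (fun j ↦ ?_)).trans ?_
    · refine ((β j (p, z)).le_opNorm _).trans (mul_le_mul (hβB z hz j) ?_ (norm_nonneg _) hB0)
      simp [Prod.norm_def]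
    · have h1 : ∑ j, ∑ k, |C i j k| ≤ ∑ i, ∑ j, ∑ k, |C i j k| :=
        Finset.single_le_sum (f := fun i ↦ ∑ j, ∑ k, |C i j k|) (fun i _ ↦
          Finset.sum_nonneg fun j _ ↦ Finset.sum_nonneg fun k _ ↦ abs_nonneg _) (Finset.mem_univ i)
      calc _ ≤ (∑ i, ∑ j, ∑ k, |C i j k|) * (B * ‖ζ‖ * ‖u z‖) :=
            mul_le_mul_of_nonneg_right h1 (by positivity)
        _ = _ := by rw [hK]; ring

end Translation

/-! ### Primitives of a flat connection -/

section Primitive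

open Filter Topology Metric Module

variable {E M EG G F P ι : Type*} [NormedAddCommGroup E] [NormedSpace ℝ E]
  [TopologicalSpace M] [ChartedSpace E M] [IsManifold 𝓘(ℝ, E) ∞ M]
  [NormedAddCommGroup EG] [NormedSpace ℝ EG] [TopologicalSpace G] [ChartedSpace EG G]
  [NormedAddCommGroup F] [NormedSpace ℝ F] [NormedAddCommGroup P] [NormedSpace ℝ P]

/-- The inverse function theorem for a map from a normed space to a manifold. -/
theorem exists_local_right_inverse [FiniteDimensional ℝ P] [FiniteDimensional ℝ E] {Ψ : P → M}
    {q₀ : P} (hΨ : ContMDiffAt 𝓘(ℝ, P) 𝓘(ℝ, E) ∞ Ψ q₀)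
    (hinj : ∀ v : P, (mfderiv 𝓘(ℝ, P) 𝓘(ℝ, E) Ψ q₀ v : E) = 0 → v = 0)
    (hdim : finrank ℝ P = finrank ℝ E) :
    ∃ κ : M → P, ContMDiffAt 𝓘(ℝ, E) 𝓘(ℝ, P) ∞ κ (Ψ q₀) ∧ κ (Ψ q₀) = q₀ ∧
      ∀ᶠ x in 𝓝 (Ψ q₀), Ψ (κ x) = x := by
  have hf := contDiffAt_extChartAt_comp hΨ
  set e := extChartAt 𝓘(ℝ, E) (Ψ q₀) with he
  set f : P → E := fun q ↦ e (Ψ q) with hfdef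
  have hi : Function.Injective (fderiv ℝ f q₀).toLinearMap := by
    rw [injective_iff_map_eq_zero]
    intro v hv
    exact hinj v ((mfderiv_eq_fderiv_extChartAt_comp hΨ v).trans hv)
  set L : P ≃L[ℝ] E := (LinearEquiv.ofInjectiveOfFinrankEq (fderiv ℝ f q₀).toLinearMap hi
    hdim).toContinuousLinearEquiv with hL
  have hL' : (L : P →L[ℝ] E) = fderiv ℝ f q₀ := by ext v; rfl
  have hfd : HasFDerivAt f (L : P →L[ℝ] E) q₀ := by
    rw [hL']; exact (hf.differentiableAt (by simp)).hasFDerivAt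
  have hstrict : HasStrictFDerivAt f (L : P →L[ℝ] E) q₀ := hf.hasStrictFDerivAt' hfd (by simp)
  have hinv : ContDiffAt ℝ ∞ (hstrict.localInverse f L q₀) (f q₀) :=
    hf.to_localInverse hfd (by simp)
  have hec : ContMDiffAt 𝓘(ℝ, E) 𝓘(ℝ, E) ∞ e (Ψ q₀) := contMDiffAt_extChartAt
  refine ⟨fun x ↦ hstrict.localInverse f L q₀ (e x), hinv.contMDiffAt.comp (Ψ q₀) hec,
    hstrict.localInverse_apply_image, ?_⟩
  have hκ : ContinuousAt (fun x ↦ hstrict.localInverse f L q₀ (e x)) (Ψ q₀) :=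
    (hinv.contMDiffAt.comp (Ψ q₀) hec).continuousAt
  have h0 : hstrict.localInverse f L q₀ (e (Ψ q₀)) = q₀ := hstrict.localInverse_apply_image
  have h1 : ∀ᶠ x in 𝓝 (Ψ q₀), f (hstrict.localInverse f L q₀ (e x)) = e x :=
    hec.continuousAt.eventually hstrict.eventually_right_inverse
  have h2 : ∀ᶠ x in 𝓝 (Ψ q₀), Ψ (hstrict.localInverse f L q₀ (e x)) ∈ e.source := by
    have h3 : ContinuousAt (fun x ↦ Ψ (hstrict.localInverse f L q₀ (e x))) (Ψ q₀) :=
      ContinuousAt.comp (g := Ψ) (by rw [h0]; exact hΨ.continuousAt) hκ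
    refine h3.preimage_mem_nhds ?_
    rw [h0]
    exact extChartAt_source_mem_nhds (Ψ q₀)
  filter_upwards [h1, h2, extChartAt_source_mem_nhds (I := 𝓘(ℝ, E)) (Ψ q₀)] with x hx1 hx2 hx3
  exact e.injOn hx2 hx3 hx1

/-- In the chart at `f p₀` the map has zero derivative on a ball, and the chart is injective. -/
theorem eventually_eq_of_mfderiv_eq_zero {f : P → M} {O : Set P} (hO : IsOpen O)
    (hf : ContMDiffOn 𝓘(ℝ, P) 𝓘(ℝ, E) ∞ f O)
    (hd : ∀ p ∈ O, ∀ v : P, (mfderiv 𝓘(ℝ, P) 𝓘(ℝ, E) f p v : E) = 0) {p₀ : P} (hp₀ : p₀ ∈ O) :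
    ∀ᶠ p in 𝓝 p₀, f p = f p₀ := by
  set e := extChartAt 𝓘(ℝ, E) (f p₀) with he
  have hc : ContinuousAt f p₀ := hf.continuousOn.continuousAt (hO.mem_nhds hp₀)
  obtain ⟨r, hr, hball⟩ := Metric.eventually_nhds_iff_ball.1
    ((hc.eventually_mem (extChartAt_source_mem_nhds (I := 𝓘(ℝ, E)) (f p₀))).and
      (hO.eventually_mem hp₀))
  have hmd : ∀ p ∈ ball p₀ r, HasFDerivAt (fun p ↦ e (f p)) (0 : P →L[ℝ] E) p := by
    intro p hp
    obtain ⟨h1, h2⟩ := hball p hp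
    have h3 : MDifferentiableAt 𝓘(ℝ, P) 𝓘(ℝ, E) f p :=
      ((hf p h2).contMDiffAt (hO.mem_nhds h2)).mdifferentiableAt (by simp)
    have h4 : MDifferentiableAt 𝓘(ℝ, E) 𝓘(ℝ, E) e (f p) :=
      mdifferentiableAt_extChartAt (by simpa using h1)
    have h5 := mfderiv_comp p h4 h3
    have h6 : DifferentiableAt ℝ (fun p ↦ e (f p)) p :=
      mdifferentiableAt_iff_differentiableAt.1 (h4.comp p h3)
    refine h6.hasFDerivAt.congr_fderiv ?_
    rw [mfderiv_eq_fderiv] at h5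
    ext v
    refine (DFunLike.congr_fun h5 v).trans ?_
    exact (congrArg (mfderiv 𝓘(ℝ, E) 𝓘(ℝ, E) e (f p)) (hd p h2 v)).trans
      (map_zero (mfderiv 𝓘(ℝ, E) 𝓘(ℝ, E) e (f p)))
  filter_upwards [ball_mem_nhds p₀ hr] with p hp
  have h2 := (convex_ball p₀ r).is_const_of_fderivWithin_eq_zero (𝕜 := ℝ)
    (f := fun p ↦ e (f p)) (fun p hp ↦ (hmd p hp).differentiableAt.differentiableWithinAt)
    (fun p hp ↦ by
      rw [fderivWithin_of_isOpen isOpen_ball hp]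
      exact (hmd p hp).fderiv) hp (mem_ball_self hr)
  exact e.injOn (hball p hp).1 (hball p₀ (mem_ball_self hr)).1 h2

theorem eq_of_mfderiv_eq_zero {f : P → M} {O : Set P} (hO : IsOpen O) (hOc : IsPreconnected O)
    (hf : ContMDiffOn 𝓘(ℝ, P) 𝓘(ℝ, E) ∞ f O)
    (hd : ∀ p ∈ O, ∀ v : P, (mfderiv 𝓘(ℝ, P) 𝓘(ℝ, E) f p v : E) = 0) {p p' : P} (hp : p ∈ O)
    (hp' : p' ∈ O) : f p = f p' := by
  have : PreconnectedSpace O := Subtype.preconnectedSpace hOc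
  refine (of_locally_iff (X := O) (P := fun a ↦ f a = f p) (fun a ↦ ?_) (x := ⟨p, hp⟩)
    (y := ⟨p', hp'⟩) rfl).symm
  have h := eventually_eq_of_mfderiv_eq_zero hO hf hd a.2
  refine ⟨{c | f c = f a}, continuous_subtype_val.continuousAt.preimage_mem_nhds h, ?_⟩
  intro c hc c' hc' h1
  exact (hc' : f c' = f a).trans ((hc : f c = f a).symm.trans h1)

theorem eq_of_mfderiv_eq_zero_of_preconnectedSpace [IsManifold 𝓘(ℝ, EG) ∞ G]
    [PreconnectedSpace G] {f : G → M} (hf : ContMDiff 𝓘(ℝ, EG) 𝓘(ℝ, E) ∞ f)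
    (hd : ∀ (g : G) (ξ : TangentSpace 𝓘(ℝ, EG) g), mfderiv 𝓘(ℝ, EG) 𝓘(ℝ, E) f g ξ = 0) (g g' : G) :
    f g = f g' := by
  refine (of_locally_iff (P := fun a ↦ f a = f g) (fun a ↦ ?_) (x := g) (y := g') rfl).symm
  set χ := extChartAt 𝓘(ℝ, EG) a with hχ
  have hs : ContMDiffOn 𝓘(ℝ, EG) 𝓘(ℝ, EG) ∞ χ.symm χ.target := contMDiffOn_extChartAt_symm a
  have ho : IsOpen χ.target := isOpen_extChartAt_target a
  have hev : ∀ᶠ z in 𝓝 (χ a), f (χ.symm z) = f (χ.symm (χ a)) := by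
    refine eventually_eq_of_mfderiv_eq_zero (f := fun z ↦ f (χ.symm z)) ho
      (hf.comp_contMDiffOn hs) (fun z hz v ↦ ?_) (mem_extChartAt_target a)
    have h := mfderiv_comp z (hf.mdifferentiable (by simp) (χ.symm z))
      (((hs z hz).contMDiffAt (ho.mem_nhds hz)).mdifferentiableAt (by simp))
    exact (DFunLike.congr_fun h v).trans (hd _ _)
  have hev' : ∀ᶠ c in 𝓝 a, f c = f a := by
    filter_upwards [(continuousAt_extChartAt (I := 𝓘(ℝ, EG)) a).eventually hev,
      extChartAt_source_mem_nhds (I := 𝓘(ℝ, EG)) a] with c hc hcs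
    rwa [χ.left_inv hcs, χ.left_inv (mem_extChartAt_source a)] at hc
  refine ⟨_, hev', fun c hc c' hc' h1 ↦ ?_⟩
  exact (hc' : f c' = f a).trans ((hc : f c = f a).symm.trans h1)

/-- A primitive is constant along leaves. -/
theorem IsFlatPlot.eq_of_primitive [IsManifold 𝓘(ℝ, EG) ∞ G] {θ : ι → OneForm E M}
    {Θ : ι → OneForm EG G}
    (hΘ : ∀ g (ξ : TangentSpace 𝓘(ℝ, EG) g), (∀ i, Θ i g ξ = 0) → ξ = 0)
    {U : Set M} (hU : IsOpen U) {ρ : M → G} (hρ : ContMDiffOn 𝓘(ℝ, E) 𝓘(ℝ, EG) ∞ ρ U)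
    (hρθ : ∀ i, ∀ x ∈ U, (Θ i (ρ x)).comp (mfderiv 𝓘(ℝ, E) 𝓘(ℝ, EG) ρ x) = θ i x)
    {τ : P → M} {O : Set P} (hO : IsOpen O) (hOc : IsPreconnected O) (hτ : IsFlatPlot θ τ O)
    (hτU : ∀ p ∈ O, τ p ∈ U) {p p' : P} (hp : p ∈ O) (hp' : p' ∈ O) : ρ (τ p) = ρ (τ p') := by
  refine eq_of_mfderiv_eq_zero (f := fun p ↦ ρ (τ p)) hO hOc (hρ.comp hτ.contMDiffOn hτU)
    (fun a ha v ↦ ?_) hp hp'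
  have h1 : MDifferentiableAt 𝓘(ℝ, E) 𝓘(ℝ, EG) ρ (τ a) :=
    ((hρ _ (hτU a ha)).contMDiffAt (hU.mem_nhds (hτU a ha))).mdifferentiableAt (by simp)
  have h2 : MDifferentiableAt 𝓘(ℝ, P) 𝓘(ℝ, E) τ a :=
    ((hτ.contMDiffOn a ha).contMDiffAt (hO.mem_nhds ha)).mdifferentiableAt (by simp)
  have h3 := mfderiv_comp a h1 h2
  refine (DFunLike.congr_fun h3 v).trans (hΘ _ _ fun i ↦ ?_)
  have h4 := DFunLike.congr_fun (hρθ i _ (hτU a ha)) (mfderiv 𝓘(ℝ, P) 𝓘(ℝ, E) τ a v)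
  refine h4.trans ?_
  exact DFunLike.congr_fun (hτ.pullback_eq_zero a ha i) v

/-- The map `ρ` expressing points in terms of a flat section `σ` is a primitive of the
connection. -/
theorem IsFlatPlot.primitive [FiniteDimensional ℝ E] [FiniteDimensional ℝ F]
    [FiniteDimensional ℝ EG] [IsManifold 𝓘(ℝ, EG) ∞ G]
    [PreconnectedSpace G] [Fintype ι] {C : ι → ι → ι → ℝ} {θ : ι → OneForm E M}
    (hθ : ∀ i, (θ i).IsSmooth) (hd : SatisfiesStructureEquations C θ) {A : G → M → M}
    (hA : ContMDiff (𝓘(ℝ, EG).prod 𝓘(ℝ, E)) 𝓘(ℝ, E) ∞ (fun p : G × M ↦ A p.1 p.2))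
    (hfree : ∀ g g' x, A g x = A g' x → g = g') {h₀ : G} (hA₀ : ∀ x, A h₀ x = x)
    {Θ : ι → OneForm EG G}
    (hΘ : ∀ i h x (ξ : TangentSpace 𝓘(ℝ, EG) h),
      θ i (A h x) (mfderiv 𝓘(ℝ, EG) 𝓘(ℝ, E) (fun h ↦ A h x) h ξ) = Θ i h ξ)
    (hΘinj : ∀ g (ξ : TangentSpace 𝓘(ℝ, EG) g), (∀ i, Θ i g ξ = 0) → ξ = 0)
    (hdim : finrank ℝ E = finrank ℝ F + finrank ℝ EG)
    {σ : F → M} {O : Set F} (hO : IsOpen O) (hσ : IsFlatPlot θ σ O)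
    {U : Set M} (hU : IsOpen U) {q : M → F} (hq : ContMDiffOn 𝓘(ℝ, E) 𝓘(ℝ, F) ∞ q U)
    (hqO : ∀ x ∈ U, q x ∈ O) (hqσ : ∀ p ∈ O, ∀ g, q (A g (σ p)) = p)
    {ρ : M → G} (hρ : ∀ x ∈ U, A (ρ x) (σ (q x)) = x) {x : M} (hx : x ∈ U) :
    ContMDiffAt 𝓘(ℝ, E) 𝓘(ℝ, EG) ∞ ρ x ∧
      ∀ i, (Θ i (ρ x)).comp (mfderiv 𝓘(ℝ, E) 𝓘(ℝ, EG) ρ x) = θ i x := by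
  have hσ₀ : IsFlatPlot θ (fun p ↦ A h₀ (σ p)) O := by simpa only [hA₀] using hσ
  have hA1 : ∀ x, ContMDiff 𝓘(ℝ, EG) 𝓘(ℝ, E) ∞ (fun h ↦ A h x) := fun x ↦
    hA.comp (contMDiff_id.prodMk contMDiff_const)
  set g₀ := ρ x with hg₀
  set χ := extChartAt 𝓘(ℝ, EG) g₀ with hχ
  have hχo : IsOpen χ.target := isOpen_extChartAt_target g₀
  have hχat : ∀ z ∈ χ.target, ContMDiffAt 𝓘(ℝ, EG) 𝓘(ℝ, EG) ∞ χ.symm z := fun z hz ↦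
    (contMDiffOn_extChartAt_symm g₀ z hz).contMDiffAt (hχo.mem_nhds hz)
  have hzt : χ g₀ ∈ χ.target := mem_extChartAt_target g₀
  have hzs : χ.symm (χ g₀) = g₀ := χ.left_inv (mem_extChartAt_source g₀)
  set Ψ : F × EG → M := fun a ↦ A (χ.symm a.2) (σ a.1) with hΨ
  set a₀ : F × EG := (q x, χ g₀) with ha₀
  have hpO : q x ∈ O := hqO x hx
  have hΨa : Ψ a₀ = x := by rw [hΨ, ha₀]; simp only [hzs]; exact hρ x hx
  have hσat : ContMDiffAt 𝓘(ℝ, F) 𝓘(ℝ, E) ∞ σ (q x) :=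
    (hσ.contMDiffOn _ hpO).contMDiffAt (hO.mem_nhds hpO)
  have hΨs : ContMDiffAt 𝓘(ℝ, F × EG) 𝓘(ℝ, E) ∞ Ψ a₀ := by
    refine hA.contMDiffAt.comp a₀ (ContMDiffAt.prodMk ?_ ?_)
    · exact (hχat _ hzt).comp a₀ contDiff_snd.contMDiff.contMDiffAt
    · exact ContMDiffAt.comp (f := (Prod.fst : F × EG → F)) a₀ hσat
        contDiff_fst.contMDiff.contMDiffAt
  have hΨd : MDifferentiableAt 𝓘(ℝ, F × EG) 𝓘(ℝ, E) Ψ a₀ := hΨs.mdifferentiableAt (by simp)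
  -- The leaf direction contributes nothing because translated leaves are leaves; the group
  -- direction contributes the invariant form.
  have hsplit : ∀ i (w : F) (ζ : EG), (θ i).pullback Ψ a₀ (w, ζ) =
      Θ i (χ.symm (χ g₀)) (mfderiv 𝓘(ℝ, EG) 𝓘(ℝ, EG) χ.symm (χ g₀) ζ) := by
    intro i w ζ
    have h1 := (θ i).pullback_comp (Ψ := Ψ) (f := fun p : F ↦ (p, χ g₀)) (q := q x) hΨd
      (by fun_prop)
    have h0 : (θ i).pullback (fun p ↦ Ψ (p, χ g₀)) (q x) = 0 :=
      (hσ₀.translate hθ hd hA hΘ hO hσ.contMDiffOn (χ.symm (χ g₀))).pullback_eq_zero _ hpO i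
    rw [(hasFDerivAt_prodMk_left (q x) (χ g₀)).fderiv, h0] at h1
    have h2 := (θ i).pullback_comp (Ψ := Ψ) (f := fun z : EG ↦ (q x, z)) (q := χ g₀) hΨd
      (by fun_prop)
    rw [(hasFDerivAt_prodMk_right (q x) (χ g₀)).fderiv] at h2
    have h3 : ((w, ζ) : F × EG) = ContinuousLinearMap.inl ℝ F EG w +
      ContinuousLinearMap.inr ℝ F EG ζ := by simp
    rw [h3, map_add]
    have h4 : (θ i).pullback Ψ a₀ (ContinuousLinearMap.inl ℝ F EG w) = 0 :=
      (DFunLike.congr_fun h1 w).symm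
    rw [h4, zero_add]
    refine (DFunLike.congr_fun h2 ζ).symm.trans ?_
    refine ((θ i).pullback_comp_mfderiv (Ψ := fun h ↦ A h (σ (q x))) (f := χ.symm)
      ((hA1 _).mdifferentiable (by simp) _) ((hχat _ hzt).mdifferentiableAt (by simp)) ζ).trans ?_
    exact hΘ i _ _ _
  have hΨU : Ψ a₀ ∈ U := hΨa ▸ hx
  -- The leaf component is recovered by `q`, since `q ∘ Ψ` is locally the first projection, and the
  -- group component by the forms, through `hsplit`.
  have hinj : ∀ v : F × EG, (mfderiv 𝓘(ℝ, F × EG) 𝓘(ℝ, E) Ψ a₀ v : E) = 0 → v = 0 := by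
    rintro ⟨w, ζ⟩ hv
    have h1 : (fun a : F × EG ↦ q (Ψ a)) =ᶠ[𝓝 a₀] Prod.fst := by
      filter_upwards [(hO.preimage continuous_fst).mem_nhds (show a₀ ∈ Prod.fst ⁻¹' O from hpO)]
        with a ha using hqσ _ ha _
    have h2 := mfderiv_comp a₀ (((hq _ hΨU).contMDiffAt (hU.mem_nhds hΨU)).mdifferentiableAt
      (by simp)) hΨd
    have h3 : fderiv ℝ (fun a : F × EG ↦ q (Ψ a)) a₀ = ContinuousLinearMap.fst ℝ F EG := by
      rw [h1.fderiv_eq]; exact hasFDerivAt_fst.fderiv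
    have h4 : mfderiv 𝓘(ℝ, F × EG) 𝓘(ℝ, F) (q ∘ Ψ) a₀ = ContinuousLinearMap.fst ℝ F EG := by
      rw [mfderiv_eq_fderiv]; exact h3
    have hw : w = 0 := by
      have h5 := DFunLike.congr_fun (h4.symm.trans h2) ((w, ζ) : F × EG)
      refine h5.trans ?_
      exact (congrArg (mfderiv 𝓘(ℝ, E) 𝓘(ℝ, F) q (Ψ a₀)) hv).trans
        (map_zero (mfderiv 𝓘(ℝ, E) 𝓘(ℝ, F) q (Ψ a₀)))
    have hζ : ζ = 0 := by
      refine mfderiv_extChartAt_symm_injective g₀ hzt (hΘinj _ _ fun i ↦ ?_)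
      rw [← hsplit i w ζ, OneForm.pullback_apply]
      exact (congrArg (θ i (Ψ a₀)) hv).trans (map_zero (θ i (Ψ a₀)))
    rw [hw, hζ]; rfl
  have hdim' : finrank ℝ (F × EG) = finrank ℝ E := by rw [finrank_prod, hdim]
  obtain ⟨κ, hκ, hκ0, hκr⟩ := exists_local_right_inverse hΨs hinj hdim'
  -- By freeness `ρ` must be the group coordinate of the local inverse of `Ψ`, which gives its
  -- smoothness.
  have hsymmc : ∀ᶠ x' in 𝓝 (Ψ a₀), ρ x' = χ.symm (κ x').2 := by
    have hc : ContinuousAt κ (Ψ a₀) := hκ.continuousAt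
    have h1 : ∀ᶠ x' in 𝓝 (Ψ a₀), (κ x').1 ∈ O :=
      hc.eventually (by
        rw [hκ0]; exact (hO.preimage continuous_fst).mem_nhds (show a₀ ∈ Prod.fst ⁻¹' O from hpO))
    filter_upwards [h1, hκr, hU.mem_nhds hΨU] with x' h1 h2 h3
    have h4 : q x' = (κ x').1 := by
      conv_lhs => rw [← h2]
      exact hqσ _ h1 _
    refine hfree _ _ (σ (q x')) ((hρ x' h3).trans ?_)
    rw [h4]; exact h2.symm
  have hρs : ContMDiffAt 𝓘(ℝ, E) 𝓘(ℝ, EG) ∞ ρ (Ψ a₀) := by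
    refine ContMDiffAt.congr_of_eventuallyEq ?_ hsymmc
    refine ContMDiffAt.comp (g := χ.symm) (f := fun x' ↦ (κ x').2) (Ψ a₀) ?_
      (contDiff_snd.contMDiff.contMDiffAt.comp (Ψ a₀) hκ)
    rw [hκ0]
    exact hχat _ hzt
  have hρΨ : ∀ᶠ a in 𝓝 a₀, ρ (Ψ a) = χ.symm a.2 := by
    filter_upwards [hΨs.continuousAt.eventually (hU.mem_nhds hΨU),
      (hO.preimage continuous_fst).mem_nhds (show a₀ ∈ Prod.fst ⁻¹' O from hpO)] with a h1 h2
    refine hfree _ _ (σ a.1) ?_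
    have h3 := hρ (Ψ a) h1
    rwa [hqσ _ h2] at h3
  have hsurj : Function.Surjective (mfderiv 𝓘(ℝ, F × EG) 𝓘(ℝ, E) Ψ a₀ : F × EG → E) := by
    let D : F × EG →ₗ[ℝ] E := (mfderiv 𝓘(ℝ, F × EG) 𝓘(ℝ, E) Ψ a₀).toLinearMap
    have hi : Function.Injective D := by
      rw [injective_iff_map_eq_zero]; exact hinj
    exact (LinearMap.injective_iff_surjective_of_finrank_eq_finrank hdim').1 hi
  have hpull : ∀ i, (Θ i (ρ (Ψ a₀))).comp (mfderiv 𝓘(ℝ, E) 𝓘(ℝ, EG) ρ (Ψ a₀)) = θ i (Ψ a₀) := by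
    intro i
    ext v
    obtain ⟨⟨w, ζ⟩, rfl⟩ := hsurj v
    have h1 := mfderiv_comp a₀ (hρs.mdifferentiableAt (by simp)) hΨd
    have h2 : mfderiv 𝓘(ℝ, F × EG) 𝓘(ℝ, EG) (ρ ∘ Ψ) a₀ =
        mfderiv 𝓘(ℝ, F × EG) 𝓘(ℝ, EG) (χ.symm ∘ Prod.snd) a₀ :=
      Filter.EventuallyEq.mfderiv_eq hρΨ
    have h3 := mfderiv_comp (f := (Prod.snd : F × EG → EG)) (g := χ.symm) a₀
      ((hχat _ hzt).mdifferentiableAt (by simp)) (differentiable_snd a₀).mdifferentiableAt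
    have h4 : mfderiv 𝓘(ℝ, F × EG) 𝓘(ℝ, EG) (Prod.snd : F × EG → EG) a₀ =
        ContinuousLinearMap.snd ℝ F EG := by
      rw [mfderiv_eq_fderiv]; exact hasFDerivAt_snd.fderiv
    rw [h4] at h3
    have h5 : ∀ g, g = g₀ → ∀ u : EG, Θ i g u = Θ i g₀ u := by rintro g rfl u; rfl
    have h6 : ρ (Ψ a₀) = g₀ := by rw [hΨa]
    have h7 := DFunLike.congr_fun ((h1.symm.trans h2).trans h3) ((w, ζ) : F × EG)
    refine (congrArg (Θ i (ρ (Ψ a₀))) h7).trans ?_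
    refine (h5 _ h6 _).trans ?_
    refine Eq.trans ?_ (hsplit i w ζ).symm
    exact (h5 _ hzs _).symm
  have key : ∀ y, Ψ a₀ = y → ContMDiffAt 𝓘(ℝ, E) 𝓘(ℝ, EG) ∞ ρ y ∧
      ∀ i, (Θ i (ρ y)).comp (mfderiv 𝓘(ℝ, E) 𝓘(ℝ, EG) ρ y) = θ i y := by
    rintro _ rfl
    exact ⟨hρs, hpull⟩
  exact key x hΨa

end Primitive

/-! ### Invariant forms and orbit maps -/

section InvariantForms

open Module

variable {E M EG G ι : Type*} [NormedAddCommGroup E] [NormedSpace ℝ E]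
  [TopologicalSpace M] [ChartedSpace E M]
  [NormedAddCommGroup EG] [NormedSpace ℝ EG] [FiniteDimensional ℝ EG]
  [TopologicalSpace G] [ChartedSpace EG G] [Group G] [LieGroup 𝓘(ℝ, EG) ∞ G]
  (b : Basis ι ℝ (GroupLieAlgebra 𝓘(ℝ, EG) G))

/-- A form dual to the infinitesimal generators pulls back along orbit maps to an invariant
form. -/
theorem apply_mfderiv_orbit [DecidableEq ι] {α : OneForm E M} {A : G → M → M}
    (hA : ∀ x, ContMDiff 𝓘(ℝ, EG) 𝓘(ℝ, E) ∞ (fun h ↦ A h x)) {i : ι}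
    (hα : ∀ j x, α x (mfderiv 𝓘(ℝ, EG) 𝓘(ℝ, E) (fun g ↦ A g x) 1 (b j) : E) =
      if i = j then 1 else 0)
    {T : G → G} {h : G} (hT : MDifferentiableAt 𝓘(ℝ, EG) 𝓘(ℝ, EG) T h) (hT1 : T h = 1) {x : M}
    (hTA : ∀ h', A h' x = A (T h') (A h x)) (ξ : TangentSpace 𝓘(ℝ, EG) h) :
    α (A h x) (mfderiv 𝓘(ℝ, EG) 𝓘(ℝ, E) (fun h ↦ A h x) h ξ) =
      b.coord i (mfderiv 𝓘(ℝ, EG) 𝓘(ℝ, EG) T h ξ : EG) := by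
  -- Rebasing the orbit map at `A h x` moves the derivative from `h` to `1`, where duality with the
  -- generators applies.
  have hf : (fun h' ↦ A h' x) = (fun g ↦ A g (A h x)) ∘ T := funext hTA
  set y := A h x with hy
  have hc := mfderiv_comp h ((hA y).mdifferentiable (by simp) (T h)) hT
  rw [← hf] at hc
  have ht : ∀ g, g = 1 → ∀ u : EG, (mfderiv 𝓘(ℝ, EG) 𝓘(ℝ, E) (fun g ↦ A g y) g u : E) =
      mfderiv 𝓘(ℝ, EG) 𝓘(ℝ, E) (fun g ↦ A g y) 1 u := by
    rintro g rfl u; rfl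
  let L : GroupLieAlgebra 𝓘(ℝ, EG) G →ₗ[ℝ] ℝ := (α y).toLinearMap.comp
    (mfderiv 𝓘(ℝ, EG) 𝓘(ℝ, E) (fun g ↦ A g y) 1).toLinearMap
  have hL : L = b.coord i := b.ext fun j ↦ by
    refine (hα j y).trans ?_
    rw [Basis.coord_apply, Basis.repr_self, Finsupp.single_apply]
    simp only [eq_comm]
  refine (congrArg (α y) ((DFunLike.congr_fun hc ξ).trans (ht _ hT1 _))).trans ?_
  exact DFunLike.congr_fun hL _

theorem eq_zero_of_mfderiv_eq_zero_of_leftInverse {f f' : G → G}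
    (hf : ContMDiff 𝓘(ℝ, EG) 𝓘(ℝ, EG) ∞ f) (hf' : ContMDiff 𝓘(ℝ, EG) 𝓘(ℝ, EG) ∞ f')
    (hff : Function.LeftInverse f' f) {g : G} {ξ : TangentSpace 𝓘(ℝ, EG) g}
    (hξ : mfderiv 𝓘(ℝ, EG) 𝓘(ℝ, EG) f g ξ = 0) : ξ = 0 := by
  have hc := mfderiv_comp g (hf'.mdifferentiable (by simp) (f g)) (hf.mdifferentiable (by simp) g)
  rw [hff.comp_eq_id, mfderiv_id] at hc
  refine (DFunLike.congr_fun hc ξ).trans ?_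
  exact (congrArg (mfderiv 𝓘(ℝ, EG) 𝓘(ℝ, EG) f' (f g)) hξ).trans
    (map_zero (mfderiv 𝓘(ℝ, EG) 𝓘(ℝ, EG) f' (f g)))

theorem eq_zero_of_leftForm_eq_zero (g : G) (ξ : TangentSpace 𝓘(ℝ, EG) g)
    (h : ∀ i, leftForm b i g ξ = 0) : ξ = 0 :=
  eq_zero_of_mfderiv_eq_zero_of_leftInverse (f := fun h : G ↦ g⁻¹ * h) (f' := fun h : G ↦ g * h)
    contMDiff_mul_left contMDiff_mul_left (fun h ↦ by simp) (b.forall_coord_eq_zero_iff.1 h)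

theorem eq_zero_of_rightForm_eq_zero (g : G) (ξ : TangentSpace 𝓘(ℝ, EG) g)
    (h : ∀ i, rightForm b i g ξ = 0) : ξ = 0 :=
  eq_zero_of_mfderiv_eq_zero_of_leftInverse (f := fun h : G ↦ h * g⁻¹) (f' := fun h : G ↦ h * g)
    contMDiff_mul_right contMDiff_mul_right (fun h ↦ by simp) (b.forall_coord_eq_zero_iff.1 h)

theorem leftForm_mul (i : ι) (c g : G) :
    (leftForm b i (c * g)).comp (mfderiv 𝓘(ℝ, EG) 𝓘(ℝ, EG) (fun h ↦ c * h) g) =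
      leftForm b i g := by
  have hc := mfderiv_comp (I' := 𝓘(ℝ, EG)) (g := fun h : G ↦ (c * g)⁻¹ * h) (f := fun h ↦ c * h) g
    ((contMDiff_mul_left (I := 𝓘(ℝ, EG)) (n := ∞)).mdifferentiable (by simp) (c * g))
    ((contMDiff_mul_left (I := 𝓘(ℝ, EG)) (n := ∞)).mdifferentiable (by simp) g)
  have hf : (fun h : G ↦ (c * g)⁻¹ * h) ∘ (fun h ↦ c * h) = fun h ↦ g⁻¹ * h :=
    funext fun h ↦ by simp [mul_assoc]
  rw [hf] at hc
  ext ξ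
  exact congrArg (b.coord i) (DFunLike.congr_fun hc ξ).symm

/-- Left translation by a central element is also a right translation, and right forms are right
invariant. -/
theorem rightForm_mul_of_mem_center (i : ι) {c : G} (hcz : c ∈ Subgroup.center G) (g : G) :
    (rightForm b i (c * g)).comp (mfderiv 𝓘(ℝ, EG) 𝓘(ℝ, EG) (fun h ↦ c * h) g) =
      rightForm b i g := by
  have hc := mfderiv_comp (I' := 𝓘(ℝ, EG)) (g := fun h : G ↦ h * (c * g)⁻¹) (f := fun h ↦ c * h) g
    ((contMDiff_mul_right (I := 𝓘(ℝ, EG)) (n := ∞)).mdifferentiable (by simp) (c * g))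
    ((contMDiff_mul_left (I := 𝓘(ℝ, EG)) (n := ∞)).mdifferentiable (by simp) g)
  have hf : (fun h : G ↦ h * (c * g)⁻¹) ∘ (fun h ↦ c * h) = fun h ↦ h * g⁻¹ :=
    funext fun h ↦ by
      simp only [Function.comp_apply, mul_inv_rev]
      rw [← mul_assoc, mul_assoc c, ← Subgroup.mem_center_iff.1 hcz, mul_inv_cancel_right]
  rw [hf] at hc
  ext ξ
  exact congrArg (b.coord i) (DFunLike.congr_fun hc ξ).symm

end InvariantForms

/-! ### Trivializations by flat sections -/

section FlatTrivialization

open Filter Topology Metric Module MulOpposite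

variable {E M EG G F N ι : Type*} [NormedAddCommGroup E] [NormedSpace ℝ E] [FiniteDimensional ℝ E]
  [TopologicalSpace M] [ChartedSpace E M] [IsManifold 𝓘(ℝ, E) ∞ M]
  [NormedAddCommGroup EG] [NormedSpace ℝ EG] [FiniteDimensional ℝ EG]
  [TopologicalSpace G] [ChartedSpace EG G] [Group G] [LieGroup 𝓘(ℝ, EG) ∞ G] [PreconnectedSpace G]
  [NormedAddCommGroup F] [NormedSpace ℝ F] [FiniteDimensional ℝ F]
  [TopologicalSpace N] [ChartedSpace F N] [IsManifold 𝓘(ℝ, F) ∞ N]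
  [MulAction Gᵐᵒᵖ M] [Fintype ι] [DecidableEq ι]
  {b : Basis ι ℝ (GroupLieAlgebra 𝓘(ℝ, EG) G)} {C : ι → ι → ι → ℝ}
  {θ : ι → OneForm E M} {π : M → N}

/-- The trivialization `ρ` of a flat connection over `V` given by a flat section `σ` of `π`, which
is parametrized by means of a coordinate system `κ` on `V`. -/
structure IsFlatTrivialization (θ : ι → OneForm E M) (π : M → N) (V : Set N) (κ : N → F)
    (O : Set F) (σ : F → M) (ρ : M → G) : Prop where
  isOpen_base : IsOpen V
  isOpen : IsOpen O
  isPreconnected : IsPreconnected O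
  contMDiffOn : ContMDiffOn 𝓘(ℝ, F) 𝓘(ℝ, F) ∞ κ V
  mapsTo : ∀ v ∈ V, κ v ∈ O
  isFlatPlot : IsFlatPlot θ σ O
  proj_mem : ∀ p ∈ O, π (σ p) ∈ V
  coord_proj : ∀ p ∈ O, κ (π (σ p)) = p
  smul_eq : ∀ x, π x ∈ V → op (ρ x) • σ (κ (π x)) = x

namespace IsFlatConnection

theorem apply_mfderiv_smul (h : IsFlatConnection F b C θ π) (i : ι) (g : G) (x : M)
    (ξ : TangentSpace 𝓘(ℝ, EG) g) :
    θ i (op g • x) (mfderiv 𝓘(ℝ, EG) 𝓘(ℝ, E) (fun g : G ↦ op g • x) g ξ) = leftForm b i g ξ :=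
  apply_mfderiv_orbit b (A := fun (g : G) x ↦ op g • x) (T := fun g' ↦ g⁻¹ * g') h.contMDiff_orbit
    (fun j x ↦ h.dual i j x)
    ((contMDiff_mul_left (I := 𝓘(ℝ, EG)) (n := ∞)).mdifferentiable (by simp) _) (by simp)
    (fun g' ↦ by rw [smul_smul, ← op_mul, mul_inv_cancel_left]) ξ

theorem eq_of_smul_eq (h : IsFlatConnection F b C θ π) {g g' : G} {x : M}
    (hg : op g • x = op g' • x) : g = g' := by
  have := h.free (g * g'⁻¹) x (by rw [op_mul, mul_smul, hg, smul_smul, ← op_mul]; simp)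
  rwa [mul_inv_eq_one] at this

/-- The leaf through `y` is a section of `π` over a coordinate ball, and `ρ` is the group element
carrying it to a given point of the fibre. -/
theorem exists_isFlatTrivialization (h : IsFlatConnection F b C θ π) (y : M) :
    ∃ (V : Set N) (κ : N → F) (O : Set F) (σ : F → M) (ρ : M → G),
      IsFlatTrivialization θ π V κ O σ ρ ∧ π y ∈ V := by
  obtain ⟨r, hr, σ, -, ht, hσ, hπσ⟩ := h.exists_isFlatPlot y
  set c := extChartAt 𝓘(ℝ, F) (π y) with hc
  have hρ : ∀ x, ∃ g : G, π x ∈ c.source ∩ c ⁻¹' ball (c (π y)) r → op g • σ (c (π x)) = x := by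
    intro x
    by_cases hx : π x ∈ c.source ∩ c ⁻¹' ball (c (π y)) r
    · obtain ⟨g, hg⟩ := (h.proj_eq_iff (σ (c (π x))) x).1 (by
        rw [hπσ _ hx.2, c.left_inv hx.1])
      exact ⟨g, fun _ ↦ hg⟩
    -- Outside the preimage of `V` the value of `ρ` is irrelevant.
    · exact ⟨1, fun hx' ↦ absurd hx' hx⟩
  choose ρ hρ using hρ
  refine ⟨c.source ∩ c ⁻¹' ball (c (π y)) r, c, ball (c (π y)) r, σ, ρ, ?_,
    mem_extChartAt_source (π y), mem_ball_self hr⟩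
  refine ⟨(continuousOn_extChartAt (π y)).isOpen_inter_preimage (isOpen_extChartAt_source (π y))
    isOpen_ball, isOpen_ball, (convex_ball _ _).isPreconnected, ?_, fun v hv ↦ hv.2, hσ, ?_, ?_, hρ⟩
  · refine (contMDiffOn_extChartAt (I := 𝓘(ℝ, F)) (x := π y)).mono fun v hv ↦ ?_
    simpa [hc] using hv.1
  · intro p hp
    rw [hπσ p hp]
    exact ⟨c.map_target (ht hp), by rw [mem_preimage, c.right_inv (ht hp)]; exact hp⟩
  · intro p hp
    rw [hπσ p hp, c.right_inv (ht hp)]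

end IsFlatConnection

namespace IsFlatTrivialization

variable {V : Set N} {κ : N → F} {O : Set F} {σ : F → M} {ρ : M → G}

theorem isOpen_preimage (T : IsFlatTrivialization θ π V κ O σ ρ) (h : IsFlatConnection F b C θ π) :
    IsOpen (π ⁻¹' V) :=
  T.isOpen_base.preimage h.contMDiff_proj.continuous

theorem primitive (T : IsFlatTrivialization θ π V κ O σ ρ) (h : IsFlatConnection F b C θ π)
    {x : M} (hx : π x ∈ V) :
    ContMDiffAt 𝓘(ℝ, E) 𝓘(ℝ, EG) ∞ ρ x ∧
      ∀ i, (leftForm b i (ρ x)).comp (mfderiv 𝓘(ℝ, E) 𝓘(ℝ, EG) ρ x) = θ i x := by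
  have hdim : finrank ℝ EG = Fintype.card ι := Module.finrank_eq_card_basis b
  exact T.isFlatPlot.primitive h.isSmooth h.structureEquations (A := fun (g : G) x ↦ op g • x)
    h.contMDiff_smul (fun g g' x ↦ h.eq_of_smul_eq) (h₀ := 1) (by simp)
    (fun i g x ξ ↦ h.apply_mfderiv_smul i g x ξ) (eq_zero_of_leftForm_eq_zero b)
    (by rw [h.finrank_eq, hdim]) T.isOpen (T.isOpen_preimage h) (q := fun x ↦ κ (π x))
    (T.contMDiffOn.comp h.contMDiff_proj.contMDiffOn fun _ hx ↦ hx) (fun x hx ↦ T.mapsTo _ hx)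
    (fun p hp g ↦ by rw [h.proj_smul, T.coord_proj p hp]) T.smul_eq hx

theorem contMDiffOn_primitive (T : IsFlatTrivialization θ π V κ O σ ρ)
    (h : IsFlatConnection F b C θ π) : ContMDiffOn 𝓘(ℝ, E) 𝓘(ℝ, EG) ∞ ρ (π ⁻¹' V) :=
  fun _ hx ↦ (T.primitive h hx).1.contMDiffWithinAt

theorem map_smul (T : IsFlatTrivialization θ π V κ O σ ρ) (h : IsFlatConnection F b C θ π)
    {x : M} (hx : π x ∈ V) (g : G) : ρ (op g • x) = ρ x * g := by
  have h1 := T.smul_eq (op g • x) (by rwa [h.proj_smul])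
  rw [h.proj_smul] at h1
  refine h.eq_of_smul_eq (h1.trans ?_)
  rw [op_mul, mul_smul, T.smul_eq x hx]

theorem map_section (T : IsFlatTrivialization θ π V κ O σ ρ) (h : IsFlatConnection F b C θ π)
    {p : F} (hp : p ∈ O) : ρ (σ p) = 1 := by
  have h1 := T.smul_eq (σ p) (T.proj_mem p hp)
  rw [T.coord_proj p hp] at h1
  exact h.free _ _ h1

/-- Used to move a flat section to another starting point in the same fibre; `ρ` changes by `g⁻¹` on
the left to compensate. -/
theorem translate (T : IsFlatTrivialization θ π V κ O σ ρ) (h : IsFlatConnection F b C θ π)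
    (g : G) :
    IsFlatTrivialization θ π V κ O (fun p ↦ op g • σ p) (fun x ↦ g⁻¹ * ρ x) where
  isOpen_base := T.isOpen_base
  isOpen := T.isOpen
  isPreconnected := T.isPreconnected
  contMDiffOn := T.contMDiffOn
  mapsTo := T.mapsTo
  isFlatPlot := IsFlatPlot.translate h.isSmooth h.structureEquations
    (A := fun (g : G) x ↦ op g • x) h.contMDiff_smul
    (fun i g x ξ ↦ h.apply_mfderiv_smul i g x ξ) T.isOpen (h₀ := 1) (by simpa using T.isFlatPlot)
    T.isFlatPlot.contMDiffOn g
  proj_mem p hp := by rw [h.proj_smul]; exact T.proj_mem p hp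
  coord_proj p hp := by rw [h.proj_smul]; exact T.coord_proj p hp
  smul_eq x hx := by rw [smul_smul, ← op_mul, mul_inv_cancel_left]; exact T.smul_eq x hx

/-- A primitive of the connection is locally a constant multiple of any trivialization. -/
theorem eventually_eq_primitive (T : IsFlatTrivialization θ π V κ O σ ρ)
    {U : Set M} (hU : IsOpen U) {ρ' : M → G}
    (hρ : ContMDiffOn 𝓘(ℝ, E) 𝓘(ℝ, EG) ∞ ρ' U)
    (hρθ : ∀ i, ∀ x ∈ U, (leftForm b i (ρ' x)).comp (mfderiv 𝓘(ℝ, E) 𝓘(ℝ, EG) ρ' x) = θ i x)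
    {v : N} (hv : v ∈ V) (hvU : σ (κ v) ∈ U) :
    ∀ᶠ w in 𝓝 v, σ (κ w) ∈ U ∧ ρ' (σ (κ w)) = ρ' (σ (κ v)) := by
  have hvO := T.mapsTo v hv
  have h1 : ∀ᶠ p in 𝓝 (κ v), p ∈ O ∧ σ p ∈ U :=
    (T.isOpen.eventually_mem hvO).and ((T.isFlatPlot.contMDiffOn.continuousOn.continuousAt
      (T.isOpen.mem_nhds hvO)).eventually_mem (hU.mem_nhds hvU))
  obtain ⟨r, hr, hball⟩ := Metric.eventually_nhds_iff_ball.1 h1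
  have h2 : ∀ᶠ w in 𝓝 v, κ w ∈ ball (κ v) r :=
    (T.contMDiffOn.continuousOn.continuousAt (T.isOpen_base.mem_nhds hv)).eventually_mem
      (ball_mem_nhds _ hr)
  have hflat : IsFlatPlot θ σ (ball (κ v) r) :=
    ⟨T.isFlatPlot.contMDiffOn.mono fun p hp ↦ (hball p hp).1,
      fun p hp ↦ T.isFlatPlot.pullback_eq_zero p (hball p hp).1⟩
  filter_upwards [h2] with w hw
  exact ⟨(hball _ hw).2, hflat.eq_of_primitive (eq_zero_of_leftForm_eq_zero b) hU hρ hρθ isOpen_ball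
    (convex_ball _ _).isPreconnected (fun p hp ↦ (hball p hp).2) hw (mem_ball_self hr)⟩

end IsFlatTrivialization

end FlatTrivialization

/-! ### Two flat connections with common horizontal spaces -/

section Biconnection

open Filter Topology Metric Module MulOpposite

variable {E M EG G F N ι : Type*} [NormedAddCommGroup E] [NormedSpace ℝ E] [FiniteDimensional ℝ E]
  [TopologicalSpace M] [ChartedSpace E M] [IsManifold 𝓘(ℝ, E) ∞ M]
  [NormedAddCommGroup EG] [NormedSpace ℝ EG] [FiniteDimensional ℝ EG]
  [TopologicalSpace G] [ChartedSpace EG G] [Group G] [LieGroup 𝓘(ℝ, EG) ∞ G] [PreconnectedSpace G]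
  [NormedAddCommGroup F] [NormedSpace ℝ F] [FiniteDimensional ℝ F]
  [TopologicalSpace N] [ChartedSpace F N] [IsManifold 𝓘(ℝ, F) ∞ N]
  [MulAction G M] [MulAction Gᵐᵒᵖ M] [SMulCommClass G Gᵐᵒᵖ M] [Fintype ι] [DecidableEq ι]
  {b : Basis ι ℝ (GroupLieAlgebra 𝓘(ℝ, EG) G)} {C C' : ι → ι → ι → ℝ}
  {θ θ' : ι → OneForm E M} {π : M → N}

variable (F) in
/-- A pair of flat connections `θ`, `θ'` with the same horizontal spaces, for a right action and
a left action of `G` that commute and have the fibres of `π` as orbits. -/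
structure IsFlatBiconnection (b : Basis ι ℝ (GroupLieAlgebra 𝓘(ℝ, EG) G))
    (C C' : ι → ι → ι → ℝ) (θ θ' : ι → OneForm E M) (π : M → N) : Prop
    extends IsFlatConnection F b C θ π where
  contMDiff_smul_left : ContMDiff (𝓘(ℝ, EG).prod 𝓘(ℝ, E)) 𝓘(ℝ, E) ∞
    (fun p : G × M ↦ p.1 • p.2)
  free_left : ∀ (g : G) (x : M), g • x = x → g = 1
  proj_smul_left : ∀ (g : G) (x : M), π (g • x) = π x
  isSmooth_left : ∀ i, (θ' i).IsSmooth
  dual_left : ∀ (i j : ι) (x : M), θ' i x (leftGenerator (b j) x) = if i = j then 1 else 0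
  structureEquations_left : SatisfiesStructureEquations C' θ'
  horizontal_iff : ∀ x v, (∀ i, θ i x v = 0) ↔ ∀ i, θ' i x v = 0

namespace IsFlatBiconnection

theorem contMDiff_orbit_left (h : IsFlatBiconnection F b C C' θ θ' π) (x : M) :
    ContMDiff 𝓘(ℝ, EG) 𝓘(ℝ, E) ∞ (fun g : G ↦ g • x) :=
  h.contMDiff_smul_left.comp (contMDiff_id.prodMk contMDiff_const)

theorem apply_mfderiv_smul_left (h : IsFlatBiconnection F b C C' θ θ' π) (i : ι) (g : G) (x : M)
    (ξ : TangentSpace 𝓘(ℝ, EG) g) :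
    θ' i (g • x) (mfderiv 𝓘(ℝ, EG) 𝓘(ℝ, E) (fun g : G ↦ g • x) g ξ) = rightForm b i g ξ :=
  apply_mfderiv_orbit b (A := fun (g : G) x ↦ g • x) (T := fun g' ↦ g' * g⁻¹)
    h.contMDiff_orbit_left (fun j x ↦ h.dual_left i j x)
    ((contMDiff_mul_right (I := 𝓘(ℝ, EG)) (n := ∞)).mdifferentiable (by simp) _) (by simp)
    (fun g' ↦ by rw [smul_smul, inv_mul_cancel_right]) ξ

theorem eq_of_smul_left_eq (h : IsFlatBiconnection F b C C' θ θ' π) {g g' : G} {x : M}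
    (hg : g • x = g' • x) : g = g' := by
  have := h.free_left (g'⁻¹ * g) x (by rw [mul_smul, hg, smul_smul]; simp)
  exact (inv_mul_eq_one.1 this).symm

/-- Leaves depend only on the common kernel of the forms. -/
theorem isFlatPlot_iff (h : IsFlatBiconnection F b C C' θ θ' π) {σ : F → M} {O : Set F} :
    IsFlatPlot θ σ O ↔ IsFlatPlot θ' σ O := by
  refine ⟨fun hσ ↦ ⟨hσ.contMDiffOn, fun p hp i ↦ ?_⟩, fun hσ ↦ ⟨hσ.contMDiffOn, fun p hp i ↦ ?_⟩⟩
  · ext w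
    exact (h.horizontal_iff _ _).1 (fun i ↦ DFunLike.congr_fun (hσ.pullback_eq_zero p hp i) w) i
  · ext w
    exact (h.horizontal_iff _ _).2 (fun i ↦ DFunLike.congr_fun (hσ.pullback_eq_zero p hp i) w) i

/-- At a point where the two connections agree, so do the infinitesimal generators. -/
theorem leftGenerator_eq_rightGenerator (h : IsFlatBiconnection F b C C' θ θ' π) {x : M}
    (hx : ∀ i, θ i x = θ' i x) (ξ : GroupLieAlgebra 𝓘(ℝ, EG) G) :
    (leftGenerator ξ x : TangentSpace 𝓘(ℝ, E) x) = rightGenerator ξ x := by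
  rw [← sub_eq_zero]
  refine h.eq_zero_of_mfderiv_proj_eq_zero ?_ fun i ↦ ?_
  · rw [map_sub, h.mfderiv_proj_rightGenerator, sub_zero]
    exact mfderiv_mfderiv_orbit_eq_zero h.contMDiff_proj (h.contMDiff_orbit_left x)
      (one_smul G x) (fun g ↦ h.proj_smul_left g x) ξ
  · have h1 : ∀ y, y = x → ∀ (α : ι → OneForm E M) (u : E), (α i y u : ℝ) = α i x u := by
      rintro y rfl α u; rfl
    have h2 := h.apply_mfderiv_smul i 1 x ξ
    have h3 := h.apply_mfderiv_smul_left i 1 x ξ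
    have h4 : leftForm b i 1 ξ = rightForm b i 1 ξ := by
      have e : (fun h : G ↦ 1⁻¹ * h) = fun h ↦ h * 1⁻¹ := by simp
      change b.coord i (mfderiv 𝓘(ℝ, EG) 𝓘(ℝ, EG) (fun h : G ↦ 1⁻¹ * h) 1 ξ : EG) = _
      rw [e]; rfl
    rw [map_sub, sub_eq_zero]
    conv_lhs => rw [hx i]
    refine (h1 _ (one_smul G x) θ' _).symm.trans (h3.trans (h4.symm.trans ?_))
    exact h2.symm.trans (h1 _ (one_smul Gᵐᵒᵖ x) θ _)

/-- At a point where the two connections agree, so do the orbit maps. -/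
theorem smul_eq_op_smul (h : IsFlatBiconnection F b C C' θ θ' π) {x : M}
    (hx : ∀ i, θ i x = θ' i x) (g : G) : g • x = op g • x := by
  -- The goal is that `g ↦ (g · x) · g⁻¹`, the diagonal of `B`, is constant. The diagonal of `R` is
  -- visibly constant, and at `(1, 1)` the partial derivatives of `B` and `R` agree because the
  -- generators do.
  set B : G × G → M := fun a ↦ op a.1⁻¹ • a.2 • x with hB
  set R : G × G → M := fun a ↦ op a.1⁻¹ • op a.2 • x with hR
  have hinv : ContMDiff (𝓘(ℝ, EG).prod 𝓘(ℝ, EG)) 𝓘(ℝ, EG) ∞ (fun a : G × G ↦ a.1⁻¹) :=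
    contMDiff_fst.inv
  have hBs : ContMDiff (𝓘(ℝ, EG).prod 𝓘(ℝ, EG)) 𝓘(ℝ, E) ∞ B :=
    h.contMDiff_smul.comp (hinv.prodMk ((h.contMDiff_orbit_left x).comp contMDiff_snd))
  have hRs : ContMDiff (𝓘(ℝ, EG).prod 𝓘(ℝ, EG)) 𝓘(ℝ, E) ∞ R :=
    h.contMDiff_smul.comp (hinv.prodMk ((h.contMDiff_orbit x).comp contMDiff_snd))
  have hdiag : ContMDiff 𝓘(ℝ, EG) (𝓘(ℝ, EG).prod 𝓘(ℝ, EG)) ∞ (fun g : G ↦ (g, g)) :=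
    contMDiff_id.prodMk contMDiff_id
  set f : G → M := fun g ↦ op g⁻¹ • g • x with hf
  have hfs : ContMDiff 𝓘(ℝ, EG) 𝓘(ℝ, E) ∞ f := hBs.comp hdiag
  have hder : ∀ {K : G × G → M}, ContMDiff (𝓘(ℝ, EG).prod 𝓘(ℝ, EG)) 𝓘(ℝ, E) ∞ K →
      ∀ ξ : EG, (mfderiv 𝓘(ℝ, EG) 𝓘(ℝ, E) (fun g ↦ K (g, g)) 1 ξ : E) =
        (mfderiv 𝓘(ℝ, EG) 𝓘(ℝ, E) (fun g ↦ K (g, 1)) 1 ξ : E) +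
        (mfderiv 𝓘(ℝ, EG) 𝓘(ℝ, E) (fun g ↦ K (1, g)) 1 ξ : E) := by
    intro K hK ξ
    have h1 := mfderiv_comp (f := fun g : G ↦ (g, g)) (g := K) (1 : G) (hK.mdifferentiable (by simp) ((1, 1) : G × G))
      (hdiag.mdifferentiable (by simp) 1)
    have h2 := mfderiv_prodMk (mdifferentiableAt_id (I := 𝓘(ℝ, EG)) (x := (1 : G)))
      (mdifferentiableAt_id (I := 𝓘(ℝ, EG)) (x := (1 : G)))
    rw [mfderiv_id] at h2
    refine (DFunLike.congr_fun h1 ξ).trans ?_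
    refine (congrArg (mfderiv (𝓘(ℝ, EG).prod 𝓘(ℝ, EG)) 𝓘(ℝ, E) K ((1, 1) : G × G))
      (DFunLike.congr_fun h2 ξ)).trans ?_
    exact mfderiv_prod_eq_add_apply (hK.mdifferentiable (by simp) ((1, 1) : G × G))
  have hf1 : ∀ ξ : EG, (mfderiv 𝓘(ℝ, EG) 𝓘(ℝ, E) f 1 ξ : E) = 0 := by
    intro ξ
    have hB1 := hder hBs ξ
    have hR1 := hder hRs ξ
    have e1 : (fun g : G ↦ R (g, g)) = fun _ ↦ x :=
      funext fun g ↦ by simp only [hR, smul_smul, ← op_mul, mul_inv_cancel, op_one, one_smul]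
    have e2 : (fun g : G ↦ R (g, 1)) = fun g ↦ B (g, 1) := by simp [hR, hB]
    have e3 : (fun g : G ↦ R (1, g)) = fun g ↦ op g • x := by simp [hR]
    have e4 : (fun g : G ↦ B (1, g)) = fun g ↦ g • x := by simp [hB]
    rw [e1, e2, e3, mfderiv_const] at hR1
    rw [e4] at hB1
    have h5 : (mfderiv 𝓘(ℝ, EG) 𝓘(ℝ, E) (fun g : G ↦ g • x) 1 ξ : E) =
        mfderiv 𝓘(ℝ, EG) 𝓘(ℝ, E) (fun g : G ↦ op g • x) 1 ξ :=
      h.leftGenerator_eq_rightGenerator hx ξ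
    have h6 : ∀ u v w : E, v = w → u + v = u + w := by rintro u v _ rfl; rfl
    exact hB1.trans ((h6 _ _ _ h5).trans hR1.symm)
  have hf0 : ∀ (g : G) (ξ : TangentSpace 𝓘(ℝ, EG) g), mfderiv 𝓘(ℝ, EG) 𝓘(ℝ, E) f g ξ = 0 := by
    intro g ξ
    set Λ : M → M := fun y ↦ op g⁻¹ • g • y with hΛ
    have hΛs : ContMDiff 𝓘(ℝ, E) 𝓘(ℝ, E) ∞ Λ :=
      h.contMDiff_smul.comp (contMDiff_const.prodMk
        (h.contMDiff_smul_left.comp (contMDiff_const.prodMk contMDiff_id)))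
    -- As the actions commute, the derivative at `g` is the derivative at `1` followed by a linear
    -- map, hence also zero.
    have hfΛ : f = fun g' ↦ Λ (f (g⁻¹ * g')) := funext fun g' ↦ by
      simp only [hf, hΛ]
      rw [smul_comm g (op (g⁻¹ * g')⁻¹), smul_smul g, mul_inv_cancel_left, smul_smul, ← op_mul]
      simp
    have hmul : ContMDiff 𝓘(ℝ, EG) 𝓘(ℝ, EG) ∞ (fun g' : G ↦ g⁻¹ * g') := contMDiff_mul_left
    have h1 := mfderiv_comp g (hΛs.mdifferentiable (by simp) (f (g⁻¹ * g)))
      ((hfs.comp hmul).mdifferentiable (by simp) g)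
    have h2 := mfderiv_comp g (hfs.mdifferentiable (by simp) (g⁻¹ * g))
      (hmul.mdifferentiable (by simp) g)
    have h3 : ∀ g', g' = 1 → ∀ u : EG, (mfderiv 𝓘(ℝ, EG) 𝓘(ℝ, E) f g' u : E) = 0 := by
      rintro _ rfl u; exact hf1 u
    have h4 : (mfderiv 𝓘(ℝ, EG) 𝓘(ℝ, E) (f ∘ fun g' ↦ g⁻¹ * g') g ξ : E) = 0 :=
      (DFunLike.congr_fun h2 ξ).trans (h3 _ (inv_mul_cancel g) _)
    have h5 : (mfderiv 𝓘(ℝ, EG) 𝓘(ℝ, E) (fun g' ↦ Λ (f (g⁻¹ * g'))) g ξ : E) = 0 :=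
      (DFunLike.congr_fun h1 ξ).trans ((congrArg (mfderiv 𝓘(ℝ, E) 𝓘(ℝ, E) Λ (f (g⁻¹ * g))) h4).trans
        (map_zero (mfderiv 𝓘(ℝ, E) 𝓘(ℝ, E) Λ (f (g⁻¹ * g)))))
    rw [← hfΛ] at h5
    exact h5
  have h1 : f g = f 1 := eq_of_mfderiv_eq_zero_of_preconnectedSpace hfs hf0 g 1
  simp only [hf, inv_one, op_one, one_smul] at h1
  conv_rhs => rw [← h1, smul_smul, ← op_mul, inv_mul_cancel, op_one, one_smul]

variable {V : Set N} {κ : N → F} {O : Set F} {σ : F → M} {ρ : M → G}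

/-- The locus where the two orbit maps agree is invariant under parallel transport. -/
theorem smul_section_eq_op_smul (h : IsFlatBiconnection F b C C' θ θ' π)
    (T : IsFlatTrivialization θ π V κ O σ ρ) {p₀ : F} (hp₀ : p₀ ∈ O)
    (hS : ∀ g : G, g • σ p₀ = op g • σ p₀) {p : F} (hp : p ∈ O) (g : G) :
    g • σ p = op g • σ p := by
  have hT := T.isFlatPlot
  have hflat : IsFlatPlot θ (fun p ↦ g • σ p) O := h.isFlatPlot_iff.2 <|
    IsFlatPlot.translate h.isSmooth_left h.structureEquations_left (A := fun (g : G) x ↦ g • x)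
      h.contMDiff_smul_left (fun i g x ξ ↦ h.apply_mfderiv_smul_left i g x ξ) T.isOpen (h₀ := 1)
      (by simpa using h.isFlatPlot_iff.1 hT) hT.contMDiffOn g
  have hmem : ∀ p ∈ O, π (g • σ p) ∈ V := fun p hp ↦ by
    rw [h.proj_smul_left]; exact T.proj_mem p hp
  -- The left translate of the leaf is again a leaf, so `ρ` keeps on it the value taken at `p₀`,
  -- which is `g` by `hS`. Hence `g • σ p` is `σ p` moved by `g` on the right.
  have h1 : ρ (g • σ p) = ρ (g • σ p₀) :=
    hflat.eq_of_primitive (eq_zero_of_leftForm_eq_zero b)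
      (T.isOpen_preimage h.toIsFlatConnection) (T.contMDiffOn_primitive h.toIsFlatConnection)
      (fun i x hx ↦ (T.primitive h.toIsFlatConnection hx).2 i) T.isOpen T.isPreconnected
      hmem hp hp₀
  rw [hS g, T.map_smul h.toIsFlatConnection (T.proj_mem p₀ hp₀),
    T.map_section h.toIsFlatConnection hp₀, one_mul] at h1
  have h2 := T.smul_eq _ (hmem p hp)
  rw [h1, h.proj_smul_left, T.coord_proj p hp] at h2
  exact h2.symm

/-- Since `x = σ · ρ = ρ · σ`, the same `ρ` is the group coordinate for both actions, so the
primitive theorem applies once for each connection. -/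
theorem isBiequivariantPrimitive (h : IsFlatBiconnection F b C C' θ θ' π)
    (T : IsFlatTrivialization θ π V κ O σ ρ)
    (hS : ∀ p ∈ O, ∀ g : G, g • σ p = op g • σ p) :
    IsBiequivariantPrimitive b θ θ' (π ⁻¹' V) ρ := by
  have h' := h.toIsFlatConnection
  have hdim : finrank ℝ EG = Fintype.card ι := Module.finrank_eq_card_basis b
  refine ⟨T.contMDiffOn_primitive h', fun i x hx ↦ (T.primitive h' hx).2 i, fun i x hx ↦ ?_,
    fun x hx g ↦ T.map_smul h' hx g, fun x hx g ↦ ?_⟩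
  · exact (IsFlatPlot.primitive h.isSmooth_left h.structureEquations_left
      (A := fun (g : G) x ↦ g • x) h.contMDiff_smul_left (fun g g' x ↦ h.eq_of_smul_left_eq)
      (h₀ := 1) (by simp) (fun i g x ξ ↦ h.apply_mfderiv_smul_left i g x ξ)
      (eq_zero_of_rightForm_eq_zero b) (by rw [h.finrank_eq, hdim]) T.isOpen
      (h.isFlatPlot_iff.1 T.isFlatPlot) (T.isOpen_preimage h') (q := fun x ↦ κ (π x))
      (T.contMDiffOn.comp h.contMDiff_proj.contMDiffOn fun _ hx ↦ hx) (fun x hx ↦ T.mapsTo _ hx)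
      (fun p hp g ↦ by rw [h.proj_smul_left, T.coord_proj p hp])
      (fun x hx ↦ (hS _ (T.mapsTo _ hx) _).trans (T.smul_eq x hx)) hx).2 i
  · have h1 := T.smul_eq (g • x) (by rw [h.proj_smul_left]; exact hx)
    rw [h.proj_smul_left] at h1
    refine h'.eq_of_smul_eq (h1.trans ?_)
    conv_lhs => rw [← T.smul_eq x hx]
    rw [smul_comm, hS _ (T.mapsTo _ hx), smul_smul, ← op_mul]

/-- The orbits containing a point at which the two orbit maps agree fill up the connected
components which they meet. -/
theorem exists_isFlatTrivialization_section (h : IsFlatBiconnection F b C C' θ θ' π) {s : Set M}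
    (hs : IsPreconnected s) {x₀ : M} (hx₀s : x₀ ∈ s) (hx₀ : ∀ i, θ i x₀ = θ' i x₀) {y : M}
    (hy : y ∈ s) :
    ∃ (V : Set N) (κ : N → F) (O : Set F) (σ : F → M) (ρ : M → G),
      IsFlatTrivialization θ π V κ O σ ρ ∧ π y ∈ V ∧ ∀ p ∈ O, ∀ g : G, g • σ p = op g • σ p := by
  have h' := h.toIsFlatConnection
  -- If the orbit of `y` meets the coincidence locus at `y · a`, the translate of `σ` by `ρ y * a`
  -- passes through that point and so lies in the locus.
  have aux : ∀ {y : M} {V : Set N} {κ : N → F} {O : Set F} {σ : F → M} {ρ : M → G},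
      IsFlatTrivialization θ π V κ O σ ρ → π y ∈ V →
      (∃ a : G, ∀ g : G, g • op a • y = op g • op a • y) →
      ∃ a : G, ∀ p ∈ O, ∀ g : G, g • op a • σ p = op g • op a • σ p := by
    rintro y V κ O σ ρ T hyV ⟨a, ha⟩
    refine ⟨ρ y * a, fun p hp g ↦ ?_⟩
    refine h.smul_section_eq_op_smul (T.translate h' (ρ y * a)) (T.mapsTo _ hyV) (fun g ↦ ?_) hp g
    have h1 := ha g
    rwa [← T.smul_eq y hyV, smul_smul, ← op_mul] at h1
  have : PreconnectedSpace s := Subtype.preconnectedSpace hs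
  have hP : ∃ a : G, ∀ g : G, g • op a • y = op g • op a • y := by
    -- The property continued along `s` is that the orbit meets the locus, not that the point lies
    -- in it: only the former is constant on fibres of `π`.
    refine of_locally_iff (X := s)
      (P := fun y ↦ ∃ a : G, ∀ g : G, g • op a • (y : M) = op g • op a • (y : M))
      (fun z ↦ ?_) (x := ⟨x₀, hx₀s⟩) (y := ⟨y, hy⟩) ⟨1, fun g ↦ ?_⟩
    · obtain ⟨V, κ, O, σ, ρ, T, hz⟩ := h'.exists_isFlatTrivialization (z : M)
      refine ⟨Subtype.val ⁻¹' (π ⁻¹' V), continuous_subtype_val.continuousAt.preimage_mem_nhds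
        ((T.isOpen_preimage h').mem_nhds hz), fun c hc d hd hPc ↦ ?_⟩
      obtain ⟨a, ha⟩ := aux T hc hPc
      refine ⟨(ρ d)⁻¹ * a, fun g ↦ ?_⟩
      have h1 := ha _ (T.mapsTo _ hd) g
      have h2 : op ((ρ (d : M))⁻¹ * a) • (d : M) = op a • σ (κ (π d)) := by
        rw [op_mul, mul_smul, op_inv]
        congr 1
        rw [inv_smul_eq_iff]
        exact (T.smul_eq _ hd).symm
      rw [h2]; exact h1
    · simpa using h.smul_eq_op_smul hx₀ g
  obtain ⟨V, κ, O, σ, ρ, T, hyV⟩ := h'.exists_isFlatTrivialization y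
  obtain ⟨a, ha⟩ := aux T hyV hP
  exact ⟨V, κ, O, _, _, T.translate h' a, hyV, ha⟩

end IsFlatBiconnection

end Biconnection

/-! ### Locally constant cocycles -/

section Cocycle

open Filter Topology

/-- A locally constant cocycle on a simply connected space is a coboundary. -/
theorem exists_coboundary_of_simplyConnectedSpace {X ι A : Type*} [TopologicalSpace X]
    [SimplyConnectedSpace X] [LocallyPathConnectedSpace X] [Group A] {V : ι → Set X}
    (hV : ∀ i, IsOpen (V i)) {idx : X → ι} (hidx : ∀ x, x ∈ V (idx x)) {c : ι → ι → X → A}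
    (hc : ∀ i j, ∀ x ∈ V i ∩ V j, ∀ᶠ y in 𝓝 x, c i j y = c i j x)
    (hcomp : ∀ i j k, ∀ x ∈ V i ∩ V j ∩ V k, c j k x * c i j x = c i k x) :
    ∃ d : ι → X → A, (∀ i, ∀ x ∈ V i, ∀ᶠ y in 𝓝 x, d i y = d i x) ∧
      ∀ i j, ∀ x ∈ V i ∩ V j, d j x = c i j x * d i x := by
  let _ : TopologicalSpace A := ⊥
  have : DiscreteTopology A := ⟨rfl⟩
  -- With discrete fibre, the bundle glued from `c` is a covering, so over a simply connected base
  -- it has a global section. Read in the local trivializations, the section is the required `d`.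
  let Z : FiberBundleCore ι X A :=
    { baseSet := V
      isOpen_baseSet := hV
      indexAt := idx
      mem_baseSet_at := hidx
      coordChange := fun i j x v ↦ c i j x * v
      coordChange_self := fun i x hx v ↦ by
        have h := hcomp i i i x ⟨⟨hx, hx⟩, hx⟩
        rw [mul_eq_left] at h
        rw [h, one_mul]
      continuousOn_coordChange := fun i j p hp ↦ by
        refine ContinuousAt.continuousWithinAt ?_
        have h1 : ∀ᶠ q : X × A in 𝓝 p, c i j q.1 * q.2 = c i j p.1 * q.2 :=
          (continuousAt_fst.eventually (hc i j p.1 hp.1)).mono fun q hq ↦ by rw [hq]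
        refine ContinuousAt.congr ?_ (h1.mono fun _ h ↦ h.symm)
        exact (continuous_of_discreteTopology (f := fun v : A ↦ c i j p.1 * v)).continuousAt.comp
          continuousAt_snd
      coordChange_comp := fun i j k x hx v ↦ by rw [← mul_assoc, hcomp i j k x hx] }
  have hcov : IsCoveringMap (Bundle.TotalSpace.proj : Bundle.TotalSpace A Z.Fiber → X) :=
    FiberBundle.isCoveringMap
  obtain ⟨x₀⟩ : Nonempty X := inferInstance
  obtain ⟨s, ⟨-, hs⟩, -⟩ := hcov.existsUnique_continuousMap_lifts (ContinuousMap.id X) x₀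
    (⟨x₀, (1 : A)⟩ : Bundle.TotalSpace A Z.Fiber) rfl
  have hs' : ∀ x, (s x).proj = x := fun x ↦ congrFun hs x
  let f : X → A := fun x ↦ (s x).2
  have hloc : ∀ i x, (Z.localTriv i (s x)).2 = c (idx x) i x * f x := by
    intro i x
    rw [Z.localTriv_apply]
    change c (idx (s x).proj) i (s x).proj * f x = _
    rw [hs']
  refine ⟨fun i x ↦ (Z.localTriv i (s x)).2, fun i x hx ↦ ?_, fun i j x hx ↦ ?_⟩
  · have h1 : ContinuousAt (fun x ↦ (Z.localTriv i (s x)).2) x := by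
      have h2 : s x ∈ (Z.localTriv i).source := by
        rw [Z.mem_localTriv_source, hs']; exact hx
      exact continuousAt_snd.comp (((Z.localTriv i).continuousAt h2).comp s.continuous.continuousAt)
    exact h1.eventually_mem ((isOpen_discrete {(Z.localTriv i (s x)).2}).mem_nhds rfl)
  · simp only [hloc]
    rw [← mul_assoc, hcomp _ _ _ x ⟨⟨hidx x, hx.1⟩, hx.2⟩]

end Cocycle

/-! ### Patching the local primitives -/

section Global

open Filter Topology Module MulOpposite

variable {E M EG G F N ι : Type*} [NormedAddCommGroup E] [NormedSpace ℝ E] [FiniteDimensional ℝ E]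
  [TopologicalSpace M] [ChartedSpace E M] [IsManifold 𝓘(ℝ, E) ∞ M]
  [NormedAddCommGroup EG] [NormedSpace ℝ EG] [FiniteDimensional ℝ EG]
  [TopologicalSpace G] [ChartedSpace EG G] [Group G] [LieGroup 𝓘(ℝ, EG) ∞ G] [PreconnectedSpace G]
  [NormedAddCommGroup F] [NormedSpace ℝ F] [FiniteDimensional ℝ F]
  [TopologicalSpace N] [ChartedSpace F N] [IsManifold 𝓘(ℝ, F) ∞ N]
  [MulAction G M] [MulAction Gᵐᵒᵖ M] [Fintype ι] [DecidableEq ι]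
  {b : Basis ι ℝ (GroupLieAlgebra 𝓘(ℝ, EG) G)} {C C' : ι → ι → ι → ℝ}
  {θ θ' : ι → OneForm E M} {π : M → N}

/-- Centrality is what preserves the right forms and the left equivariance; the other two properties
hold for any `c`. -/
theorem IsBiequivariantPrimitive.mul_left {U : Set M} {ρ : M → G}
    (hρ : IsBiequivariantPrimitive b θ θ' U ρ) (hU : IsOpen U) {c : G}
    (hc : c ∈ Subgroup.center G) : IsBiequivariantPrimitive b θ θ' U (fun x ↦ c * ρ x) := by
  have hmul : ContMDiff 𝓘(ℝ, EG) 𝓘(ℝ, EG) ∞ (fun g : G ↦ c * g) := contMDiff_mul_left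
  have hcomp : ∀ x ∈ U, mfderiv 𝓘(ℝ, E) 𝓘(ℝ, EG) (fun x ↦ c * ρ x) x =
      (mfderiv 𝓘(ℝ, EG) 𝓘(ℝ, EG) (fun g : G ↦ c * g) (ρ x)).comp
        (mfderiv 𝓘(ℝ, E) 𝓘(ℝ, EG) ρ x) := fun x hx ↦
    mfderiv_comp x (hmul.mdifferentiable (by simp) _)
      (((hρ.contMDiffOn x hx).contMDiffAt (hU.mem_nhds hx)).mdifferentiableAt (by simp))
  refine ⟨hmul.comp_contMDiffOn hρ.contMDiffOn, fun i x hx ↦ ?_, fun i x hx ↦ ?_,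
    fun x hx g ↦ ?_, fun x hx g ↦ ?_⟩
  · rw [hcomp x hx, ← hρ.pullback_left i x hx, ← leftForm_mul b i c (ρ x)]; rfl
  · rw [hcomp x hx, ← hρ.pullback_right i x hx, ← rightForm_mul_of_mem_center b i hc (ρ x)]; rfl
  · rw [hρ.map_right_action x hx, mul_assoc]
  · rw [hρ.map_left_action x hx, ← mul_assoc, ← mul_assoc, Subgroup.mem_center_iff.1 hc]

theorem IsBiequivariantPrimitive.of_locally {ρ : M → G}
    (h : ∀ x, ∃ U : Set M, IsOpen U ∧ x ∈ U ∧ (∀ y ∈ U, ∀ g : G, g • y ∈ U ∧ op g • y ∈ U) ∧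
      ∃ ρ', IsBiequivariantPrimitive b θ θ' U ρ' ∧ EqOn ρ ρ' U) :
    IsBiequivariantPrimitive b θ θ' univ ρ := by
  choose U hU hxU hinv ρ' hρ' heq using h
  have hev : ∀ x, ρ =ᶠ[𝓝 x] ρ' x := fun x ↦ by
    filter_upwards [(hU x).mem_nhds (hxU x)] with y hy using heq x hy
  have ht : ∀ (x : M) (Θ : ι → OneForm EG G) (i : ι) (g : G), g = ρ x → ∀ u : EG,
      (Θ i (ρ x) u : ℝ) = Θ i g u := by rintro x Θ i g rfl u; rfl
  refine ⟨fun x _ ↦ ?_, fun i x _ ↦ ?_, fun i x _ ↦ ?_, fun x _ g ↦ ?_, fun x _ g ↦ ?_⟩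
  · exact ((((hρ' x).contMDiffOn x (hxU x)).contMDiffAt
      ((hU x).mem_nhds (hxU x))).congr_of_eventuallyEq (hev x)).contMDiffWithinAt
  · rw [(hev x).mfderiv_eq, ← (hρ' x).pullback_left i x (hxU x)]
    ext v
    exact ht x (leftForm b) i _ (heq x (hxU x)).symm _
  · rw [(hev x).mfderiv_eq, ← (hρ' x).pullback_right i x (hxU x)]
    ext v
    exact ht x (rightForm b) i _ (heq x (hxU x)).symm _
  · rw [heq x (hinv x x (hxU x) g).2, heq x (hxU x), (hρ' x).map_right_action x (hxU x)]
  · rw [heq x (hinv x x (hxU x) g).1, heq x (hxU x), (hρ' x).map_left_action x (hxU x)]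

variable [SMulCommClass G Gᵐᵒᵖ M]

/-- Over a simply connected base, the local primitives can be patched. -/
theorem IsFlatBiconnection.exists_isBiequivariantPrimitive [SimplyConnectedSpace N]
    (h : IsFlatBiconnection F b C C' θ θ' π) (hπ : Function.Surjective π) [PreconnectedSpace M]
    {x₀ : M} (hx₀ : ∀ i, θ i x₀ = θ' i x₀) :
    ∃ ρ : M → G, IsBiequivariantPrimitive b θ θ' univ ρ := by
  have h' := h.toIsFlatConnection
  have : LocallyPathConnectedSpace N := ChartedSpace.locallyPathConnectedSpace F N
  have hex : ∀ a : N, ∃ (V : Set N) (κ : N → F) (O : Set F) (σ : F → M) (ρ : M → G),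
      IsFlatTrivialization θ π V κ O σ ρ ∧ a ∈ V ∧
        IsBiequivariantPrimitive b θ θ' (π ⁻¹' V) ρ := by
    intro a
    obtain ⟨y, rfl⟩ := hπ a
    obtain ⟨V, κ, O, σ, ρ, T, hy, hS⟩ :=
      h.exists_isFlatTrivialization_section isPreconnected_univ (mem_univ x₀) hx₀ (mem_univ y)
    exact ⟨V, κ, O, σ, ρ, T, hy, h.isBiequivariantPrimitive T hS⟩
  choose V κ O σ ρ T hmem hρ using hex
  have hσ : ∀ a, ∀ v ∈ V a, π (σ a (κ a v)) = v := by
    intro a v hv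
    obtain ⟨y, rfl⟩ := hπ v
    conv_rhs => rw [← (T a).smul_eq y hv, h.proj_smul]
  -- Right equivariance gives `ρ a' = z * ρ a` on a fibre, with `z` the value of `ρ a'` on the
  -- section `σ a`. Evaluating at `g • s` by left equivariance gives `g * z = z * g`.
  have hc : ∀ a a' v, ∃ z : Subgroup.center G, v ∈ V a ∩ V a' →
      ∀ x, π x = v → ρ a' x = z * ρ a x := by
    intro a a' v
    by_cases hv : v ∈ V a ∩ V a'
    · set s := σ a (κ a v) with hs
      have hsv : π s = v := hσ a v hv.1
      have h1 : ∀ x, π x = v → ρ a' x = ρ a' s * ρ a x := by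
        rintro x rfl
        conv_lhs => rw [← (T a).smul_eq x hv.1]
        exact (hρ a').map_right_action s (by rw [mem_preimage, hsv]; exact hv.2) _
      have h2 : ρ a s = 1 := (T a).map_section h' ((T a).mapsTo v hv.1)
      refine ⟨⟨ρ a' s, Subgroup.mem_center_iff.2 fun g ↦ ?_⟩, fun _ ↦ h1⟩
      have h3 := h1 (g • s) (by rw [h.proj_smul_left, hsv])
      rw [(hρ a').map_left_action s (by rw [mem_preimage, hsv]; exact hv.2),
        (hρ a).map_left_action s (by rw [mem_preimage, hsv]; exact hv.1), h2, mul_one] at h3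
      exact h3
    · exact ⟨1, fun hv' ↦ absurd hv' hv⟩
  choose c hc using hc
  have hcs : ∀ a a', ∀ v ∈ V a ∩ V a', (c a a' v : G) = ρ a' (σ a (κ a v)) := by
    intro a a' v hv
    rw [hc a a' v hv _ (hσ a v hv.1), (T a).map_section h' ((T a).mapsTo v hv.1), mul_one]
  obtain ⟨d, hd, hdc⟩ := exists_coboundary_of_simplyConnectedSpace (V := V) (idx := id) (c := c)
    -- Local constancy of the cocycle: `c a a'` is `ρ a'` along the leaf `σ a`, and a primitive is
    -- constant along leaves.
    (fun a ↦ (T a).isOpen_base) hmem (fun a a' v hv ↦ by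
      have h1 := (T a).eventually_eq_primitive ((T a').isOpen_preimage h')
        (hρ a').contMDiffOn (hρ a').pullback_left hv.1 (by
          rw [mem_preimage, hσ a v hv.1]; exact hv.2)
      filter_upwards [h1, ((T a).isOpen_base.inter (T a').isOpen_base).mem_nhds hv] with w h2 h3
      exact Subtype.ext (by rw [hcs a a' w h3, hcs a a' v hv, h2.2]))
    (fun a a' a'' v hv ↦ by
      obtain ⟨y, rfl⟩ := hπ v
      refine Subtype.ext (mul_right_cancel (b := ρ a y) ?_)
      rw [Subgroup.coe_mul, mul_assoc, ← hc a a' _ hv.1 y rfl, ← hc a' a'' _ ⟨hv.1.2, hv.2⟩ y rfl,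
        ← hc a a'' _ ⟨hv.1.1, hv.2⟩ y rfl])
  -- The index is chosen by the point itself. The choice does not matter, because `d` and `ρ` are
  -- both multiplied by `c` under a change of index.
  refine ⟨fun x ↦ ((d (π x) (π x))⁻¹ : Subgroup.center G) * ρ (π x) x, .of_locally fun x ↦ ?_⟩
  obtain ⟨W, hW, hWo, hxW⟩ := _root_.eventually_nhds_iff.1
    ((hd (π x) (π x) (hmem _)).and ((T (π x)).isOpen_base.eventually_mem (hmem (π x))))
  have hUo : IsOpen (π ⁻¹' W) := hWo.preimage h.contMDiff_proj.continuous
  refine ⟨π ⁻¹' W, hUo, hxW, fun y hy g ↦ ?_, fun y ↦ ((d (π x) (π x))⁻¹ : Subgroup.center G) *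
    ρ (π x) y, ?_, fun y hy ↦ ?_⟩
  · rw [mem_preimage, mem_preimage, h.proj_smul_left, h.proj_smul]; exact ⟨hy, hy⟩
  · have hρW : IsBiequivariantPrimitive b θ θ' (π ⁻¹' W) (ρ (π x)) := by
      have hsub : π ⁻¹' W ⊆ π ⁻¹' V (π x) := fun y hy ↦ (hW _ hy).2
      exact ⟨(hρ (π x)).contMDiffOn.mono hsub, fun i y hy ↦ (hρ (π x)).pullback_left i y (hsub hy),
        fun i y hy ↦ (hρ (π x)).pullback_right i y (hsub hy),
        fun y hy ↦ (hρ (π x)).map_right_action y (hsub hy),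
        fun y hy ↦ (hρ (π x)).map_left_action y (hsub hy)⟩
    exact hρW.mul_left hUo (SetLike.coe_mem _)
  · have hyV := (hW _ hy).2
    have h1 := hdc (π x) (π y) (π y) ⟨hyV, hmem _⟩
    rw [(hW _ hy).1] at h1
    have h2 := hc (π x) (π y) (π y) ⟨hyV, hmem _⟩ y rfl
    have h3 := Subgroup.mem_center_iff.1 (c (π x) (π y) (π y)).2
    simp only
    rw [h1, h2, mul_inv_rev, Subgroup.coe_mul, ← mul_assoc, mul_assoc ((d (π x) (π x))⁻¹ :
      Subgroup.center G).1, Subgroup.coe_inv _ (c _ _ _), inv_mul_cancel, mul_one]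

end Global

/-! ### From the hypotheses to a pair of flat connections -/

section Construction

open Filter Topology Module MulOpposite

/-- Differentiate `π ∘ s = id` at `z`. -/
theorem surjective_mfderiv_of_local_section {E M F N : Type*} [NormedAddCommGroup E]
    [NormedSpace ℝ E] [TopologicalSpace M] [ChartedSpace E M]
    [NormedAddCommGroup F] [NormedSpace ℝ F] [TopologicalSpace N] [ChartedSpace F N] {π : M → N}
    {s : N → M} {z : N} (hπ : MDifferentiableAt 𝓘(ℝ, E) 𝓘(ℝ, F) π (s z))
    (hs : MDifferentiableAt 𝓘(ℝ, F) 𝓘(ℝ, E) s z) (hπs : ∀ᶠ v in 𝓝 z, π (s v) = v) :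
    Function.Surjective (mfderiv 𝓘(ℝ, E) 𝓘(ℝ, F) π (s z)) := by
  have h1 := mfderiv_comp z hπ hs
  have h2 : mfderiv 𝓘(ℝ, F) 𝓘(ℝ, F) (π ∘ s) z = mfderiv 𝓘(ℝ, F) 𝓘(ℝ, F) id z :=
    Filter.EventuallyEq.mfderiv_eq hπs
  rw [mfderiv_id] at h2
  exact fun w ↦ ⟨mfderiv 𝓘(ℝ, F) 𝓘(ℝ, E) s z w, (DFunLike.congr_fun (h1.symm.trans h2) w :)⟩

/-- A space is connected if the orbits of a connected group and the orbit space are. -/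
theorem preconnectedSpace_of_orbitRel_quotient {G M : Type*} [TopologicalSpace G] [Group G]
    [ConnectedSpace G] [TopologicalSpace M] [MulAction G M]
    (h : ∀ x : M, Continuous fun g : G ↦ g • x)
    [PreconnectedSpace (MulAction.orbitRel.Quotient G M)] : PreconnectedSpace M := by
  have hq : IsQuotientMap (Quotient.mk _ : M → MulAction.orbitRel.Quotient G M) :=
    isQuotientMap_quotient_mk'
  constructor
  -- For a quotient map with connected fibres, preimages of connected components are connected
  -- components.
  rcases isEmpty_or_nonempty M with hM | ⟨⟨x⟩⟩
  · rw [univ_eq_empty_iff.2 hM]; exact isPreconnected_empty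
  have h1 := hq.preimage_connectedComponent (fun t ↦ ?_) x
  · rw [PreconnectedSpace.connectedComponent_eq_univ, preimage_univ] at h1
    rw [h1]; exact isPreconnected_connectedComponent
  · obtain ⟨y, rfl⟩ := hq.surjective t
    have h2 : (Quotient.mk _ : M → MulAction.orbitRel.Quotient G M) ⁻¹' {Quotient.mk _ y} =
        range fun g : G ↦ g • y := by
      ext z
      rw [mem_preimage, mem_singleton_iff, Quotient.eq]
      exact MulAction.orbitRel_apply
    rw [h2]
    exact isConnected_range (h y)

variable {E M EG G F ι : Type*} [NormedAddCommGroup E] [NormedSpace ℝ E] [FiniteDimensional ℝ E]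
  [TopologicalSpace M] [ChartedSpace E M] [IsManifold 𝓘(ℝ, E) ∞ M]
  [NormedAddCommGroup EG] [NormedSpace ℝ EG] [FiniteDimensional ℝ EG]
  [TopologicalSpace G] [ChartedSpace EG G] [Group G] [LieGroup 𝓘(ℝ, EG) ∞ G] [ConnectedSpace G]
  [NormedAddCommGroup F] [NormedSpace ℝ F] [FiniteDimensional ℝ F]
  [MulAction G M] [MulAction Gᵐᵒᵖ M] [Fintype ι] [DecidableEq ι]

/-- The hypotheses on two commuting actions with common orbits and on the two coframes yield a pair
of flat connections over the orbit space. -/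
theorem isFlatBiconnection_orbitRel [ChartedSpace F (MulAction.orbitRel.Quotient G M)]
    [IsManifold 𝓘(ℝ, F) ∞ (MulAction.orbitRel.Quotient G M)]
    {b : Basis ι ℝ (GroupLieAlgebra 𝓘(ℝ, EG) G)} {C C' : ι → ι → ι → ℝ}
    (hleft : ContMDiff (𝓘(ℝ, EG).prod 𝓘(ℝ, E)) 𝓘(ℝ, E) ∞ (fun p : G × M ↦ p.1 • p.2))
    (hright : ContMDiff (𝓘(ℝ, EG).prod 𝓘(ℝ, E)) 𝓘(ℝ, E) ∞ (fun p : G × M ↦ op p.1 • p.2))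
    (hfree_left : ∀ (g : G) (x : M), g • x = x → g = 1)
    (hfree_right : ∀ (g : G) (x : M), op g • x = x → g = 1)
    (horbits : ∀ x : M, MulAction.orbit G x = MulAction.orbit Gᵐᵒᵖ x)
    (hsub : Manifold.IsSubmersion 𝓘(ℝ, E) 𝓘(ℝ, F) ∞
      (fun x : M ↦ (Quotient.mk _ x : MulAction.orbitRel.Quotient G M)))
    (hsection : ∀ z : MulAction.orbitRel.Quotient G M,
      ∃ V : Set (MulAction.orbitRel.Quotient G M), IsOpen V ∧ z ∈ V ∧
      ∃ s : MulAction.orbitRel.Quotient G M → M, ContMDiffOn 𝓘(ℝ, F) 𝓘(ℝ, E) ∞ s V ∧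
        ∀ v ∈ V, (Quotient.mk _ (s v) : MulAction.orbitRel.Quotient G M) = v)
    {θ θ' : ι → OneForm E M} (hθ : ∀ i, (θ i).IsSmooth) (hθ' : ∀ i, (θ' i).IsSmooth)
    (hdual : ∀ (i j : ι) (x : M), θ i x (rightGenerator (b j) x) = if i = j then 1 else 0)
    (hdual' : ∀ (i j : ι) (x : M), θ' i x (leftGenerator (b j) x) = if i = j then 1 else 0)
    (hspan : ∀ x : M, Submodule.span ℝ (Set.range fun i ↦ θ i x) =
      Submodule.span ℝ (Set.range fun i ↦ θ' i x))
    (hd : SatisfiesStructureEquations C θ) (hd' : SatisfiesStructureEquations C' θ') (x₀ : M) :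
    IsFlatBiconnection F b C C' θ θ'
      (fun x : M ↦ (Quotient.mk _ x : MulAction.orbitRel.Quotient G M)) := by
  set π : M → MulAction.orbitRel.Quotient G M := fun x ↦ Quotient.mk _ x with hπdef
  have hπ : ContMDiff 𝓘(ℝ, E) 𝓘(ℝ, F) ∞ π := hsub.contMDiff
  have hπl : ∀ x y, π x = π y ↔ ∃ g : G, g • y = x := fun x y ↦ by
    rw [hπdef, Quotient.eq]
    exact MulAction.orbitRel_apply
  have hπr : ∀ x y, π x = π y ↔ ∃ g : G, op g • x = y := fun x y ↦ by
    rw [eq_comm, hπl]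
    change y ∈ MulAction.orbit G x ↔ _
    rw [horbits]
    exact ⟨fun ⟨g, hg⟩ ↦ ⟨unop g, hg⟩, fun ⟨g, hg⟩ ↦ ⟨op g, hg⟩⟩
  have hsurj : ∀ x, Function.Surjective (mfderiv 𝓘(ℝ, E) 𝓘(ℝ, F) π x) := by
    intro x
    obtain ⟨V, hV, hxV, s, hs, hsV⟩ := hsection (π x)
    -- The local section only meets the orbit of `x`; translating it by `g` makes it pass through
    -- `x`.
    obtain ⟨g, hg⟩ := (hπl x (s (π x))).1 (hsV _ hxV).symm
    have hact : ContMDiff 𝓘(ℝ, E) 𝓘(ℝ, E) ∞ (fun y : M ↦ g • y) :=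
      hleft.comp (contMDiff_const.prodMk contMDiff_id)
    have hsm : MDifferentiableAt 𝓘(ℝ, F) 𝓘(ℝ, E) (fun v ↦ g • s v) (π x) :=
      (hact.contMDiffAt.comp (π x) ((hs _ hxV).contMDiffAt (hV.mem_nhds hxV))).mdifferentiableAt
        (by simp)
    have h1 : ∀ᶠ v in 𝓝 (π x), π (g • s v) = v := by
      filter_upwards [hV.mem_nhds hxV] with v hv
      exact ((hπl _ (s v)).2 ⟨g, rfl⟩).trans (hsV v hv)
    have h2 := surjective_mfderiv_of_local_section (s := fun v ↦ g • s v)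
      (hπ.mdifferentiable (by simp) _) hsm h1
    have h3 : ∀ y : M, y = x → Function.Surjective (mfderiv 𝓘(ℝ, E) 𝓘(ℝ, F) π y) →
        Function.Surjective (mfderiv 𝓘(ℝ, E) 𝓘(ℝ, F) π x) := by rintro y rfl h; exact h
    exact h3 _ hg h2
  have horbit : ContMDiff 𝓘(ℝ, EG) 𝓘(ℝ, E) ∞ (fun g : G ↦ op g • x₀) :=
    hright.comp (contMDiff_id.prodMk contMDiff_const)
  have hdim : finrank ℝ EG = Fintype.card ι := Module.finrank_eq_card_basis b
  have hfin : finrank ℝ E = finrank ℝ F + Fintype.card ι := by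
    -- The upper bound holds because the connected, hence second countable, group `G` covers a
    -- fibre; the lower bound because `dπ` and the forms are jointly surjective.
    apply le_antisymm
    · have := topologicalGroup_of_lieGroup 𝓘(ℝ, EG) ∞ (G := G)
      have := ChartedSpace.locallyCompactSpace EG G
      have := sigmaCompactSpace_of_connectedSpace G
      have := ChartedSpace.secondCountable_of_sigmaCompact EG G
      rw [← hdim]
      exact finrank_le_of_fiber_subset_range (hsub.isSubmersionAt x₀) horbit
        fun y hy ↦ (hπr x₀ y).1 hy.symm
    · let D : E →ₗ[ℝ] F := (mfderiv 𝓘(ℝ, E) 𝓘(ℝ, F) π x₀).toLinearMap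
      let Θ : ι → E →ₗ[ℝ] ℝ := fun i ↦ (θ i x₀).toLinearMap
      have h1 := LinearMap.finrank_le_finrank_of_surjective <|
        surjective_prod_pi_of_dual (D := D) (Θ := Θ)
          (X := fun j ↦ (rightGenerator (b j) x₀ : E)) (hsurj x₀) (fun i j ↦ hdual i j x₀)
          (fun j ↦ mfderiv_mfderiv_orbit_eq_zero hπ horbit (by simp)
            (fun g ↦ ((hπr x₀ _).2 ⟨g, rfl⟩).symm) (b j))
      rwa [finrank_prod, finrank_fintype_fun_eq_card] at h1
  refine ⟨⟨hright, hfree_right, hπ, hsurj, hπr, hfin, hθ, hdual, hd⟩, hleft, hfree_left,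
    fun g x ↦ (hπl _ x).2 ⟨g, rfl⟩, hθ', hdual', hd', fun x v ↦ ?_⟩
  -- Evaluation at `v`: forms vanish on `v` exactly when their span lies in its kernel, so equal
  -- spans have the same horizontal vectors.
  let ev : (TangentSpace 𝓘(ℝ, E) x →L[ℝ] ℝ) →ₗ[ℝ] ℝ :=
    { toFun := fun α ↦ α v, map_add' := fun _ _ ↦ rfl, map_smul' := fun _ _ ↦ rfl }
  have key : ∀ α : ι → OneForm E M, (∀ i, α i x v = 0) ↔
      Submodule.span ℝ (Set.range fun i ↦ α i x) ≤
        LinearMap.ker ev := fun α ↦ by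
    rw [Submodule.span_le, range_subset_iff]; rfl
  rw [key, key, hspan]

end Construction

end MaurerCartan

end

/-! ### The theorem -/

theorem theorem5p1
    {EG G E M : Type*}
    -- the connected Lie group `G`
    [NormedAddCommGroup EG] [NormedSpace ℝ EG] [FiniteDimensional ℝ EG]
    [TopologicalSpace G] [ChartedSpace EG G] [Group G] [LieGroup 𝓘(ℝ, EG) ∞ G]
    [ConnectedSpace G]
    -- the manifold `M`
    [NormedAddCommGroup E] [NormedSpace ℝ E] [FiniteDimensional ℝ E]
    [TopologicalSpace M] [ChartedSpace E M] [IsManifold 𝓘(ℝ, E) ∞ M] [T2Space M]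
    -- the Maurer-Cartan forms and the structure constants of `G`
    {ι : Type*} [Fintype ι] [DecidableEq ι]
    (b : Module.Basis ι ℝ (GroupLieAlgebra 𝓘(ℝ, EG) G))
    (C : ι → ι → ι → ℝ)
    (hCL : MaurerCartan.SatisfiesStructureEquations C (MaurerCartan.leftForm b))
    (hCR : MaurerCartan.SatisfiesStructureEquations (-C) (MaurerCartan.rightForm b))
    -- commuting left and right actions, smooth, free, regular, with common orbits
    [MulAction G M] [MulAction Gᵐᵒᵖ M] [SMulCommClass G Gᵐᵒᵖ M]
    (hleft : ContMDiff (𝓘(ℝ, EG).prod 𝓘(ℝ, E)) 𝓘(ℝ, E) ∞ (fun p : G × M ↦ p.1 • p.2))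
    (hright : ContMDiff (𝓘(ℝ, EG).prod 𝓘(ℝ, E)) 𝓘(ℝ, E) ∞
      (fun p : G × M ↦ MulOpposite.op p.1 • p.2))
    (hfree_left : ∀ (g : G) (x : M), g • x = x → g = 1)
    (hfree_right : ∀ (g : G) (x : M), MulOpposite.op g • x = x → g = 1)
    (hreg_left : MaurerCartan.IsRegularAction E M G)
    (hreg_right : MaurerCartan.IsRegularAction E M Gᵐᵒᵖ)
    (horbits : ∀ x : M, MulAction.orbit G x = MulAction.orbit Gᵐᵒᵖ x)
    -- the `1`-forms on `M`
    (ωhat ωcheck : ι → MaurerCartan.OneForm E M)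
    (hsmooth_hat : ∀ i, MaurerCartan.OneForm.IsSmooth (ωhat i))
    (hsmooth_check : ∀ i, MaurerCartan.OneForm.IsSmooth (ωcheck i))
    (hdual_hat : ∀ (i j : ι) (x : M),
      ωhat i x (MaurerCartan.rightGenerator (b j) x) = if i = j then 1 else 0)
    (hdual_check : ∀ (i j : ι) (x : M),
      ωcheck i x (MaurerCartan.leftGenerator (b j) x) = if i = j then 1 else 0)
    (hspan : ∀ x : M, Submodule.span ℝ (Set.range fun i ↦ ωhat i x) =
      Submodule.span ℝ (Set.range fun i ↦ ωcheck i x))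
    (x₀ : M) (hx₀ : ∀ i, ωhat i x₀ = ωcheck i x₀)
    (hd_hat : MaurerCartan.SatisfiesStructureEquations C ωhat)
    (hd_check : MaurerCartan.SatisfiesStructureEquations (-C) ωcheck) :
    (∀ y ∈ connectedComponent x₀, ∃ U : Set M, IsOpen U ∧ y ∈ U ∧
      (∀ g : G, ∀ x ∈ U, g • x ∈ U ∧ MulOpposite.op g • x ∈ U) ∧
      ∃ ρ : M → G, MaurerCartan.IsBiequivariantPrimitive b ωhat ωcheck U ρ) ∧
    (SimplyConnectedSpace (MulAction.orbitRel.Quotient G M) →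
      ∃ ρ : M → G, MaurerCartan.IsBiequivariantPrimitive b ωhat ωcheck Set.univ ρ) := by
  obtain ⟨k, hchart, hman, hsub, hsection⟩ := hreg_left
  have h := MaurerCartan.isFlatBiconnection_orbitRel hleft hright hfree_left hfree_right horbits
    hsub hsection hsmooth_hat hsmooth_check hdual_hat hdual_check hspan hd_hat hd_check x₀
  constructor
  · intro y hy
    obtain ⟨V, κ, O, σ, ρ, T, hyV, hS⟩ := h.exists_isFlatTrivialization_section
      isPreconnected_connectedComponent mem_connectedComponent hx₀ hy
    refine ⟨_, T.isOpen_preimage h.toIsFlatConnection, hyV, fun g x hx ↦ ?_, ρ,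
      h.isBiequivariantPrimitive T hS⟩
    rw [mem_preimage, mem_preimage, h.proj_smul_left, h.proj_smul]
    exact ⟨hx, hx⟩
  · intro hsc
    -- A simply connected orbit space is connected, and so are the orbits; hence `M` is the
    -- component of `x₀`.
    have : PreconnectedSpace M := MaurerCartan.preconnectedSpace_of_orbitRel_quotient
      fun x ↦ (h.contMDiff_orbit_left x).continuous
    exact h.exists_isBiequivariantPrimitive Quotient.mk_surjective hx₀
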